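/- Setting. Let $d\ge 2$, $N\ge 1$, let $\mathcal H$ be a complex Hilbert space and $H\ge 0$ a (possibly unbounded) self-adjoint operator on $\mathcal H$ with a unit vector $\Omega$ such that $H\Omega=0$ and $H\ge 1$ on $\Omega^\perp$. On $\bigotimes_{\mathbf i\in\{1,\dots,N\}^d}\mathcal H$ let $H_{\mathbf i}$ and $P_{\Omega_{\mathbf i}}$ be the operators acting as $H$ and as the orthogonal projection onto $\mathbb C\Omega$ on the factor $\mathbf i$. For $\mathbf k\in\mathbb N_0^d$ and $\mathbf q$ with $1\le q_j$ and $q_j+k_j\le N$ let $J_{\mathbf k,\mathbf q}=\{\mathbf i:\ q_j\le i_j\le q_j+k_j\ \forall j\}$, a rectangle of size $|\mathbf k|=\sum_j k_j$; for a rectangle $J$ put $$H^0_J=\sum_{\mathbf i\in J}H_{\mathbf i},\qquad \pi_J=\sum_{\mathbf i\in J}(1-P_{\Omega_{\mathbf i}}),\qquad P^{(-)}_J=\prod_{\mathbf i\in J}P_{\Omega_{\mathbf i}},\qquad P^{(+)}_J=1-P^{(-)}_J,$$ $[X]_1=X+1$ and $\|V\|_{H^0}=\|[H^0_J]_1^{-1/2}V[H^0_J]_1^{-1/2}\|$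 for an operator (or quadratic form) $V$ belonging to $J$. Rectangles are totally ordered: $(\mathbf k',\mathbf q')\succ(\mathbf k,\mathbf q)$ if $|\mathbf k'|>|\mathbf k|$; or $|\mathbf k'|=|\mathbf k|$ and, at the first $j$ with $k_j\neq k'_j$, $k'_j<k_j$; or $\mathbf k'=\mathbf k$ and, at the last $j$ with $q_j\ne q'_j$, $q'_j>q_j$. Write $s_{-1}$ for the predecessor of $s$. For every $J$ of size $1$ let $V_J$ be a symmetric form on $D((H^0_J)^{1/2})$, acting as the identity on the factors outside $J$, with $|\langle\phi,V_J\phi\rangle|\le\frac12\langle\phi,(H^0_J+1)\phi\rangle$. Let $t\ge 0$. The effective potentials $V^{(s)}_J$, for rectangles $J$ and steps $s$, are forms on $D((H^0_J)^{1/2})$ defined recursively. Before the first step (that is, for the last rectangle $s$ of size $0$) they are $H_{\mathbf i}$ if $J=\{\mathbf i\}$, $V_J$ if $J$ has size $1$, and $0$ if $J$ is larger. For a rectangle $K$ of size at least $1$ put $$G_K=H^0_K+t\sum_{J\subsetneq K,\ |J|\ge 1}V_J^{(K_{-1})},\qquad E_K=\Big\langle\bigotimes\Omega,\,G_K\bigotimes\Omega\Big\rangle,$$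 where $|J|$ is the size of $J$. With $V=V^{(K_{-1})}_K$ let $(V)_1=V$, $S_j=(G_K-E_K)^{-1}P_K^{(+)}(V)_jP_K^{(-)}-\mathrm{h.c.}$, for $j\ge2$ $$(V)_j=\sum_{p\ge2,\ r_1+\dots+r_p=j}\tfrac1{p!}\,\mathrm{ad}S_{r_1}(\cdots\mathrm{ad}S_{r_p}(G_K))+\sum_{p\ge1,\ r_1+\dots+r_p=j-1}\tfrac1{p!}\,\mathrm{ad}S_{r_1}(\cdots\mathrm{ad}S_{r_p}(V))\qquad(r_i\ge1),$$ and $S_K=\sum_{j\ge1}t^jS_j$, where $\mathrm{ad}A(B)=AB-BA$. In step $K$ one sets: $V^{(K)}_K=\sum_{j\ge1}t^{j-1}\big(P^{(+)}_K(V)_jP^{(+)}_K+P^{(-)}_K(V)_jP^{(-)}_K\big)$; if $K\subsetneq J$, $V^{(K)}_J=V^{(K_{-1})}_J+\sum_{L}\sum_{n\ge1}\frac1{n!}\mathrm{ad}^nS_K(V^{(K_{-1})}_L)$, summed over the rectangles $L\subseteq J$ that meet $K$ and for which $J$ is the smallest rectangle containing $K\cup L$; and $V^{(K)}_J=V^{(K_{-1})}_J$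 in all other cases. (In the recursion, a term whose defining inverse or series does not exist is read as $0$.) For every rectangle $J$ of size $r\ge1$ fix rectangles $J_*$ and $J_{**}$ of sizes $\lfloor r^{1/4}\rfloor$ and $r-\lfloor r^{1/4}\rfloor$. The inductive bounds for $J$ in step $s$ are $$\|V^{(s)}_J\|_{H^0}\le\frac{t^{(r-1)/3}}{r^{22d}}\ \text{ if } s\prec J_*;\qquad \|V^{(s)}_J\|_{H^0}\le 2\,\frac{t^{(r-1)/3}}{r^{22d}}\ \text{ if } J_*\preceq s\prec J_{**};$$ $$\|V^{(s)}_J\|_{H^0}\le 48\,\frac{t^{(r-1)/3}}{r^{20d}}\ \text{ if } J_{**}\preceq s\prec J;\qquad \|V^{(s)}_J\|_{H^0}\le 96\,\frac{t^{(r-1)/3}}{r^{20d}}\ \text{ if } J\preceq s.$$ Lemma. For every $d\ge2$ there are constants $t_d>0$ and $C_d>0$, depending only on $d$, such that the following holds for all $\mathcal H$, $H$, $\Omega$, $N$, $(V_J)$ as above, all $0\le t<t_d$ and all choices of the rectangles $J_*,J_{**}$. Let $K$ be a rectangle of size at least $1$, and suppose that the inductive bounds hold in step $K_{-1}$ for every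 rectangle $J\preceq K$ of size at least $1$. Then there is exactly one bounded operator $T=(G_K-E_K)^{-1}P^{(+)}_KV_K^{(K_{-1})}P^{(-)}_K$, in the sense that $Ty\in D((H^0_K)^{1/2})\cap\operatorname{ran}P_K^{(+)}$ and $\langle z,(G_K-E_K)Ty\rangle=\langle P_K^{(+)}z,\,V^{(K_{-1})}_KP_K^{(-)}y\rangle$ as forms, for all vectors $y$ and all $z\in D((H^0_K)^{1/2})$; and $$\Big\|[H^0_K]_1^{1/2}[\pi_K]_1^{-1/2}\frac1{G_K-E_K}P^{(+)}_KV_K^{(K_{-1})}P^{(-)}_K\Big\|\ \le\ C_d\,\Big\|[\pi_K]_1^{-1/2}[H^0_K]_1^{-1/2}P^{(+)}_KV_K^{(K_{-1})}P^{(-)}_K\Big\|.$$ -/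

import Mathlib

open scoped TensorProduct ENNReal

namespace LieSchwinger

noncomputable section

section HilbertTensor

open scoped ComplexOrder

set_option linter.unusedSectionVars false

variable (ι : Type*) (E : Type*) [NormedAddCommGroup E] [InnerProductSpace ℂ E]

/-- The algebraic tensor product `⨂_{i ∈ ι} E`, as a type of its own (Mathlib's `⨂[ℂ] _ : ι, E`
already carries the projective seminorm, which is not the one needed here). -/
def AlgTensor : Type _ := ⨂[ℂ] _ : ι, E

instance : AddCommGroup (AlgTensor ι E) := inferInstanceAs (AddCommGroup (⨂[ℂ] _ : ι, E))
instance : Module ℂ (AlgTensor ι E) := inferInstanceAs (Module ℂ (⨂[ℂ] _ : ι, E))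

variable {ι E}

/-- The elementary tensor `⨂ x i`. -/
def algTprod (x : ι → E) : AlgTensor ι E := PiTensorProduct.tprod ℂ x

lemma exists_sum_algTprod (x : AlgTensor ι E) :
    ∃ (s : Finset (ι → E)) (c : (ι → E) → ℂ), x = ∑ v ∈ s, c v • algTprod v := by
  have hx : x ∈ Submodule.span ℂ (Set.range (algTprod : (ι → E) → AlgTensor ι E)) :=
    (PiTensorProduct.span_tprod_eq_top (R := ℂ) (s := fun _ : ι => E)).ge trivial
  obtain ⟨c, hc⟩ := Finsupp.mem_span_range_iff_exists_finsupp.1 hx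
  exact ⟨c.support, c, hc.symm⟩

lemma algTensor_ext {M : Type*} [AddCommMonoid M] [Module ℂ M] {f g : AlgTensor ι E →ₗ[ℂ] M}
    (h : ∀ x, f (algTprod x) = g (algTprod x)) : f = g :=
  PiTensorProduct.ext (MultilinearMap.ext h)

variable [Fintype ι]

/-- The linear functional `y ↦ ∏ ⟪x i, y i⟫` on the algebraic tensor product. -/
def algInnerLeft (x : ι → E) : AlgTensor ι E →ₗ[ℂ] ℂ :=
  PiTensorProduct.lift ((MultilinearMap.mkPiAlgebra ℂ ι ℂ).compLinearMap
    (fun i => (innerSL ℂ (x i) : E →ₗ[ℂ] ℂ)))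

lemma algInnerLeft_tprod (x y : ι → E) :
    algInnerLeft x (algTprod y) = ∏ i, inner ℂ (x i) (y i) := by
  unfold algInnerLeft algTprod
  erw [PiTensorProduct.lift.tprod]
  simp

lemma prod_inner_update [DecidableEq ι] (x y : ι → E) (i : ι) (c : E) :
    (∏ j, inner ℂ (Function.update x i c j) (y j)) =
      inner ℂ c (y i) * ∏ j ∈ Finset.univ.erase i, inner ℂ (x j) (y j) := by
  rw [← Finset.mul_prod_erase _ _ (Finset.mem_univ i), Function.update_self]
  congr 1
  refine Finset.prod_congr rfl fun j hj => ?_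
  rw [Function.update_of_ne (Finset.ne_of_mem_erase hj)]

/-- `y ↦ conj (∏ ⟪x i, y i⟫)`, conjugate linear in `y` and multilinear in `x`. -/
def algInnerMulti : MultilinearMap ℂ (fun _ : ι => E) (AlgTensor ι E →ₗ⋆[ℂ] ℂ) where
  toFun x := (starLinearEquiv ℂ (A := ℂ) : ℂ →ₗ⋆[ℂ] ℂ).comp (algInnerLeft x)
  map_update_add' x i a b := by
    have h : algInnerLeft (Function.update x i (a + b)) =
        algInnerLeft (Function.update x i a) + algInnerLeft (Function.update x i b) := by
      refine algTensor_ext fun y => ?_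
      simp only [LinearMap.add_apply, algInnerLeft_tprod, prod_inner_update, inner_add_left,
        add_mul]
    ext y
    simp [h]
  map_update_smul' x i c a := by
    have h : algInnerLeft (Function.update x i (c • a)) =
        star c • algInnerLeft (Function.update x i a) := by
      refine algTensor_ext fun y => ?_
      simp only [LinearMap.smul_apply, algInnerLeft_tprod, prod_inner_update, inner_smul_left,
        mul_assoc, smul_eq_mul]
      rfl
    ext y
    simp [h]

/-- The form `⟪y, x⟫ = ∏ ⟪y i, x i⟫` (on elementary tensors), as a map of `x` and then `y`. -/
def algInnerFlip : AlgTensor ι E →ₗ[ℂ] (AlgTensor ι E →ₗ⋆[ℂ] ℂ) :=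
  PiTensorProduct.lift algInnerMulti

lemma algInnerFlip_tprod (x y : ι → E) :
    algInnerFlip (algTprod x) (algTprod y) = ∏ i, inner ℂ (y i) (x i) := by
  have : algInnerFlip (algTprod x) = algInnerMulti x := by
    unfold algInnerFlip algTprod
    exact PiTensorProduct.lift.tprod _
  rw [this]
  change star (algInnerLeft x (algTprod y)) = _
  rw [algInnerLeft_tprod, star_prod]
  exact Finset.prod_congr rfl fun i _ => inner_conj_symm _ _

lemma algInnerFlip_sum (s t : Finset (ι → E)) (c e : (ι → E) → ℂ) (f : (ι → E) → ι → E) :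
    algInnerFlip (∑ v ∈ s, c v • algTprod (f v)) (∑ w ∈ t, e w • algTprod (f w)) =
      ∑ v ∈ s, ∑ w ∈ t, star (e w) * c v * ∏ i, inner ℂ (f w i) (f v i) := by
  rw [map_sum, map_sum, Finset.sum_comm]
  refine Finset.sum_congr rfl fun w _ => ?_
  rw [LinearMap.sum_apply]
  refine Finset.sum_congr rfl fun v _ => ?_
  rw [LinearMap.map_smulₛₗ, LinearMap.map_smul, LinearMap.smul_apply, algInnerFlip_tprod,
    smul_eq_mul, smul_eq_mul, starRingEnd_apply]
  ring

lemma algInnerFlip_sum_id (s t : Finset (ι → E)) (c e : (ι → E) → ℂ) :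
    algInnerFlip (∑ v ∈ s, c v • algTprod v) (∑ w ∈ t, e w • algTprod w) =
      ∑ v ∈ s, ∑ w ∈ t, star (e w) * c v * ∏ i, inner ℂ (w i) (v i) :=
  algInnerFlip_sum s t c e id

lemma posSemidef_prod {n : Type*} [Finite n] (s : Finset ι) (A : ι → Matrix n n ℂ)
    (hA : ∀ i, (A i).PosSemidef) :
    (Matrix.of fun a b => ∏ i ∈ s, A i a b).PosSemidef := by
  classical
  induction s using Finset.induction_on with
  | empty =>
    have h : (Matrix.of fun a b => ∏ i ∈ (∅ : Finset ι), A i a b) =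
        Matrix.vecMulVec (fun _ : n => (1 : ℂ)) (star fun _ : n => (1 : ℂ)) := by
      ext a b
      simp [Matrix.vecMulVec]
    rw [h]
    exact Matrix.posSemidef_vecMulVec_self_star _
  | insert i s hi ih =>
    have h : (Matrix.of fun a b => ∏ i ∈ insert i s, A i a b) =
        (A i).hadamard (Matrix.of fun a b => ∏ i ∈ s, A i a b) := by
      ext a b
      simp [Finset.prod_insert hi, Matrix.hadamard]
    rw [h]
    exact (hA i).hadamard ih

/-- The entrywise product of the Gram matrices of the images under `B i` is dominated by
`∏ ‖B i‖ ^ 2` times that of the original Gram matrices. -/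
lemma posSemidef_prod_sub {n : Type*} [Finite n] (s : Finset ι) (x : n → ι → E)
    (B : ι → E →L[ℂ] E) :
    (Matrix.of fun a b => (∏ i ∈ s, (‖B i‖ ^ 2 : ℝ) • inner ℂ (x a i) (x b i)) -
      ∏ i ∈ s, inner ℂ (B i (x a i)) (B i (x b i))).PosSemidef := by
  classical
  induction s using Finset.induction_on with
  | empty =>
    have h : (Matrix.of fun a b => (∏ i ∈ (∅ : Finset ι), (‖B i‖ ^ 2 : ℝ) •
        inner ℂ (x a i) (x b i)) - ∏ i ∈ (∅ : Finset ι), inner ℂ (B i (x a i)) (B i (x b i))) =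
        (0 : Matrix n n ℂ) := by
      ext a b
      simp
    rw [h]
    exact Matrix.PosSemidef.zero
  | insert i s hi ih =>
    have h1 := (Matrix.posSemidef_opNorm_smul_gram_sub_gram (𝕜 := ℂ) (fun a => x a i)
      (B i)).hadamard
      (posSemidef_prod s (fun i => (‖B i‖ ^ 2 : ℝ) • Matrix.gram ℂ (fun a => x a i))
        fun i => (Matrix.posSemidef_gram ℂ _).smul (by positivity))
    have h2 := (Matrix.posSemidef_gram ℂ (fun a => B i (x a i))).hadamard ih
    have h3 := h1.add h2
    refine (congrArg Matrix.PosSemidef ?_).mp h3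
    ext a b
    simp only [Finset.prod_insert hi, Matrix.hadamard, Matrix.gram, Matrix.add_apply,
      Matrix.of_apply, Matrix.sub_apply, Matrix.smul_apply, Function.comp_apply]
    ring

lemma re_sum_nonneg_of_posSemidef (s : Finset (ι → E)) (c : (ι → E) → ℂ)
    (f : (ι → E) → (ι → E) → ℂ)
    (hM : (Matrix.of fun v w : s => f v w).PosSemidef) :
    0 ≤ (∑ v ∈ s, ∑ w ∈ s, star (c w) * c v * f w v).re := by
  have h := hM.re_dotProduct_nonneg (fun v : s => c v)
  convert h using 1
  simp only [dotProduct, Matrix.mulVec, Finset.mul_sum, Matrix.of_apply, Pi.star_apply]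
  rw [Finset.sum_comm, ← Finset.sum_coe_sort s]
  refine congrArg _ (Finset.sum_congr rfl fun v _ => ?_)
  rw [← Finset.sum_coe_sort s]
  refine Finset.sum_congr rfl fun w _ => ?_
  ring

/-- The inner product `⟪⨂ x i, ⨂ y i⟫ = ∏ ⟪x i, y i⟫` on the algebraic tensor product. -/
@[reducible]
def algTensorCore : PreInnerProductSpace.Core ℂ (AlgTensor ι E) where
  inner x y := algInnerFlip y x
  conj_inner_symm x y := by
    obtain ⟨s, c, rfl⟩ := exists_sum_algTprod x
    obtain ⟨t, e, rfl⟩ := exists_sum_algTprod y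
    rw [algInnerFlip_sum_id s t c e, algInnerFlip_sum_id t s e c, map_sum, Finset.sum_comm]
    simp only [map_sum]
    refine Finset.sum_congr rfl fun v _ => Finset.sum_congr rfl fun w _ => ?_
    simp only [map_mul, map_prod, inner_conj_symm]
    simp only [starRingEnd_apply, star_star]
    ring
  re_inner_nonneg x := by
    obtain ⟨s, c, rfl⟩ := exists_sum_algTprod x
    rw [algInnerFlip_sum_id s s c c]
    exact re_sum_nonneg_of_posSemidef s c (fun v w => ∏ i, inner ℂ (v i) (w i))
      (posSemidef_prod Finset.univ (fun i => Matrix.gram ℂ fun v : s => (v : ι → E) i)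
        fun i => Matrix.posSemidef_gram ℂ _)
  add_left x y z := map_add _ _ _
  smul_left x y r := LinearMap.map_smulₛₗ _ _ _

instance : SeminormedAddCommGroup (AlgTensor ι E) :=
  @InnerProductSpace.Core.toSeminormedAddCommGroup ℂ _ _ _ _ algTensorCore

instance : InnerProductSpace ℂ (AlgTensor ι E) :=
  InnerProductSpace.ofCore algTensorCore

lemma norm_sq_algTensor (x : AlgTensor ι E) : ‖x‖ ^ 2 = (algInnerFlip x x).re :=
  norm_sq_eq_re_inner (𝕜 := ℂ) x

/-- `⨂ B i` on the algebraic tensor product, as a linear map. -/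
def algTensorLin (B : ι → E →L[ℂ] E) : AlgTensor ι E →ₗ[ℂ] AlgTensor ι E :=
  PiTensorProduct.map (fun i => (B i : E →ₗ[ℂ] E))

lemma algTensorLin_tprod (B : ι → E →L[ℂ] E) (x : ι → E) :
    algTensorLin B (algTprod x) = algTprod fun i => B i (x i) :=
  PiTensorProduct.map_tprod _ _

lemma norm_algTensorLin_le (B : ι → E →L[ℂ] E) (x : AlgTensor ι E) :
    ‖algTensorLin B x‖ ≤ (∏ i, ‖B i‖) * ‖x‖ := by
  refine le_of_sq_le_sq ?_ (by positivity)
  obtain ⟨s, c, rfl⟩ := exists_sum_algTprod x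
  rw [map_sum]
  simp only [map_smul, algTensorLin_tprod]
  rw [mul_pow, norm_sq_algTensor, norm_sq_algTensor, algInnerFlip_sum_id s s c c,
    algInnerFlip_sum s s c c fun v i => B i (v i), ← sub_nonneg]
  have h := re_sum_nonneg_of_posSemidef s c (fun v w =>
    (∏ i, (‖B i‖ ^ 2 : ℝ) • inner ℂ (v i) (w i)) - ∏ i, inner ℂ (B i (v i)) (B i (w i)))
    (posSemidef_prod_sub Finset.univ (fun v : s => (v : ι → E)) B)
  refine h.trans_eq ?_
  symm
  rw [← Complex.re_ofReal_mul, ← Complex.sub_re, Finset.mul_sum, ← Finset.sum_sub_distrib]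
  congr 1
  refine Finset.sum_congr rfl fun v _ => ?_
  rw [Finset.mul_sum, ← Finset.sum_sub_distrib]
  refine Finset.sum_congr rfl fun w _ => ?_
  simp only [Complex.real_smul, Finset.prod_mul_distrib]
  push_cast
  rw [← Finset.prod_pow]
  ring

variable (ι E) in
/-- The Hilbert space tensor product `⨂_{i ∈ ι} E`: the completion of the algebraic one. -/
abbrev HTensor : Type _ := UniformSpace.Completion (AlgTensor ι E)

/-- The elementary tensor `⨂ x i` in the Hilbert space tensor product. -/
def htprod (x : ι → E) : HTensor ι E := ((algTprod x : AlgTensor ι E) : HTensor ι E)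

/-- The bounded operator `⨂ B i` on the Hilbert space tensor product. -/
def tensorMap (B : ι → E →L[ℂ] E) : HTensor ι E →L[ℂ] HTensor ι E :=
  ((algTensorLin B).mkContinuous _ (norm_algTensorLin_le B)).completion

/-- The operator acting as `B` on the factor `i` and as the identity on the others. -/
def siteOp [DecidableEq ι] (i : ι) (B : E →L[ℂ] E) : HTensor ι E →L[ℂ] HTensor ι E :=
  tensorMap (Function.update 1 i B)

end HilbertTensor

section OneSite

/-- The one-site data: a non-negative self-adjoint operator `H` on the Hilbert space `𝓗`, possibly
unbounded, with a unit vector `Ω` such that `H Ω = 0` and `H ≥ 1` on the orthogonal complement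
of `Ω`. -/
structure SiteData (𝓗 : Type*) [NormedAddCommGroup 𝓗] [InnerProductSpace ℂ 𝓗]
    [CompleteSpace 𝓗] where
  H : 𝓗 →ₗ.[ℂ] 𝓗
  selfAdjoint : IsSelfAdjoint H
  nonneg : ∀ x : H.domain, 0 ≤ (inner ℂ (H x) (x : 𝓗)).re
  Ω : 𝓗
  norm_Ω : ‖Ω‖ = 1
  Ω_mem : Ω ∈ H.domain
  H_Ω : H ⟨Ω, Ω_mem⟩ = 0
  gap : ∀ x : H.domain, inner ℂ Ω (x : 𝓗) = 0 → ‖(x : 𝓗)‖ ^ 2 ≤ (inner ℂ (H x) (x : 𝓗)).re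

variable {𝓗 : Type*} [NormedAddCommGroup 𝓗] [InnerProductSpace ℂ 𝓗] [CompleteSpace 𝓗]

/-- `R = (H + 1)⁻¹`. -/
def SiteData.IsResolvent (S : SiteData 𝓗) (R : 𝓗 →L[ℂ] 𝓗) : Prop :=
  ∀ x, ∃ h : R x ∈ S.H.domain, S.H ⟨R x, h⟩ + R x = x

open Classical in
/-- The bounded operator `(H + 1)⁻¹`; it exists and is unique because `H` is self-adjoint and
non-negative. -/
def SiteData.resolvent (S : SiteData 𝓗) : 𝓗 →L[ℂ] 𝓗 :=
  if h : ∃ R, S.IsResolvent R then h.choose else 0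

/-- The bounded operator `(H + 1) ^ (-1/2)`, the positive square root of `(H + 1)⁻¹`. -/
def SiteData.invSqrt (S : SiteData 𝓗) : 𝓗 →L[ℂ] 𝓗 := CFC.sqrt S.resolvent

/-- The orthogonal projection onto `ℂ Ω`. -/
def SiteData.projΩ (S : SiteData 𝓗) : 𝓗 →L[ℂ] 𝓗 := (Submodule.span ℂ {S.Ω}).starProjection

end OneSite

section Lattice

variable {ι : Type*} [Fintype ι] [DecidableEq ι]
variable {𝓗 : Type*} [NormedAddCommGroup 𝓗] [InnerProductSpace ℂ 𝓗] [CompleteSpace 𝓗]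

/-- The operator `(H_i + 1) ^ (1/2)` on `⨂ 𝓗`, where `H_i` acts as `H` on the factor `i`: the
(unbounded) inverse of `(H_i + 1) ^ (-1/2)`. -/
def sqrtSite (S : SiteData 𝓗) (i : ι) : HTensor ι 𝓗 →ₗ.[ℂ] HTensor ι 𝓗 :=
  ((siteOp i S.invSqrt : HTensor ι 𝓗 →ₗ[ℂ] HTensor ι 𝓗).toPMap ⊤).inverse

/-- The form domain `D((H⁰_A) ^ (1/2)) = ⋂_{i ∈ A} D((H_i) ^ (1/2))` of `H⁰_A = ∑_{i ∈ A} H_i`. -/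
def formDomain (S : SiteData 𝓗) (A : Finset ι) : Submodule ℂ (HTensor ι 𝓗) :=
  ⨅ i ∈ A, (sqrtSite S i).domain

lemma formDomain_anti (S : SiteData 𝓗) {A B : Finset ι} (h : A ⊆ B) :
    formDomain S B ≤ formDomain S A :=
  biInf_mono fun _ hi => h hi

lemma formDomain_le (S : SiteData 𝓗) {A : Finset ι} {i : ι} (h : i ∈ A) :
    formDomain S A ≤ (sqrtSite S i).domain :=
  iInf₂_le i h

/-- Sesquilinear forms on `D((H⁰_A) ^ (1/2))`, conjugate linear in the first argument: the form of
an operator `V` is `(x, y) ↦ ⟪x, V y⟫`. -/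
abbrev Form (S : SiteData 𝓗) (A : Finset ι) : Type _ :=
  formDomain S A →ₗ⋆[ℂ] formDomain S A →ₗ[ℂ] ℂ

variable {S : SiteData 𝓗} {A B : Finset ι}

open Classical in
/-- The value `v(x, y)` for `x`, `y` in the form domain (and `0` for other vectors). -/
def Form.eval (v : Form S A) (x y : HTensor ι 𝓗) : ℂ :=
  if h : x ∈ formDomain S A ∧ y ∈ formDomain S A then v ⟨x, h.1⟩ ⟨y, h.2⟩ else 0

/-- The form of the identity, `(x, y) ↦ ⟪x, y⟫`. -/
def formOne (S : SiteData 𝓗) (A : Finset ι) : Form S A :=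
  LinearMap.mk₂'ₛₗ (starRingEnd ℂ) (RingHom.id ℂ)
    (fun x y => inner ℂ (x : HTensor ι 𝓗) (y : HTensor ι 𝓗))
    (fun x x' y => by simp [inner_add_left]) (fun c x y => by simp [inner_smul_left])
    (fun x y y' => by simp [inner_add_right]) (fun c x y => by simp [inner_smul_right])

/-- The form of `H_i + 1` on `D((H⁰_A) ^ (1/2))`, for `i ∈ A`. -/
def formSiteAddOne (S : SiteData 𝓗) (A : Finset ι) (i : A) : Form S A :=
  let L : formDomain S A →ₗ[ℂ] HTensor ι 𝓗 :=
    (sqrtSite S (i : ι)).toFun.comp (Submodule.inclusion (formDomain_le S i.2))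
  LinearMap.mk₂'ₛₗ (starRingEnd ℂ) (RingHom.id ℂ) (fun x y => inner ℂ (L x) (L y))
    (fun x x' y => by simp [inner_add_left]) (fun c x y => by simp [inner_smul_left])
    (fun x y y' => by simp [inner_add_right]) (fun c x y => by simp [inner_smul_right])

/-- The form of `H⁰_A = ∑_{i ∈ A} H_i`. -/
def formH0 (S : SiteData 𝓗) (A : Finset ι) : Form S A :=
  ∑ i : A, (formSiteAddOne S A i - formOne S A)

open Classical in
/-- `‖(H⁰_A + 1) ^ (1/2) x‖`, equal to `∞` for `x` outside the domain of `(H⁰_A) ^ (1/2)`. -/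
def weight (S : SiteData 𝓗) (A : Finset ι) (x : HTensor ι 𝓗) : ℝ≥0∞ :=
  if x ∈ formDomain S A then
    ENNReal.ofReal (Real.sqrt (((formH0 S A + formOne S A).eval x x).re))
  else ⊤

/-- `P⁻_A`: the projection onto `Ω` in the factors `i ∈ A`, the identity in the others. -/
def projMinus (S : SiteData 𝓗) (A : Finset ι) : HTensor ι 𝓗 →L[ℂ] HTensor ι 𝓗 :=
  tensorMap fun i => if i ∈ A then S.projΩ else 1

/-- `P⁺_A = 1 - P⁻_A`. -/
def projPlus (S : SiteData 𝓗) (A : Finset ι) : HTensor ι 𝓗 →L[ℂ] HTensor ι 𝓗 :=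
  1 - projMinus S A

/-- The number operator `π_A = ∑_{i ∈ A} (1 - P_{Ω_i})`. -/
def numberOp (S : SiteData 𝓗) (A : Finset ι) : HTensor ι 𝓗 →L[ℂ] HTensor ι 𝓗 :=
  ∑ i ∈ A, (1 - siteOp i S.projΩ)

/-- `(π_A + 1) ^ (-1/2)`, by the continuous functional calculus. -/
def numberWeight (S : SiteData 𝓗) (A : Finset ι) : HTensor ι 𝓗 →L[ℂ] HTensor ι 𝓗 :=
  cfc (fun x : ℝ => (x + 1) ^ (-(1 / 2) : ℝ)) (numberOp S A)

/-- The product vector `⨂ Ω`. -/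
def vacuum (S : SiteData 𝓗) : HTensor ι 𝓗 := htprod fun _ => S.Ω

open Classical in
/-- A form on `D((H⁰_A) ^ (1/2))`, regarded as one on `D((H⁰_B) ^ (1/2))`, for `A ⊆ B`. -/
def Form.extend (B : Finset ι) (v : Form S A) : Form S B :=
  if h : A ⊆ B then
    (v.comp (Submodule.inclusion (formDomain_anti S h))).compl₂
      (Submodule.inclusion (formDomain_anti S h))
  else 0

open Classical in
/-- The form `(x, y) ↦ v(X† x, Y y)` of `X v Y`, for bounded operators `X`, `Y` such that `X†` and
`Y` leave the form domain invariant. -/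
def Form.sandwich (X Y : HTensor ι 𝓗 →L[ℂ] HTensor ι 𝓗) (v : Form S A) : Form S A :=
  if h : (∀ x ∈ formDomain S A, (ContinuousLinearMap.adjoint X : _ →ₗ[ℂ] _) x ∈ formDomain S A) ∧
      ∀ x ∈ formDomain S A, (Y : _ →ₗ[ℂ] _) x ∈ formDomain S A then
    (v.comp ((ContinuousLinearMap.adjoint X : _ →ₗ[ℂ] _).restrict h.1)).compl₂
      ((Y : _ →ₗ[ℂ] _).restrict h.2)
  else 0

/-- The commutator `ad X (v) = X v - v X`. -/
def Form.ad (X : HTensor ι 𝓗 →L[ℂ] HTensor ι 𝓗) (v : Form S A) : Form S A :=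
  v.sandwich X 1 - v.sandwich 1 X

/-- The block-diagonal part `P⁺ v P⁺ + P⁻ v P⁻`. -/
def Form.diag (v : Form S A) : Form S A :=
  v.sandwich (projPlus S A) (projPlus S A) + v.sandwich (projMinus S A) (projMinus S A)

open Classical in
/-- The sum of a series of forms. -/
def Form.tsum (f : ℕ → Form S A) : Form S A :=
  if h : ∀ x y, Summable fun n => f n x y then
    LinearMap.mk₂'ₛₗ (starRingEnd ℂ) (RingHom.id ℂ) (fun x y => ∑' n, f n x y)
      (fun x x' y => by simp only [map_add, LinearMap.add_apply]; exact (h x y).tsum_add (h x' y))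
      (fun c x y => by
        simp only [LinearMap.map_smulₛₗ, LinearMap.smul_apply, smul_eq_mul, tsum_mul_left])
      (fun x y y' => by simp only [map_add]; exact (h x y).tsum_add (h x y'))
      (fun c x y => by simp only [map_smul, smul_eq_mul, tsum_mul_left, RingHom.id_apply])
  else 0

/-- The weighted norm `‖(H⁰_A + 1) ^ (-1/2) v (H⁰_A + 1) ^ (-1/2)‖`, with values in `[0, ∞]`. -/
def Form.normH0 (v : Form S A) : ℝ≥0∞ :=
  sInf {C | ∀ x ∈ formDomain S A, ∀ y ∈ formDomain S A,
    ‖v.eval x y‖ₑ ≤ C * weight S A x * weight S A y}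

/-- `v` is symmetric. -/
def Form.IsSymm (v : Form S A) : Prop := ∀ x y, starRingEnd ℂ (v x y) = v y x

/-- `v` acts as the identity on the factors `j ∉ A`: it commutes with all bounded operators on these
factors. -/
def Form.IsLocal (v : Form S A) : Prop :=
  ∀ j ∉ A, ∀ b : 𝓗 →L[ℂ] 𝓗, ∀ x ∈ formDomain S A, ∀ y ∈ formDomain S A,
    v.eval x (siteOp j b y) = v.eval (ContinuousLinearMap.adjoint (siteOp j b) x) y

/-- The operator `T = (G - E)⁻¹ P⁺_A v P⁻_A`, in terms of the form `g` of `G`: `T y` is the vector in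
the range of `P⁺_A` and in the form domain with `⟪z, (G - E) T y⟫ = v(P⁺_A z, P⁻_A y)`. -/
def IsResolventTerm (g : Form S A) (E : ℂ) (v : Form S A)
    (T : HTensor ι 𝓗 →L[ℂ] HTensor ι 𝓗) : Prop :=
  ∀ y, T y ∈ formDomain S A ∧ projPlus S A (T y) = T y ∧ ∀ z ∈ formDomain S A,
    g.eval z (T y) - E * inner ℂ z (T y) = v.eval (projPlus S A z) (projMinus S A y)

open Classical in
/-- `(G - E)⁻¹ P⁺_A v P⁻_A`. -/
def resolventTerm (g : Form S A) (E : ℂ) (v : Form S A) : HTensor ι 𝓗 →L[ℂ] HTensor ι 𝓗 :=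
  if h : ∃! T, IsResolventTerm g E v T then h.choose else 0

/-- `(G - E)⁻¹ P⁺_A v P⁻_A - h.c.` -/
def antiTerm (g : Form S A) (E : ℂ) (v : Form S A) : HTensor ι 𝓗 →L[ℂ] HTensor ι 𝓗 :=
  resolventTerm g E v - ContinuousLinearMap.adjoint (resolventTerm g E v)

/-- The terms `v_j`, `j ≥ 1`, of the Lie-Schwinger series of `G + t v`: `v_1 = v` and, with
`S_r = (G - E)⁻¹ P⁺ v_r P⁻ - h.c.`,
`v_j = ∑_{p ≥ 2, r_1 + ⋯ + r_p = j} (1 / p!) ad S_{r_1} (⋯ ad S_{r_p} (G)) +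
∑_{p ≥ 1, r_1 + ⋯ + r_p = j - 1} (1 / p!) ad S_{r_1} (⋯ ad S_{r_p} (v))` for `j ≥ 2`. A
`Composition j` is a list of positive integers with sum `j`; the test `r < j`, always true
here, makes the recursion visibly well founded. -/
def seriesV (g : Form S A) (E : ℂ) (v : Form S A) : ℕ → Form S A
  | 0 => 0
  | 1 => v
  | j + 2 =>
    (∑ c : Composition (j + 2), if 2 ≤ c.length then
      ((c.length.factorial : ℂ)⁻¹) • c.blocks.foldr (fun r w =>
        Form.ad (if _h : r < j + 2 then antiTerm g E (seriesV g E v r) else 0) w) g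
      else 0) +
    ∑ c : Composition (j + 1), ((c.length.factorial : ℂ)⁻¹) • c.blocks.foldr (fun r w =>
        Form.ad (if _h : r < j + 2 then antiTerm g E (seriesV g E v r) else 0) w) v
  termination_by j => j

/-- The Lie-Schwinger generator `∑_{j ≥ 1} t ^ j S_j`. -/
def generator (t : ℝ) (g : Form S A) (E : ℂ) (v : Form S A) :
    HTensor ι 𝓗 →L[ℂ] HTensor ι 𝓗 :=
  ∑' j : ℕ, ((t : ℂ) ^ (j + 1)) • antiTerm g E (seriesV g E v (j + 1))

/-- The block-diagonalized potential `∑_{j ≥ 1} t ^ (j - 1) (v_j)^{diag}`. -/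
def diagonalized (t : ℝ) (g : Form S A) (E : ℂ) (v : Form S A) : Form S A :=
  Form.tsum fun j => ((t : ℂ) ^ j) • (seriesV g E v (j + 1)).diag

/-- `∑_{n ≥ 1} (1 / n!) ad^n X (v)`. -/
def adExp (X : HTensor ι 𝓗 →L[ℂ] HTensor ι 𝓗) (v : Form S A) : Form S A :=
  Form.tsum fun n => (((n + 1).factorial : ℂ)⁻¹) • (Form.ad X)^[n + 1] v

/-- `‖(H⁰_A + 1) ^ (1/2) (π_A + 1) ^ (-1/2) T‖`, with values in `[0, ∞]`. -/
def weightedNorm (S : SiteData 𝓗) (A : Finset ι) (T : HTensor ι 𝓗 →L[ℂ] HTensor ι 𝓗) : ℝ≥0∞ :=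
  sInf {C | ∀ y, weight S A (numberWeight S A (T y)) ≤ C * ‖y‖ₑ}

/-- `‖(π_A + 1) ^ (-1/2) (H⁰_A + 1) ^ (-1/2) P⁺_A v P⁻_A‖`, with values in `[0, ∞]`: the supremum of
`|v(P⁺_A (π_A + 1) ^ (-1/2) x, P⁻_A y)|` over `‖(H⁰_A + 1) ^ (1/2) x‖ ≤ 1` and `‖y‖ ≤ 1` (the
two weights commute). -/
def Form.doublyWeightedNorm (v : Form S A) : ℝ≥0∞ :=
  sInf {C | ∀ x ∈ formDomain S A, ∀ y,
    ‖v.eval (projPlus S A (numberWeight S A x)) (projMinus S A y)‖ₑ ≤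
      C * weight S A x * ‖y‖ₑ}

end Lattice

section Rectangles

/-- The sites `(i_1, …, i_d)`, `1 ≤ i_j ≤ N`. -/
abbrev Site (d N : ℕ) : Type := Fin d → Finset.Icc 1 N

/-- The rectangle with corner `q` and side lengths `k` in the lattice `{1, …, N} ^ d`. -/
@[ext]
structure Rect (d N : ℕ) where
  k : Fin d → ℕ
  q : Fin d → ℕ
  one_le : ∀ j, 1 ≤ q j
  le_N : ∀ j, q j + k j ≤ N

namespace Rect

variable {d N : ℕ}

instance : Finite (Rect d N) := by
  refine Finite.of_injective
    (fun J : Rect d N => ((fun j => ⟨J.k j, by have := J.le_N j; omega⟩,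
      fun j => ⟨J.q j, by have := J.le_N j; omega⟩) :
        (Fin d → Fin (N + 1)) × (Fin d → Fin (N + 1)))) fun J L h => ?_
  simp only [Prod.mk.injEq, funext_iff, Fin.mk.injEq] at h
  exact Rect.ext (funext h.1) (funext h.2)

instance : Fintype (Rect d N) := Fintype.ofFinite _

/-- The size `|k| = k_1 + ⋯ + k_d`. -/
def size (J : Rect d N) : ℕ := ∑ j, J.k j

/-- The set of sites of the rectangle. -/
def sites (J : Rect d N) : Finset (Site d N) :=
  {i | ∀ j, J.q j ≤ (i j : ℕ) ∧ (i j : ℕ) ≤ J.q j + J.k j}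

/-- The order on rectangles: by size; then, at the first side length that differs, the larger side
length comes first; then by the last corner coordinate that differs. -/
instance : LT (Rect d N) where
  lt J L := J.size < L.size ∨
    (J.size = L.size ∧ ∃ j, (∀ l < j, L.k l = J.k l) ∧ L.k j < J.k j) ∨
    ((∀ l, L.k l = J.k l) ∧ ∃ j, (∀ l, j < l → L.q l = J.q l) ∧ J.q j < L.q j)

instance : LE (Rect d N) where
  le J L := J = L ∨ J < L

/-- `J` is the smallest rectangle that contains `s` and `L`. -/
def IsHull (s L J : Rect d N) : Prop :=
  ∀ j, J.q j = min (s.q j) (L.q j) ∧ J.q j + J.k j = max (s.q j + s.k j) (L.q j + L.k j)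

/-- The position of the rectangle in the order. -/
def index (J : Rect d N) : ℕ := Nat.card {L : Rect d N // L < J}

end Rect

end Rectangles

section Algorithm

variable {d N : ℕ}
variable {𝓗 : Type*} [NormedAddCommGroup 𝓗] [InnerProductSpace ℂ 𝓗] [CompleteSpace 𝓗]

/-- A potential for every rectangle. -/
abbrev Potentials (S : SiteData 𝓗) (d N : ℕ) : Type _ := ∀ J : Rect d N, Form S J.sites

/-- A nearest-neighbour interaction: the potentials of the rectangles of size 1 are symmetric,
localized, and satisfy `|⟪φ, V_J φ⟫| ≤ (1/2) ⟪φ, (H⁰_J + 1) φ⟫`. (The other values are not used.) -/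
structure IsInteraction {S : SiteData 𝓗} (V : Potentials S d N) : Prop where
  symm : ∀ J : Rect d N, J.size = 1 → (V J).IsSymm
  isLocal : ∀ J : Rect d N, J.size = 1 → (V J).IsLocal
  bound : ∀ J : Rect d N, J.size = 1 → ∀ x ∈ formDomain S J.sites,
    ‖(V J).eval x x‖ ≤ 1 / 2 * ((formH0 S J.sites + formOne S J.sites).eval x x).re

variable {S : SiteData 𝓗}

open Classical in
/-- The form of `G_K = ∑_{i ∈ K} H_i + t ∑_{J ⊂ K, |J| ≥ 1} V_J`. -/
def formG (t : ℝ) (W : Potentials S d N) (K : Rect d N) : Form S K.sites :=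
  formH0 S K.sites +
    (t : ℂ) • ∑ J : Rect d N with J.sites ⊂ K.sites ∧ 1 ≤ J.size, (W J).extend K.sites

/-- `E_K = ⟪⨂ Ω, G_K ⨂ Ω⟫`. -/
def energy (t : ℝ) (W : Potentials S d N) (K : Rect d N) : ℂ :=
  (formG t W K).eval (vacuum S) (vacuum S)

/-- The generator `S_s` of the block-diagonalization of `G_s + t W_s`. -/
def stepGenerator (t : ℝ) (W : Potentials S d N) (s : Rect d N) :
    HTensor (Site d N) 𝓗 →L[ℂ] HTensor (Site d N) 𝓗 :=
  generator t (formG t W s) (energy t W s) (W s)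

/-- The potentials before the first step: `H_i` on the sites, the interaction on the rectangles of
size 1, and zero on the larger ones. -/
def initial (V : Potentials S d N) : Potentials S d N := fun J =>
  if J.size = 0 then formH0 S J.sites else if J.size = 1 then V J else 0

open Classical in
/-- The step of the algorithm that block-diagonalizes the potential of `s`, from the potentials `W`
after the previous step: a potential is unchanged unless its rectangle contains `s`; that of `s`
becomes its block-diagonalization; and to that of `J ⊃ s` one adds
`∑_L ∑_{n ≥ 1} (1 / n!) ad^n S_s (W_L)`, over the rectangles `L` that meet `s` and for which `J`
is the smallest rectangle containing `s` and `L`. -/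
def step (t : ℝ) (s : Rect d N) (W : Potentials S d N) : Potentials S d N := fun J =>
  if J = s then diagonalized t (formG t W J) (energy t W J) (W J)
  else if s.sites ⊂ J.sites then
    W J + ∑ L : Rect d N with L.sites ⊆ J.sites ∧ (s.sites ∩ L.sites).Nonempty ∧ s.IsHull L J,
      adExp (stepGenerator t W s) ((W L).extend J.sites)
  else W J

open Classical in
/-- The potentials after the step number `n`; no step is done at rectangles of size 0. -/
def effectiveAux (t : ℝ) (V : Potentials S d N) : ℕ → Potentials S d N
  | 0 => initial V
  | n + 1 =>
    if h : ∃ s : Rect d N, s.index = n + 1 ∧ 1 ≤ s.size then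
      step t h.choose (effectiveAux t V n)
    else effectiveAux t V n

/-- The effective potentials `V^{(s)}_J` in step `s`. -/
def effective (t : ℝ) (V : Potentials S d N) (s : Rect d N) : Potentials S d N :=
  effectiveAux t V s.index

/-- The inductive bounds on the potential `v` of the rectangle `J` (of size `r ≥ 1`) in step `s`, with
thresholds `a` and `b` between the regimes and `x_d = 20 d`. -/
structure InductiveBounds (t : ℝ) (s J a b : Rect d N) (v : Form S J.sites) : Prop where
  small : s < a → v.normH0 ≤ ENNReal.ofReal
    (t ^ (((J.size : ℝ) - 1) / 3) / (J.size : ℝ) ^ (20 * d + 2 * d))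
  middle : a ≤ s → s < b → v.normH0 ≤ ENNReal.ofReal
    (2 * (t ^ (((J.size : ℝ) - 1) / 3) / (J.size : ℝ) ^ (20 * d + 2 * d)))
  large : b ≤ s → s < J → v.normH0 ≤ ENNReal.ofReal
    (48 * (t ^ (((J.size : ℝ) - 1) / 3) / (J.size : ℝ) ^ (20 * d)))
  final : J ≤ s → v.normH0 ≤ ENNReal.ofReal
    (96 * (t ^ (((J.size : ℝ) - 1) / 3) / (J.size : ℝ) ^ (20 * d)))

end Algorithm

end

end LieSchwinger

open scoped TensorProduct ENNReal

namespace LieSchwinger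

noncomputable section

/-! ### Product operators on the Hilbert space tensor product. -/

section TensorMaps

set_option linter.unusedSectionVars false

variable {ι : Type*} [Fintype ι] {E : Type*} [NormedAddCommGroup E] [InnerProductSpace ℂ E]

/-! Every rectangle J strictly inside K of size at least 1 precedes K, so its potential V_J has
already been block-diagonalized and is not touched afterwards (`isBlockDiag_effectiveAux`). It is
also local: it acts as the identity outside J. Locality passes through the recursion because each
generator is built from resolvent terms, and a resolvent term is local by its own uniqueness
(`isLocalOp_resolventTerm`).

For a local form, P⁻_J V_J P⁻_J is the vacuum expectation of V_J times P⁻_J. Together with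
block-diagonality this gives V_J - ⟨V_J⟩ = P⁺_J (V_J - ⟨V_J⟩) P⁺_J. On ran P⁺_J the gap gives H⁰_J ≥
1, hence H⁰_J + 1 ≤ 2 H⁰_J, and a bound C on ‖V_J‖_{H⁰} becomes |V_J - ⟨V_J⟩| ≤ 3C H⁰_J
(`Form.norm_eval_sub_vacuum_le`). Since H⁰_K has no vacuum energy, G_K - E_K is exactly H⁰_K + t ∑_J
(V_J - ⟨V_J⟩). The bounds 96/r^{20d} are summable over the rectangles of size r that contain a given
site, so for t small depending on d only the interaction is at most H⁰_K / 2
(`norm_sum_le_half_energy`) and G_K - E_K ≥ H⁰_K / 2 (`IsTreated.half_energy_le`). A Lax-Milgram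
argument on D((H⁰_K)^{1/2}) ∩ ran P⁺_K then yields the operator T.

The weighted estimate needs the same coercivity after conjugation with M = (π_K + 1)^{-1/2}. M
commutes with H⁰_K but not with V_J. However, V_J does not couple different excitation patterns
outside J, so it commutes with the number of excitations in K outside J. That number plus one
differs from π_K + 1 by a factor between 1 and |J| + 1, now with |J| the number of sites. The
conjugation therefore costs at most |J| + 1 (`Form.norm_eval_sub_vacuum_weighted_le`), a power of r
that 1/r^{20d} absorbs.

Finally let u = T y and w = M u. Testing the equation for u with M w gives ½⟨w, H⁰_K w⟩ ≤ |⟨M w,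
(G_K - E_K) M⁻¹ w⟩| = |⟨P⁺ M w, V_K P⁻ y⟩|. The right side is at most the doubly weighted norm times
‖(H⁰_K + 1)^{1/2} w‖ ‖y‖, while ‖(H⁰_K + 1)^{1/2} w‖² ≤ 2⟨w, H⁰_K w⟩ because w lies in ran P⁺_K.
Dividing by ‖(H⁰_K + 1)^{1/2} w‖ gives the claim with C_d = 4 (`IsTreated.weightedNorm_le`). -/

lemma inner_htprod (x y : ι → E) :
    inner ℂ (htprod x) (htprod y) = ∏ i, inner ℂ (x i) (y i) := by
  unfold htprod
  rw [UniformSpace.Completion.inner_coe]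
  exact algInnerFlip_tprod y x

lemma tensorMap_htprod (B : ι → E →L[ℂ] E) (x : ι → E) :
    tensorMap B (htprod x) = htprod fun i => B i (x i) := by
  unfold tensorMap htprod
  rw [ContinuousLinearMap.completion_apply_coe]
  congr 1
  exact algTensorLin_tprod B x

variable (ι E) in
lemma dense_span_htprod :
    Dense (Submodule.span ℂ (Set.range (htprod : (ι → E) → HTensor ι E)) :
      Set (HTensor ι E)) := by
  refine (UniformSpace.Completion.denseRange_coe (α := AlgTensor ι E)).mono ?_
  rintro _ ⟨x, rfl⟩
  obtain ⟨s, c, rfl⟩ := exists_sum_algTprod x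
  have : ((∑ v ∈ s, c v • algTprod v : AlgTensor ι E) : HTensor ι E) =
      ∑ v ∈ s, c v • htprod v := by
    have h := map_sum (UniformSpace.Completion.toComplL (𝕜 := ℂ) (E := AlgTensor ι E))
      (fun v => c v • algTprod v) s
    simp only [map_smul] at h
    exact h
  rw [this]
  exact Submodule.sum_mem _ fun v _ =>
    Submodule.smul_mem _ _ (Submodule.subset_span ⟨v, rfl⟩)

/-- Two continuous linear maps that agree on elementary tensors agree. -/
lemma htensor_clm_ext {F : Type*} [NormedAddCommGroup F] [NormedSpace ℂ F]
    {f g : HTensor ι E →L[ℂ] F} (h : ∀ x, f (htprod x) = g (htprod x)) : f = g :=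
  ContinuousLinearMap.ext_on (dense_span_htprod ι E) (by rintro _ ⟨x, rfl⟩; exact h x)

lemma tensorMap_mul (B C : ι → E →L[ℂ] E) :
    tensorMap B * tensorMap C = tensorMap fun i => B i * C i :=
  htensor_clm_ext fun x => by simp [tensorMap_htprod]

lemma tensorMap_one : tensorMap (fun _ : ι => (1 : E →L[ℂ] E)) = 1 :=
  htensor_clm_ext fun x => by simp [tensorMap_htprod]

lemma htprod_eq_zero {x : ι → E} {i : ι} (h : x i = 0) : htprod x = 0 := by
  rw [← inner_self_eq_zero (𝕜 := ℂ), inner_htprod]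
  exact Finset.prod_eq_zero (Finset.mem_univ i) (by simp [h])

lemma tensorMap_eq_zero {B : ι → E →L[ℂ] E} {i : ι} (h : B i = 0) : tensorMap B = 0 :=
  htensor_clm_ext fun x => by
    rw [tensorMap_htprod]
    exact htprod_eq_zero (i := i) (by simp [h])

lemma norm_tensorMap_le (B : ι → E →L[ℂ] E) (x : HTensor ι E) :
    ‖tensorMap B x‖ ≤ (∏ i, ‖B i‖) * ‖x‖ := by
  induction x using UniformSpace.Completion.induction_on with
  | hp => exact isClosed_le (by fun_prop) (by fun_prop)
  | ih x =>
    unfold tensorMap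
    rw [ContinuousLinearMap.completion_apply_coe, UniformSpace.Completion.norm_coe,
      UniformSpace.Completion.norm_coe]
    exact norm_algTensorLin_le B x

lemma htprod_add_univ [DecidableEq ι] (x y : ι → E) :
    htprod (fun i => x i + y i) = ∑ s : Finset ι, htprod (s.piecewise x y) := by
  have h : algTprod (x + y) = ∑ s : Finset ι, algTprod (s.piecewise x y) :=
    (PiTensorProduct.tprod ℂ (s := fun _ : ι => E)).map_add_univ x y
  have h' := congrArg (UniformSpace.Completion.toComplL (𝕜 := ℂ) (E := AlgTensor ι E)) h
  rw [map_sum] at h'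
  exact h'

lemma htprod_smul (c : ι → ℂ) (x : ι → E) :
    htprod (fun i => c i • x i) = (∏ i, c i) • htprod x := by
  have h : algTprod (fun i => c i • x i) = (∏ i, c i) • algTprod x :=
    (PiTensorProduct.tprod ℂ (s := fun _ : ι => E)).map_smul_univ c x
  have h' := congrArg (UniformSpace.Completion.toComplL (𝕜 := ℂ) (E := AlgTensor ι E)) h
  rw [map_smul] at h'
  exact h'

lemma inner_ext_htprod {f g : HTensor ι E →L[ℂ] HTensor ι E}
    (h : ∀ x y, inner ℂ (htprod x) (f (htprod y)) = inner ℂ (htprod x) (g (htprod y))) :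
    f = g := by
  refine htensor_clm_ext fun y => ?_
  have : innerSL ℂ (f (htprod y)) = innerSL ℂ (g (htprod y)) := by
    refine htensor_clm_ext fun x => ?_
    simp only [innerSL_apply_apply]
    rw [← inner_conj_symm, h, inner_conj_symm]
  exact (innerSL_inj (𝕜 := ℂ)).1 this

variable [CompleteSpace E]

lemma adjoint_tensorMap (B : ι → E →L[ℂ] E) :
    ContinuousLinearMap.adjoint (tensorMap B) =
      tensorMap fun i => ContinuousLinearMap.adjoint (B i) := by
  refine inner_ext_htprod fun x y => ?_
  rw [ContinuousLinearMap.adjoint_inner_right, tensorMap_htprod, tensorMap_htprod,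
    inner_htprod, inner_htprod]
  simp [ContinuousLinearMap.adjoint_inner_right]

variable [DecidableEq ι]

lemma siteOp_mul (i : ι) (b c : E →L[ℂ] E) : siteOp i b * siteOp i c = siteOp i (b * c) := by
  unfold siteOp
  rw [tensorMap_mul]
  congr 1
  ext1 j
  rcases eq_or_ne j i with rfl | h
  · simp
  · simp [Function.update_of_ne h]

lemma siteOp_one (i : ι) : siteOp i (1 : E →L[ℂ] E) = 1 := by
  unfold siteOp
  rw [show Function.update (1 : ι → E →L[ℂ] E) i 1 = fun _ => 1 by
    rw [show (1 : E →L[ℂ] E) = (1 : ι → E →L[ℂ] E) i from rfl, Function.update_eq_self]; rfl]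
  exact tensorMap_one

lemma siteOp_apply_htprod (i : ι) (b : E →L[ℂ] E) (x : ι → E) :
    siteOp i b (htprod x) = htprod (Function.update x i (b (x i))) := by
  unfold siteOp
  rw [tensorMap_htprod]
  congr 1
  ext1 j
  rcases eq_or_ne j i with rfl | h
  · simp
  · simp [Function.update_of_ne h]

lemma htprod_update_add (x : ι → E) (i : ι) (a b : E) :
    htprod (Function.update x i (a + b)) =
      htprod (Function.update x i a) + htprod (Function.update x i b) := by
  have h : algTprod (Function.update x i (a + b)) =
      algTprod (Function.update x i a) + algTprod (Function.update x i b) :=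
    (PiTensorProduct.tprod ℂ (s := fun _ : ι => E)).map_update_add x i a b
  have h' := congrArg (UniformSpace.Completion.toComplL (𝕜 := ℂ) (E := AlgTensor ι E)) h
  rw [map_add] at h'
  exact h'

lemma htprod_update_smul (x : ι → E) (i : ι) (c : ℂ) (a : E) :
    htprod (Function.update x i (c • a)) = c • htprod (Function.update x i a) := by
  have h : algTprod (Function.update x i (c • a)) = c • algTprod (Function.update x i a) :=
    (PiTensorProduct.tprod ℂ (s := fun _ : ι => E)).map_update_smul x i c a
  have h' := congrArg (UniformSpace.Completion.toComplL (𝕜 := ℂ) (E := AlgTensor ι E)) h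
  rw [map_smul] at h'
  exact h'

lemma siteOp_add (i : ι) (b c : E →L[ℂ] E) : siteOp i (b + c) = siteOp i b + siteOp i c :=
  htensor_clm_ext fun x => by
    simp [siteOp_apply_htprod, htprod_update_add]

lemma siteOp_smul (i : ι) (c : ℂ) (b : E →L[ℂ] E) : siteOp i (c • b) = c • siteOp i b :=
  htensor_clm_ext fun x => by
    simp [siteOp_apply_htprod, htprod_update_smul]

lemma adjoint_siteOp (i : ι) (b : E →L[ℂ] E) :
    ContinuousLinearMap.adjoint (siteOp i b) = siteOp i (ContinuousLinearMap.adjoint b) := by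
  unfold siteOp
  rw [adjoint_tensorMap]
  congr 1
  ext1 j
  rcases eq_or_ne j i with rfl | h
  · simp
  · simp only [Function.update_of_ne h, Pi.one_apply]
    exact star_one (E →L[ℂ] E)

lemma commute_siteOp_tensorMap {i : ι} {b : E →L[ℂ] E} {B : ι → E →L[ℂ] E}
    (h : Commute b (B i)) : Commute (siteOp i b) (tensorMap B) := by
  unfold siteOp
  rw [Commute, SemiconjBy, tensorMap_mul, tensorMap_mul]
  congr 1
  ext1 j
  rcases eq_or_ne j i with rfl | hj
  · simpa using h.eq
  · simp [Function.update_of_ne hj]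

lemma commute_siteOp {i j : ι} {b c : E →L[ℂ] E} (h : i = j → Commute b c) :
    Commute (siteOp i b) (siteOp j c) := by
  refine commute_siteOp_tensorMap ?_
  rcases eq_or_ne i j with rfl | hij
  · simpa using h rfl
  · simp [Function.update_of_ne hij]

lemma norm_siteOp_le (i : ι) (b : E →L[ℂ] E) (hb : ‖b‖ ≤ 1) (x : HTensor ι E) :
    ‖siteOp i b x‖ ≤ ‖x‖ := by
  refine (norm_tensorMap_le _ x).trans (mul_le_of_le_one_left (norm_nonneg _) ?_)
  refine Finset.prod_le_one (fun _ _ => norm_nonneg _) fun j _ => ?_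
  rcases eq_or_ne j i with rfl | h
  · simpa using hb
  · rw [Function.update_of_ne h]
    exact ContinuousLinearMap.norm_id_le

end TensorMaps

/-! ### The one-site resolvent, its square root and the gap. -/

section OneSiteLemmas

variable {𝓗 : Type*} [NormedAddCommGroup 𝓗] [InnerProductSpace ℂ 𝓗] [CompleteSpace 𝓗]

namespace SiteData

variable (S : SiteData 𝓗)

lemma inner_H_left (x y : S.H.domain) :
    inner ℂ (S.H x) (y : 𝓗) = inner ℂ (x : 𝓗) (S.H y) := by
  have h := LinearPMap.adjoint_isFormalAdjoint S.selfAdjoint.dense_domain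
  rw [LinearPMap.isSelfAdjoint_def.1 S.selfAdjoint] at h
  exact h x y

lemma norm_sq_le_re_inner (x : S.H.domain) :
    ‖(x : 𝓗)‖ ^ 2 ≤ (inner ℂ (S.H x + (x : 𝓗)) (x : 𝓗)).re := by
  rw [inner_add_left, Complex.add_re]
  have h := inner_self_eq_norm_sq (𝕜 := ℂ) (x : 𝓗)
  have h0 := S.nonneg x
  change (inner ℂ (x : 𝓗) (x : 𝓗)).re = _ at h
  linarith

lemma norm_le_norm_H_add (x : S.H.domain) : ‖(x : 𝓗)‖ ≤ ‖S.H x + (x : 𝓗)‖ := by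
  have h := S.norm_sq_le_re_inner x
  have h2 : (inner ℂ (S.H x + (x : 𝓗)) (x : 𝓗)).re ≤ ‖S.H x + (x : 𝓗)‖ * ‖(x : 𝓗)‖ :=
    re_inner_le_norm (𝕜 := ℂ) _ _
  by_contra! hc
  nlinarith [norm_nonneg (S.H x + (x : 𝓗))]

lemma eq_zero_of_H_add_eq_zero (x : S.H.domain) (h : S.H x + (x : 𝓗) = 0) : (x : 𝓗) = 0 := by
  simpa [h] using S.norm_le_norm_H_add x

/-- `(x, H x) ↦ H x + x`, on the graph of `H`. -/
def graphAdd : S.H.graph →L[ℂ] 𝓗 :=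
  (ContinuousLinearMap.fst ℂ 𝓗 𝓗 + ContinuousLinearMap.snd ℂ 𝓗 𝓗).comp S.H.graph.subtypeL

/-- A vector z orthogonal to ran (H + 1) lies in D(H*) = D(H) and satisfies H z = -z, which
non-negativity forbids unless z = 0; so the range is dense. The bound ‖x‖ ≤ ‖(H + 1) x‖ gives
injectivity and closed range. On the graph, which is complete, H + 1 becomes a bounded map. -/
lemma graphAdd_bijective : Function.Bijective S.graphAdd := by
  have hcl : IsClosed (S.H.graph : Set (𝓗 × 𝓗)) := S.selfAdjoint.isClosed
  have : CompleteSpace S.H.graph := hcl.completeSpace_coe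
  rw [ContinuousLinearMap.bijective_iff_dense_range_and_antilipschitz]
  constructor
  · rw [Submodule.topologicalClosure_eq_top_iff, Submodule.eq_bot_iff]
    intro z hz
    have hz' : ∀ x : S.H.domain, inner ℂ (-z) (x : 𝓗) = inner ℂ z (S.H x) := by
      intro x
      have := (Submodule.mem_orthogonal' _ _).1 hz
        (S.graphAdd ⟨((x : 𝓗), S.H x), LinearPMap.mem_graph _ x⟩) ⟨_, rfl⟩
      simp only [graphAdd, ContinuousLinearMap.comp_apply, Submodule.subtypeL_apply,
        add_apply, ContinuousLinearMap.coe_fst',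
        ContinuousLinearMap.coe_snd', inner_add_right] at this
      rw [inner_neg_left, neg_eq_iff_add_eq_zero, this]
    have hsa := LinearPMap.isSelfAdjoint_def.1 S.selfAdjoint
    have hdom : z ∈ S.H.adjoint.domain :=
      LinearPMap.mem_adjoint_domain_of_exists z ⟨-z, hz'⟩
    have happ := LinearPMap.adjoint_apply_eq S.selfAdjoint.dense_domain ⟨z, hdom⟩ hz'
    have hdom' : z ∈ S.H.domain := hsa ▸ hdom
    have happ' : S.H ⟨z, hdom'⟩ = -z := by
      rw [← happ]
      have h := (LinearPMap.ext_iff.1 hsa).2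
      exact (@h z hdom hdom').symm
    exact S.eq_zero_of_H_add_eq_zero ⟨z, hdom'⟩ (by simp [happ'])
  -- The graph carries the maximum norm, and ‖H x‖ ≤ ‖(H + 1) x‖ + ‖x‖ ≤ 2 ‖(H + 1) x‖.
  · refine ⟨2, AddMonoidHomClass.antilipschitz_of_bound S.graphAdd fun p => ?_⟩
    obtain ⟨⟨x, y⟩, hp⟩ := p
    obtain ⟨x', h1, h2⟩ := (LinearPMap.mem_graph_iff _).1 hp
    simp only at h1 h2
    subst h1 h2
    have h := S.norm_le_norm_H_add x'
    have e : S.graphAdd ⟨((x' : 𝓗), S.H x'), hp⟩ = S.H x' + x' := by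
      simp [graphAdd, add_comm]
    rw [e]
    have h3 : ‖S.H x'‖ ≤ ‖S.H x' + (x' : 𝓗)‖ + ‖(x' : 𝓗)‖ := by
      simpa using norm_sub_le (S.H x' + (x' : 𝓗)) x'
    rw [Submodule.coe_norm, Prod.norm_def]
    refine max_le ?_ ?_
    · push_cast
      linarith [norm_nonneg (S.H x' + (x' : 𝓗))]
    · push_cast
      linarith

lemma exists_isResolvent : ∃ R, S.IsResolvent R := by
  have hcl : IsClosed (S.H.graph : Set (𝓗 × 𝓗)) := S.selfAdjoint.isClosed
  have : CompleteSpace S.H.graph := hcl.completeSpace_coe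
  let e := ContinuousLinearEquiv.ofBijective S.graphAdd
    (LinearMap.ker_eq_bot.2 S.graphAdd_bijective.1)
    (LinearMap.range_eq_top.2 S.graphAdd_bijective.2)
  refine ⟨(ContinuousLinearMap.fst ℂ 𝓗 𝓗).comp
    (S.H.graph.subtypeL.comp (e.symm : 𝓗 →L[ℂ] S.H.graph)), fun x => ?_⟩
  have hx : S.graphAdd (e.symm x) = x := e.apply_symm_apply x
  obtain ⟨x', h1, h2⟩ := (LinearPMap.mem_graph_iff _).1 (e.symm x).2
  have hx' : S.H x' + (x' : 𝓗) = x := by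
    rw [h1, h2, add_comm]
    exact hx
  change ∃ h : ((e.symm x : S.H.graph) : 𝓗 × 𝓗).1 ∈ S.H.domain,
    S.H ⟨((e.symm x : S.H.graph) : 𝓗 × 𝓗).1, h⟩ + ((e.symm x : S.H.graph) : 𝓗 × 𝓗).1 = x
  rw [← h1]
  exact ⟨x'.2, hx'⟩

lemma isResolvent_resolvent : S.IsResolvent S.resolvent := by
  unfold resolvent
  rw [dif_pos S.exists_isResolvent]
  exact S.exists_isResolvent.choose_spec

/-- `(H + 1)⁻¹ x`, as an element of the domain of `H`. -/
def resolventDom (x : 𝓗) : S.H.domain := ⟨S.resolvent x, (S.isResolvent_resolvent x).1⟩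

lemma H_resolventDom (x : 𝓗) : S.H (S.resolventDom x) + (S.resolventDom x : 𝓗) = x :=
  (S.isResolvent_resolvent x).2

lemma resolvent_inner (x y : 𝓗) :
    inner ℂ (S.resolvent x) y = inner ℂ x (S.resolvent y) := by
  conv_lhs => rw [← S.H_resolventDom y]
  conv_rhs => rw [← S.H_resolventDom x]
  rw [inner_add_left, inner_add_right]
  change inner ℂ (S.resolventDom x : 𝓗) _ + _ = inner ℂ _ (S.resolventDom y : 𝓗) + _
  rw [S.inner_H_left]
  rfl

lemma resolvent_nonneg : 0 ≤ S.resolvent := by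
  rw [ContinuousLinearMap.nonneg_iff_isPositive]
  refine ⟨fun x y => S.resolvent_inner x y, fun x => ?_⟩
  change 0 ≤ (inner ℂ (S.resolvent x) x).re
  rw [S.resolvent_inner]
  have h := S.norm_sq_le_re_inner (S.resolventDom x)
  rw [S.H_resolventDom] at h
  exact (sq_nonneg _).trans h

lemma resolvent_injective : Function.Injective S.resolvent := by
  refine (injective_iff_map_eq_zero _).2 fun x hx => ?_
  have h : S.resolventDom x = 0 := Subtype.ext hx
  rw [← S.H_resolventDom x, h]
  simp

lemma resolvent_Ω : S.resolvent S.Ω = S.Ω := by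
  have h := S.eq_zero_of_H_add_eq_zero (S.resolventDom S.Ω - ⟨S.Ω, S.Ω_mem⟩) (by
    rw [LinearPMap.map_sub, S.H_Ω, sub_zero, Submodule.coe_sub, ← add_sub_assoc,
      S.H_resolventDom, sub_self])
  exact sub_eq_zero.1 h

/-- With u = (H + 1)⁻¹ x, again orthogonal to Ω, the gap gives 2‖u‖² ≤ ⟨u, x⟩ ≤ ‖u‖ ‖x‖. Hence ‖u‖ ≤
‖x‖ / 2. This is the gap H ≥ 1 on the complement of Ω, expressed by bounded operators. -/
lemma re_inner_resolvent_le (x : 𝓗) (hx : inner ℂ S.Ω x = 0) :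
    (inner ℂ (S.resolvent x) x).re ≤ 1 / 2 * ‖x‖ ^ 2 := by
  have h0 : inner ℂ S.Ω (S.resolventDom x : 𝓗) = 0 := by
    change inner ℂ S.Ω (S.resolvent x) = 0
    rw [← S.resolvent_inner, S.resolvent_Ω, hx]
  have h1 := S.gap (S.resolventDom x) h0
  have h2 : ‖(S.resolventDom x : 𝓗)‖ ^ 2 * 2 ≤ (inner ℂ (S.resolvent x) x).re := by
    rw [S.resolvent_inner]
    change _ ≤ (inner ℂ x (S.resolventDom x : 𝓗)).re
    have e := congrArg (fun z => (inner ℂ z (S.resolventDom x : 𝓗)).re) (S.H_resolventDom x)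
    simp only [inner_add_left, Complex.add_re] at e
    have h := inner_self_eq_norm_sq (𝕜 := ℂ) (S.resolventDom x : 𝓗)
    change (inner ℂ (S.resolventDom x : 𝓗) (S.resolventDom x : 𝓗)).re = _ at h
    linarith
  have h3 : (inner ℂ (S.resolvent x) x).re ≤ ‖(S.resolventDom x : 𝓗)‖ * ‖x‖ :=
    re_inner_le_norm (𝕜 := ℂ) _ _
  nlinarith [sq_nonneg (‖x‖ - 2 * ‖(S.resolventDom x : 𝓗)‖)]

lemma invSqrt_mul_self : S.invSqrt * S.invSqrt = S.resolvent :=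
  CFC.sqrt_mul_sqrt_self _ S.resolvent_nonneg

lemma invSqrt_nonneg : 0 ≤ S.invSqrt := CFC.sqrt_nonneg _

lemma adjoint_invSqrt : ContinuousLinearMap.adjoint S.invSqrt = S.invSqrt :=
  (IsSelfAdjoint.of_nonneg S.invSqrt_nonneg)

lemma invSqrt_inner (x y : 𝓗) :
    inner ℂ (S.invSqrt x) y = inner ℂ x (S.invSqrt y) := by
  conv_lhs => rw [← S.adjoint_invSqrt]
  exact ContinuousLinearMap.adjoint_inner_left _ _ _

lemma invSqrt_injective : Function.Injective S.invSqrt := by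
  intro x y h
  apply S.resolvent_injective
  rw [← invSqrt_mul_self, mul_apply_eq_comp, h, mul_apply_eq_comp]

/-- Since (H + 1)⁻¹ fixes Ω, the vector w = (H + 1)^{-1/2} Ω - Ω is mapped to -w by the positive
operator (H + 1)^{-1/2}, so w = 0. -/
lemma invSqrt_Ω : S.invSqrt S.Ω = S.Ω := by
  set w := S.invSqrt S.Ω - S.Ω with hw
  have h1 : S.invSqrt w + w = 0 := by
    rw [hw, map_sub, ← mul_apply_eq_comp, invSqrt_mul_self, resolvent_Ω]
    abel
  have h2 : 0 ≤ (inner ℂ (S.invSqrt w) w).re :=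
    ((ContinuousLinearMap.nonneg_iff_isPositive _).1 S.invSqrt_nonneg).2 w
  have h3 : S.invSqrt w = -w := eq_neg_of_add_eq_zero_left h1
  rw [h3, inner_neg_left, Complex.neg_re] at h2
  have h := inner_self_eq_norm_sq (𝕜 := ℂ) w
  change (inner ℂ w w).re = _ at h
  have h4 : ‖w‖ = 0 := by nlinarith [norm_nonneg w]
  exact sub_eq_zero.1 (norm_eq_zero.1 h4)

lemma projΩ_apply (x : 𝓗) : S.projΩ x = inner ℂ S.Ω x • S.Ω :=
  Submodule.starProjection_unit_singleton ℂ S.norm_Ω x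

lemma projΩ_Ω : S.projΩ S.Ω = S.Ω := by
  rw [projΩ_apply, inner_self_eq_norm_sq_to_K, S.norm_Ω]
  simp

lemma projΩ_mul_self : S.projΩ * S.projΩ = S.projΩ := by
  ext x
  rw [mul_apply_eq_comp, S.projΩ_apply x, map_smul, projΩ_Ω]

lemma adjoint_projΩ : ContinuousLinearMap.adjoint S.projΩ = S.projΩ :=
  (isSelfAdjoint_starProjection (Submodule.span ℂ {S.Ω}))

lemma norm_projΩ_sq_add (x : 𝓗) : ‖S.projΩ x‖ ^ 2 + ‖x - S.projΩ x‖ ^ 2 = ‖x‖ ^ 2 := by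
  have h : inner ℂ (S.projΩ x) (x - S.projΩ x) = 0 := by
    conv_lhs => rw [← S.adjoint_projΩ]
    rw [ContinuousLinearMap.adjoint_inner_left, S.adjoint_projΩ, map_sub,
      ← mul_apply_eq_comp, projΩ_mul_self]
    simp
  have := norm_add_sq_eq_norm_sq_add_norm_sq_of_inner_eq_zero _ _ h
  rw [add_sub_cancel] at this
  nlinarith

lemma invSqrt_mul_projΩ : S.invSqrt * S.projΩ = S.projΩ := by
  ext x
  rw [mul_apply_eq_comp, projΩ_apply, map_smul, invSqrt_Ω]

lemma projΩ_mul_invSqrt : S.projΩ * S.invSqrt = S.projΩ := by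
  ext x
  rw [mul_apply_eq_comp, projΩ_apply, projΩ_apply, ← invSqrt_inner, invSqrt_Ω]

lemma norm_invSqrt_sq_le (x : 𝓗) (hx : inner ℂ S.Ω x = 0) :
    ‖S.invSqrt x‖ ^ 2 ≤ 1 / 2 * ‖x‖ ^ 2 := by
  have h := S.re_inner_resolvent_le x hx
  rw [← invSqrt_mul_self, mul_apply_eq_comp, invSqrt_inner] at h
  have h' := inner_self_eq_norm_sq (𝕜 := ℂ) (S.invSqrt x)
  change (inner ℂ _ _).re = _ at h'
  linarith

/-- `(H + 1) ^ (-1/2) (P + √2 (1 - P))`, a contraction because `H ≥ 1 - P`. -/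
def gapOp : 𝓗 →L[ℂ] 𝓗 :=
  S.invSqrt * (S.projΩ + ((Real.sqrt 2 : ℝ) : ℂ) • (1 - S.projΩ))

/-- The Ω component is preserved, and the complement is mapped into itself with squared norm at most
halved, which the factor √2 compensates. In this form the gap survives tensoring: a contraction at
one site is a contraction of the tensor product. -/
lemma norm_gapOp_le : ‖S.gapOp‖ ≤ 1 := by
  refine ContinuousLinearMap.opNorm_le_bound _ zero_le_one fun x => ?_
  rw [one_mul]
  refine le_of_sq_le_sq ?_ (norm_nonneg _)
  have e : S.gapOp x = S.projΩ x + ((Real.sqrt 2 : ℝ) : ℂ) • S.invSqrt (x - S.projΩ x) := by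
    have := congrArg (fun T : 𝓗 →L[ℂ] 𝓗 => T x) S.invSqrt_mul_projΩ
    simp only [mul_apply_eq_comp] at this
    simp [gapOp, this]
  have h0 : inner ℂ S.Ω (x - S.projΩ x) = 0 := by
    rw [inner_sub_right, projΩ_apply, inner_smul_right, inner_self_eq_norm_sq_to_K, S.norm_Ω]
    simp
  have h1 : inner ℂ (S.projΩ x) (((Real.sqrt 2 : ℝ) : ℂ) • S.invSqrt (x - S.projΩ x)) = 0 := by
    rw [inner_smul_right, ← invSqrt_inner]
    rw [S.projΩ_apply x, map_smul, invSqrt_Ω, inner_smul_left, ← S.projΩ_apply x, h0]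
    simp
  have h2 := norm_add_sq_eq_norm_sq_add_norm_sq_of_inner_eq_zero _ _ h1
  have h3 := S.norm_invSqrt_sq_le _ h0
  rw [e, ← S.norm_projΩ_sq_add x]
  have h4 : ‖((Real.sqrt 2 : ℝ) : ℂ) • S.invSqrt (x - S.projΩ x)‖ ^ 2 =
      2 * ‖S.invSqrt (x - S.projΩ x)‖ ^ 2 := by
    rw [norm_smul, mul_pow, Complex.norm_real, Real.norm_eq_abs, sq_abs,
      Real.sq_sqrt (by norm_num)]
  nlinarith

end SiteData

end OneSiteLemmas

/-! ### Excitation sectors and the operators that are scalar on each of them. -/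

section Sectors

set_option linter.unusedSectionVars false

variable {ι : Type*} [Fintype ι] [DecidableEq ι]
variable {𝓗 : Type*} [NormedAddCommGroup 𝓗] [InnerProductSpace ℂ 𝓗] [CompleteSpace 𝓗]
variable (S : SiteData 𝓗)

/-- The projection onto the sector in which exactly the sites of `A` are excited. -/
def sector (A : Finset ι) : HTensor ι 𝓗 →L[ℂ] HTensor ι 𝓗 :=
  tensorMap fun i => if i ∈ A then 1 - S.projΩ else S.projΩ

lemma projΩ_mul_compl : S.projΩ * (1 - S.projΩ) = 0 := by
  rw [mul_sub, mul_one, S.projΩ_mul_self, sub_self]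

lemma compl_mul_projΩ : (1 - S.projΩ) * S.projΩ = 0 := by
  rw [sub_mul, one_mul, S.projΩ_mul_self, sub_self]

lemma compl_mul_self : (1 - S.projΩ) * (1 - S.projΩ) = 1 - S.projΩ := by
  rw [mul_sub, mul_one, compl_mul_projΩ, sub_zero]

lemma sector_mul_self (A : Finset ι) : sector S A * sector S A = sector S A := by
  unfold sector
  rw [tensorMap_mul]
  congr 1
  ext1 i
  split_ifs
  · exact compl_mul_self S
  · exact S.projΩ_mul_self

lemma sector_mul_of_ne {A B : Finset ι} (h : A ≠ B) : sector S A * sector S B = 0 := by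
  obtain ⟨i, hi⟩ : ∃ i, ¬(i ∈ A ↔ i ∈ B) := by
    by_contra! hc
    exact h (Finset.ext hc)
  unfold sector
  rw [tensorMap_mul]
  refine tensorMap_eq_zero (i := i) ?_
  by_cases hA : i ∈ A
  · have hB : i ∉ B := fun hB => hi (by simp [hA, hB])
    simp [hA, hB, compl_mul_projΩ]
  · have hB : i ∈ B := by
      by_contra hB
      exact hi (by simp [hA, hB])
    simp [hA, hB, projΩ_mul_compl]

lemma sector_mul (A B : Finset ι) :
    sector S A * sector S B = if A = B then sector S A else 0 := by
  split_ifs with h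
  · rw [← h, sector_mul_self]
  · exact sector_mul_of_ne S h

lemma adjoint_sector (A : Finset ι) :
    ContinuousLinearMap.adjoint (sector S A) = sector S A := by
  unfold sector
  rw [adjoint_tensorMap]
  congr 1
  ext1 i
  split_ifs
  · rw [map_sub, S.adjoint_projΩ]
    congr 1
    exact star_one (𝓗 →L[ℂ] 𝓗)
  · exact S.adjoint_projΩ

/-- Expand the product over all sites of P_Ω + (1 - P_Ω) = 1. All the projections and number weights
are functions on this finite resolution of the identity, which reduces their algebra to that of real
functions on `Finset ι`. -/
lemma sum_sector : ∑ A : Finset ι, sector S A = 1 := by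
  refine htensor_clm_ext fun x => ?_
  have h := htprod_add_univ (fun i => x i - S.projΩ (x i)) (fun i => S.projΩ (x i))
  simp only [sub_add_cancel] at h
  rw [sum_apply, one_apply_eq_self]
  conv_rhs => rw [show htprod x = htprod fun i => x i from rfl, h]
  refine Finset.sum_congr rfl fun A _ => ?_
  unfold sector
  rw [tensorMap_htprod]
  congr 1
  ext1 i
  by_cases hi : i ∈ A <;> simp [hi]

lemma commute_siteOp_sector {i : ι} {b : 𝓗 →L[ℂ] 𝓗} (h : Commute b S.projΩ) (A : Finset ι) :
    Commute (siteOp i b) (sector S A) := by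
  refine commute_siteOp_tensorMap ?_
  split_ifs
  · exact (Commute.one_right b).sub_right h
  · exact h

lemma siteOp_projΩ_mul_sector (i : ι) (A : Finset ι) :
    siteOp i S.projΩ * sector S A = if i ∈ A then 0 else sector S A := by
  unfold sector siteOp
  rw [tensorMap_mul]
  split_ifs with h
  · exact tensorMap_eq_zero (i := i) (by simp [h, projΩ_mul_compl])
  · congr 1
    ext1 j
    rcases eq_or_ne j i with rfl | hj
    · simp [h, S.projΩ_mul_self]
    · simp [Function.update_of_ne hj]

lemma projMinus_mul_sector (B A : Finset ι) :
    projMinus S B * sector S A = if A ∩ B = ∅ then sector S A else 0 := by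
  unfold sector projMinus
  rw [tensorMap_mul]
  split_ifs with h
  · congr 1
    ext1 j
    by_cases hB : j ∈ B
    · have hA : j ∉ A := fun hA => by
        have : j ∈ A ∩ B := Finset.mem_inter.2 ⟨hA, hB⟩
        simp [h] at this
      simp [hA, hB, S.projΩ_mul_self]
    · simp [hB]
  · obtain ⟨j, hj⟩ := Finset.nonempty_iff_ne_empty.2 h
    rw [Finset.mem_inter] at hj
    exact tensorMap_eq_zero (i := j) (by simp [hj.1, hj.2, projΩ_mul_compl])

/-- The operator equal to the scalar `F A` on the sector of `A`. -/
def diagOp (F : Finset ι → ℝ) : HTensor ι 𝓗 →L[ℂ] HTensor ι 𝓗 :=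
  ∑ A : Finset ι, (F A : ℂ) • sector S A

lemma diagOp_mul_sector (F : Finset ι → ℝ) (A : Finset ι) :
    diagOp S F * sector S A = (F A : ℂ) • sector S A := by
  unfold diagOp
  rw [Finset.sum_mul, Finset.sum_eq_single A]
  · rw [smul_mul_assoc, sector_mul_self]
  · intro B _ hB
    rw [smul_mul_assoc, sector_mul_of_ne S hB, smul_zero]
  · simp

/-- An operator that is scalar on every sector is diagonal. -/
lemma eq_diagOp {X : HTensor ι 𝓗 →L[ℂ] HTensor ι 𝓗} {F : Finset ι → ℝ}
    (h : ∀ A, X * sector S A = (F A : ℂ) • sector S A) : X = diagOp S F := by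
  rw [← mul_one X, ← sum_sector S, Finset.mul_sum]
  exact Finset.sum_congr rfl fun A _ => h A

lemma diagOp_mul (F G : Finset ι → ℝ) : diagOp S F * diagOp S G = diagOp S (F * G) :=
  eq_diagOp S fun A => by
    rw [mul_assoc, diagOp_mul_sector, mul_smul_comm, diagOp_mul_sector, smul_smul,
      Pi.mul_apply, Complex.ofReal_mul, mul_comm]

lemma diagOp_one : diagOp S (1 : Finset ι → ℝ) = 1 := (eq_diagOp S fun A => by simp).symm

lemma diagOp_add (F G : Finset ι → ℝ) : diagOp S (F + G) = diagOp S F + diagOp S G :=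
  (eq_diagOp S fun A => by
    rw [add_mul, diagOp_mul_sector, diagOp_mul_sector, ← add_smul, Pi.add_apply,
      Complex.ofReal_add]).symm

lemma diagOp_const (c : ℝ) : diagOp S (fun _ : Finset ι => c) = (c : ℂ) • 1 :=
  (eq_diagOp S fun A => by simp).symm

lemma adjoint_diagOp (F : Finset ι → ℝ) :
    ContinuousLinearMap.adjoint (diagOp S F) = diagOp S F := by
  unfold diagOp
  simp only [map_sum, LinearIsometryEquiv.map_smulₛₗ, adjoint_sector, Complex.conj_ofReal]

lemma sector_eq_diagOp (B : Finset ι) :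
    sector S B = diagOp S fun A => if A = B then 1 else 0 :=
  eq_diagOp S fun A => by
    rw [sector_mul]
    rcases eq_or_ne A B with rfl | h
    · simp
    · simp [h, h.symm]

lemma projMinus_eq_diagOp (B : Finset ι) :
    projMinus S B = diagOp S fun A => if A ∩ B = ∅ then 1 else 0 :=
  eq_diagOp S fun A => by
    rw [projMinus_mul_sector]
    split_ifs <;> simp

lemma projPlus_eq_diagOp (B : Finset ι) :
    projPlus S B = diagOp S fun A => if A ∩ B = ∅ then 0 else 1 :=
  eq_diagOp S fun A => by
    rw [projPlus, sub_mul, one_mul, projMinus_mul_sector]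
    split_ifs <;> simp

lemma numberOp_eq_diagOp (B : Finset ι) :
    numberOp S B = diagOp S fun A => ((A ∩ B).card : ℝ) :=
  eq_diagOp S fun A => by
    unfold numberOp
    rw [Finset.sum_mul]
    have h : ∀ i ∈ B, (1 - siteOp i S.projΩ) * sector S A =
        (if i ∈ A then (1 : ℂ) else 0) • sector S A := by
      intro i _
      rw [sub_mul, one_mul, siteOp_projΩ_mul_sector]
      split_ifs <;> simp
    rw [Finset.sum_congr rfl h, ← Finset.sum_smul]
    congr 1
    rw [Finset.sum_ite, Finset.sum_const_zero, add_zero, Finset.sum_const,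
      Finset.filter_mem_eq_inter, Finset.inter_comm]
    simp

/-- `diagOp` as a homomorphism of real algebras. -/
def diagHom : (Finset ι → ℝ) →ₐ[ℝ] (HTensor ι 𝓗 →L[ℂ] HTensor ι 𝓗) where
  toFun F := diagOp S F
  map_one' := diagOp_one (ι := ι) S
  map_mul' F G := (diagOp_mul S F G).symm
  map_zero' := by simp [diagOp]
  map_add' F G := diagOp_add S F G
  commutes' c := by
    refine (diagOp_const (ι := ι) S c).trans ?_
    rw [Algebra.algebraMap_eq_smul_one c]
    ext x
    simp

lemma isSelfAdjoint_diagOp (F : Finset ι → ℝ) : IsSelfAdjoint (diagOp S F) :=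
  adjoint_diagOp S F

/-- An algebra homomorphism cannot enlarge the spectrum, and in the algebra of functions the
spectrum of F is its range. -/
lemma spectrum_diagOp_subset (F : Finset ι → ℝ) :
    spectrum ℝ (diagOp S F) ⊆ Set.range F := by
  refine (AlgHom.spectrum_apply_subset (diagHom S) F).trans fun r hr => ?_
  rw [spectrum.mem_iff] at hr
  by_contra hc
  refine hr (Pi.isUnit_iff.2 fun A => isUnit_iff_ne_zero.2 ?_)
  rw [Pi.sub_apply]
  exact sub_ne_zero.2 fun h => hc ⟨A, h.symm⟩

/-- The spectrum is finite, so f agrees on it with an interpolating polynomial, and polynomials pass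
through the homomorphism `diagHom`. No continuity of f is required. -/
lemma cfc_diagOp (f : ℝ → ℝ) (F : Finset ι → ℝ) :
    cfc f (diagOp S F) = diagOp S fun A => f (F A) := by
  classical
  let s : Finset ℝ := Finset.univ.image F
  let p : Polynomial ℝ := Lagrange.interpolate s id f
  have hp : ∀ A, p.eval (F A) = f (F A) := fun A =>
    Lagrange.eval_interpolate_at_node (v := id) (r := f) (s := s) (i := F A)
      Function.injective_id.injOn (Finset.mem_image_of_mem F (Finset.mem_univ A))
  have h1 : cfc f (diagOp S F) = cfc p.eval (diagOp S F) := by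
    refine cfc_congr fun r hr => ?_
    obtain ⟨A, rfl⟩ := spectrum_diagOp_subset S F hr
    exact (hp A).symm
  rw [h1, cfc_polynomial p (diagOp S F) (isSelfAdjoint_diagOp S F)]
  change Polynomial.aeval (diagHom S F) p = diagHom S fun A => f (F A)
  rw [Polynomial.aeval_algHom_apply]
  congr 1
  ext1 A
  rw [← hp A]
  simp

lemma numberWeight_eq_diagOp (B : Finset ι) :
    numberWeight S B = diagOp S fun A => (((A ∩ B).card : ℝ) + 1) ^ (-(1 / 2) : ℝ) := by
  unfold numberWeight
  rw [numberOp_eq_diagOp, cfc_diagOp]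

lemma inner_sector_of_ne {A B : Finset ι} (h : A ≠ B) (x y : HTensor ι 𝓗) :
    inner ℂ (sector S A x) (sector S B y) = 0 := by
  conv_lhs => rw [← adjoint_sector S A]
  rw [ContinuousLinearMap.adjoint_inner_left, ← mul_apply_eq_comp,
    sector_mul_of_ne S h]
  simp

lemma norm_sq_eq_sum_sector (x : HTensor ι 𝓗) :
    ‖x‖ ^ 2 = ∑ A : Finset ι, ‖sector S A x‖ ^ 2 := by
  have h : ∑ A : Finset ι, sector S A x = x := by
    rw [← sum_apply, sum_sector]
    rfl
  conv_lhs => rw [← h]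
  have h2 := inner_self_eq_norm_sq_to_K (𝕜 := ℂ) (∑ A : Finset ι, sector S A x)
  rw [sum_inner] at h2
  have h3 : ∀ A : Finset ι, inner ℂ (sector S A x) (∑ B : Finset ι, sector S B x) =
      ((‖sector S A x‖ : ℂ)) ^ 2 := by
    intro A
    rw [inner_sum, Finset.sum_eq_single A]
    · exact inner_self_eq_norm_sq_to_K _
    · exact fun B _ hB => inner_sector_of_ne S hB.symm _ _
    · simp
  rw [Finset.sum_congr rfl fun A _ => h3 A] at h2
  refine Complex.ofReal_injective ?_
  push_cast
  exact h2.symm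

lemma sector_diagOp (F : Finset ι → ℝ) (A : Finset ι) (x : HTensor ι 𝓗) :
    sector S A (diagOp S F x) = (F A : ℂ) • sector S A x := by
  have h : sector S A * diagOp S F = (F A : ℂ) • sector S A := by
    rw [← diagOp_mul_sector, sector_eq_diagOp, diagOp_mul, diagOp_mul, mul_comm]
  exact congrArg (fun T : HTensor ι 𝓗 →L[ℂ] HTensor ι 𝓗 => T x) h

lemma norm_sq_diagOp (F : Finset ι → ℝ) (x : HTensor ι 𝓗) :
    ‖diagOp S F x‖ ^ 2 = ∑ A : Finset ι, F A ^ 2 * ‖sector S A x‖ ^ 2 := by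
  rw [norm_sq_eq_sum_sector S]
  refine Finset.sum_congr rfl fun A _ => ?_
  rw [sector_diagOp, norm_smul, mul_pow, Complex.norm_real, Real.norm_eq_abs, sq_abs]

lemma commute_siteOp_diagOp {i : ι} {b : 𝓗 →L[ℂ] 𝓗} (h : Commute b S.projΩ)
    (F : Finset ι → ℝ) : Commute (siteOp i b) (diagOp S F) :=
  Commute.sum_right _ _ _ fun A _ => (commute_siteOp_sector S h A).smul_right _

lemma commute_invSqrt_projΩ : Commute S.invSqrt S.projΩ := by
  rw [Commute, SemiconjBy, S.invSqrt_mul_projΩ, S.projΩ_mul_invSqrt]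

end Sectors

/-! ### The form domain, the energy of excitations and the gap of H⁰. -/

section FormDomain

set_option linter.unusedSectionVars false

variable {ι : Type*} [Fintype ι] [DecidableEq ι]
variable {𝓗 : Type*} [NormedAddCommGroup 𝓗] [InnerProductSpace ℂ 𝓗] [CompleteSpace 𝓗]
variable (S : SiteData 𝓗)

lemma invSqrt_denseRange : DenseRange S.invSqrt := by
  have h : (S.invSqrt.range)ᗮ = ⊥ := by
    rw [Submodule.eq_bot_iff]
    intro z hz
    apply S.invSqrt_injective
    rw [map_zero, ← inner_self_eq_zero (𝕜 := ℂ), S.invSqrt_inner]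
    exact (Submodule.mem_orthogonal' _ _).1 hz _ ⟨_, rfl⟩
  rw [← Submodule.topologicalClosure_eq_top_iff] at h
  have := Submodule.dense_iff_topologicalClosure_eq_top.2 h
  exact this

lemma siteOp_invSqrt_inner (i : ι) (x y : HTensor ι 𝓗) :
    inner ℂ (siteOp i S.invSqrt x) y = inner ℂ x (siteOp i S.invSqrt y) := by
  conv_lhs => rw [← S.adjoint_invSqrt, ← adjoint_siteOp]
  exact ContinuousLinearMap.adjoint_inner_left _ _ _

/-- By symmetry a vector in the kernel is orthogonal to every elementary tensor whose factor i lies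
in ran (H + 1)^{-1/2}. That range is dense, so the vector is orthogonal to all elementary tensors.
Injectivity is what makes the inverse `sqrtSite` meaningful. -/
lemma siteOp_invSqrt_injective (i : ι) :
    Function.Injective (siteOp i S.invSqrt : HTensor ι 𝓗 → HTensor ι 𝓗) := by
  refine (injective_iff_map_eq_zero _).2 fun x hx => ?_
  have h0 : (innerSL ℂ x : HTensor ι 𝓗 →L[ℂ] ℂ) = 0 := by
    refine htensor_clm_ext fun y => ?_
    -- An elementary tensor is linear in its factor i, with bound the product of the other norms;
    -- this continuity carries the identity from the dense range to all of 𝓗.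
    have hcont : Continuous fun z : 𝓗 => inner ℂ x (htprod (Function.update y i z)) := by
      have hlin : IsLinearMap ℂ fun z : 𝓗 =>
          htprod (Function.update y i z) :=
        ⟨fun a b => htprod_update_add y i a b, fun c a => htprod_update_smul y i c a⟩
      have hb : ∀ z : 𝓗, ‖htprod (Function.update y i z)‖ ≤
          (∏ j ∈ Finset.univ.erase i, ‖y j‖) * ‖z‖ := by
        intro z
        refine le_of_sq_le_sq (le_of_eq ?_) (by positivity)
        rw [← Complex.ofReal_inj]
        have := inner_self_eq_norm_sq_to_K (𝕜 := ℂ) (htprod (Function.update y i z))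
        push_cast
        refine this.symm.trans ?_
        rw [inner_htprod, ← Finset.mul_prod_erase _ _ (Finset.mem_univ i)]
        have h2 : ∀ j ∈ Finset.univ.erase i, inner ℂ (Function.update y i z j)
            (Function.update y i z j) = ((‖y j‖ : ℂ)) ^ 2 := by
          intro j hj
          rw [Function.update_of_ne (Finset.ne_of_mem_erase hj)]
          exact inner_self_eq_norm_sq_to_K _
        rw [Finset.prod_congr rfl h2, Function.update_self, Finset.prod_pow, mul_pow, mul_comm]
        congr 1
        exact inner_self_eq_norm_sq_to_K _
      have hc : Continuous fun z : 𝓗 => htprod (Function.update y i z) :=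
        ((hlin.mk' _).mkContinuous _ hb).continuous
      exact continuous_const.inner hc
    have hz : (fun z : 𝓗 => inner ℂ x (htprod (Function.update y i z))) = fun _ => 0 := by
      refine (invSqrt_denseRange S).equalizer hcont continuous_const (funext fun z => ?_)
      simp only [Function.comp_apply]
      have h3 : htprod (Function.update y i (S.invSqrt z)) =
          siteOp i S.invSqrt (htprod (Function.update y i z)) := by
        rw [siteOp_apply_htprod]
        simp
      rw [h3, ← siteOp_invSqrt_inner, hx, inner_zero_left]
    have := congrFun hz (y i)
    simpa using this
  have h1 : inner ℂ x x = (0 : ℂ) := by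
    have := congrArg (fun f : HTensor ι 𝓗 →L[ℂ] ℂ => f x) h0
    simpa using this
  exact inner_self_eq_zero.1 h1

variable {S}

lemma mem_domain_sqrtSite {i : ι} {x : HTensor ι 𝓗} :
    x ∈ (sqrtSite S i).domain ↔ ∃ ξ, siteOp i S.invSqrt ξ = x := by
  unfold sqrtSite
  rw [LinearPMap.inverse_domain]
  constructor
  · rintro ⟨ξ, rfl⟩
    exact ⟨ξ, rfl⟩
  · rintro ⟨ξ, rfl⟩
    exact ⟨⟨ξ, trivial⟩, rfl⟩

lemma sqrtSite_apply {i : ι} {ξ : HTensor ι 𝓗} (x : (sqrtSite S i).domain)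
    (h : siteOp i S.invSqrt ξ = x) : sqrtSite S i x = ξ := by
  refine LinearPMap.inverse_apply_eq (f := (siteOp i S.invSqrt :
    HTensor ι 𝓗 →ₗ[ℂ] HTensor ι 𝓗).toPMap ⊤) ?_ (x := ⟨ξ, trivial⟩) h
  rw [LinearMap.ker_eq_bot']
  intro z hz
  refine Subtype.ext (siteOp_invSqrt_injective S i ?_)
  rw [Submodule.coe_zero, map_zero]
  exact hz

variable (S) in
open Classical in
/-- `(H_i + 1) ^ (1/2) x`, and `0` outside the domain. -/
def root (i : ι) (x : HTensor ι 𝓗) : HTensor ι 𝓗 :=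
  if h : x ∈ (sqrtSite S i).domain then sqrtSite S i ⟨x, h⟩ else 0

lemma root_of_mem {i : ι} {x : HTensor ι 𝓗} (h : x ∈ (sqrtSite S i).domain) :
    root S i x = sqrtSite S i ⟨x, h⟩ := dif_pos h

lemma root_eq {i : ι} {x ξ : HTensor ι 𝓗} (h : siteOp i S.invSqrt ξ = x) :
    root S i x = ξ := by
  rw [root_of_mem (mem_domain_sqrtSite.2 ⟨ξ, h⟩)]
  exact sqrtSite_apply _ h

lemma siteOp_root {i : ι} {x : HTensor ι 𝓗} (h : x ∈ (sqrtSite S i).domain) :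
    siteOp i S.invSqrt (root S i x) = x := by
  obtain ⟨ξ, hξ⟩ := mem_domain_sqrtSite.1 h
  rw [root_eq hξ, hξ]

lemma apply_comm {X Y : HTensor ι 𝓗 →L[ℂ] HTensor ι 𝓗} (h : Commute X Y)
    (x : HTensor ι 𝓗) : X (Y x) = Y (X x) :=
  congrArg (fun T : HTensor ι 𝓗 →L[ℂ] HTensor ι 𝓗 => T x) h.eq

/-- Commuting with the bounded operator (H_i + 1)^{-1/2} implies commuting with its unbounded
inverse, domains included; `root_map` is the other half. -/
lemma map_mem_domain {i : ι} {X : HTensor ι 𝓗 →L[ℂ] HTensor ι 𝓗}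
    (hX : Commute (siteOp i S.invSqrt) X) {x : HTensor ι 𝓗} (h : x ∈ (sqrtSite S i).domain) :
    X x ∈ (sqrtSite S i).domain := by
  obtain ⟨ξ, rfl⟩ := mem_domain_sqrtSite.1 h
  exact mem_domain_sqrtSite.2 ⟨X ξ, apply_comm hX ξ⟩

lemma root_map {i : ι} {X : HTensor ι 𝓗 →L[ℂ] HTensor ι 𝓗}
    (hX : Commute (siteOp i S.invSqrt) X) {x : HTensor ι 𝓗} (h : x ∈ (sqrtSite S i).domain) :
    root S i (X x) = X (root S i x) := by
  refine root_eq ?_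
  rw [apply_comm hX, siteOp_root h]

lemma map_mem_formDomain {A : Finset ι} {X : HTensor ι 𝓗 →L[ℂ] HTensor ι 𝓗}
    (hX : ∀ i ∈ A, Commute (siteOp i S.invSqrt) X) {x : HTensor ι 𝓗}
    (h : x ∈ formDomain S A) : X x ∈ formDomain S A := by
  unfold formDomain at *
  simp only [Submodule.mem_iInf] at *
  exact fun i hi => map_mem_domain (hX i hi) (h i hi)

lemma commute_invSqrt_diagOp (i : ι) (F : Finset ι → ℝ) :
    Commute (siteOp i S.invSqrt) (diagOp S F) :=
  commute_siteOp_diagOp S (commute_invSqrt_projΩ S) F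

lemma diagOp_mem {A : Finset ι} (F : Finset ι → ℝ) {x : HTensor ι 𝓗}
    (h : x ∈ formDomain S A) : diagOp S F x ∈ formDomain S A :=
  map_mem_formDomain (fun i _ => commute_invSqrt_diagOp i F) h

lemma projPlus_mem {A : Finset ι} (B : Finset ι) {x : HTensor ι 𝓗}
    (h : x ∈ formDomain S A) : projPlus S B x ∈ formDomain S A := by
  rw [projPlus_eq_diagOp]
  exact diagOp_mem _ h

lemma siteOp_mem {A : Finset ι} {j : ι} (hj : j ∉ A) (b : 𝓗 →L[ℂ] 𝓗) {x : HTensor ι 𝓗}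
    (h : x ∈ formDomain S A) : siteOp j b x ∈ formDomain S A :=
  map_mem_formDomain (fun _ hi => commute_siteOp fun hij => absurd (hij ▸ hi) hj) h

lemma siteOp_invSqrt_projMinus {A : Finset ι} {i : ι} (hi : i ∈ A) (x : HTensor ι 𝓗) :
    siteOp i S.invSqrt (projMinus S A x) = projMinus S A x := by
  have h : siteOp i S.invSqrt * projMinus S A = projMinus S A := by
    unfold siteOp projMinus
    rw [tensorMap_mul]
    congr 1
    ext1 j
    rcases eq_or_ne j i with rfl | hj
    · simp [hi, S.invSqrt_mul_projΩ]
    · simp [Function.update_of_ne hj]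
  exact congrArg (fun T : HTensor ι 𝓗 →L[ℂ] HTensor ι 𝓗 => T x) h

lemma mem_formDomain {A : Finset ι} {x : HTensor ι 𝓗} :
    x ∈ formDomain S A ↔ ∀ i ∈ A, x ∈ (sqrtSite S i).domain := by
  simp [formDomain, Submodule.mem_iInf]

/-- No regularity of x is required, since (H_i + 1)^{-1/2} fixes Ω and hence everything in ran P⁻_A
for i ∈ A. -/
lemma projMinus_mem (A : Finset ι) (x : HTensor ι 𝓗) : projMinus S A x ∈ formDomain S A :=
  mem_formDomain.2 fun _ hi => mem_domain_sqrtSite.2 ⟨_, siteOp_invSqrt_projMinus hi x⟩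

lemma root_projMinus {A : Finset ι} {i : ι} (hi : i ∈ A) (x : HTensor ι 𝓗) :
    root S i (projMinus S A x) = projMinus S A x :=
  root_eq (siteOp_invSqrt_projMinus hi x)

lemma projMinus_vacuum (A : Finset ι) : projMinus S A (vacuum S) = vacuum S := by
  unfold projMinus vacuum
  rw [tensorMap_htprod]
  congr 1
  ext1 i
  split_ifs
  · exact S.projΩ_Ω
  · rfl

variable (S) in
/-- The form `⟪x, H_i y⟫`. -/
def siteForm (i : ι) (x y : HTensor ι 𝓗) : ℂ :=
  inner ℂ (root S i x) (root S i y) - inner ℂ x y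

variable (S) in
/-- The quadratic form `⟪x, H_i x⟫`. -/
def siteEnergy (i : ι) (x : HTensor ι 𝓗) : ℝ := ‖root S i x‖ ^ 2 - ‖x‖ ^ 2

variable (S) in
/-- The quadratic form `⟪x, H⁰_B x⟫`. -/
def energyOn (B : Finset ι) (x : HTensor ι 𝓗) : ℝ := ∑ i ∈ B, siteEnergy S i x

lemma siteForm_self (i : ι) (x : HTensor ι 𝓗) : siteForm S i x x = siteEnergy S i x := by
  unfold siteForm siteEnergy
  push_cast
  congr 1
  · exact inner_self_eq_norm_sq_to_K _
  · exact inner_self_eq_norm_sq_to_K _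

lemma Form.eval_of_mem {A : Finset ι} (v : Form S A) {x y : HTensor ι 𝓗}
    (hx : x ∈ formDomain S A) (hy : y ∈ formDomain S A) :
    v.eval x y = v ⟨x, hx⟩ ⟨y, hy⟩ := dif_pos ⟨hx, hy⟩

lemma formOne_eval {A : Finset ι} {x y : HTensor ι 𝓗}
    (hx : x ∈ formDomain S A) (hy : y ∈ formDomain S A) :
    (formOne S A).eval x y = inner ℂ x y := by
  rw [Form.eval_of_mem _ hx hy]
  rfl

lemma formH0_eval {A : Finset ι} {x y : HTensor ι 𝓗}
    (hx : x ∈ formDomain S A) (hy : y ∈ formDomain S A) :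
    (formH0 S A).eval x y = ∑ i ∈ A, siteForm S i x y := by
  rw [Form.eval_of_mem _ hx hy]
  unfold formH0
  rw [LinearMap.sum_apply, LinearMap.sum_apply, ← Finset.sum_coe_sort A]
  refine Finset.sum_congr rfl fun i _ => ?_
  unfold siteForm
  rw [root_of_mem (formDomain_le S i.2 hx), root_of_mem (formDomain_le S i.2 hy)]
  rfl

lemma Form.eval_add {A : Finset ι} (v w : Form S A) (x y : HTensor ι 𝓗) :
    (v + w).eval x y = v.eval x y + w.eval x y := by
  unfold Form.eval
  split_ifs <;> simp

lemma weight_of_mem {A : Finset ι} {x : HTensor ι 𝓗} (hx : x ∈ formDomain S A) :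
    weight S A x = ENNReal.ofReal (Real.sqrt (energyOn S A x + ‖x‖ ^ 2)) := by
  unfold weight
  rw [if_pos hx, Form.eval_add, formH0_eval hx hx, formOne_eval hx hx]
  congr 3
  rw [Complex.add_re, Complex.re_sum]
  congr 1
  · exact Finset.sum_congr rfl fun i _ => by rw [siteForm_self, Complex.ofReal_re]
  · exact inner_self_eq_norm_sq (𝕜 := ℂ) x

/-- The square root of H_i + 1 commutes with the sector projections, so both norms split by
Pythagoras without cross terms. Energy inequalities can then be checked sector by sector. -/
lemma siteEnergy_eq_sum_sector {i : ι} {x : HTensor ι 𝓗} (hx : x ∈ (sqrtSite S i).domain) :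
    siteEnergy S i x = ∑ A : Finset ι, siteEnergy S i (sector S A x) := by
  unfold siteEnergy
  rw [Finset.sum_sub_distrib, norm_sq_eq_sum_sector S x, norm_sq_eq_sum_sector S (root S i x)]
  congr 1
  refine Finset.sum_congr rfl fun A _ => ?_
  rw [root_map (commute_siteOp_sector S (commute_invSqrt_projΩ S) A) hx]

lemma siteEnergy_diagOp {i : ι} {x : HTensor ι 𝓗} (hx : x ∈ (sqrtSite S i).domain)
    (F : Finset ι → ℝ) :
    siteEnergy S i (diagOp S F x) = ∑ A, F A ^ 2 * siteEnergy S i (sector S A x) := by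
  unfold siteEnergy
  rw [root_map (commute_invSqrt_diagOp i F) hx, norm_sq_diagOp, norm_sq_diagOp,
    ← Finset.sum_sub_distrib]
  refine Finset.sum_congr rfl fun A _ => ?_
  rw [root_map (commute_siteOp_sector S (commute_invSqrt_projΩ S) A) hx, mul_sub]

lemma siteEnergy_sector_of_notMem {i : ι} {A : Finset ι} (hi : i ∉ A) (x : HTensor ι 𝓗) :
    siteEnergy S i (sector S A x) = 0 := by
  have h : siteOp i S.invSqrt * sector S A = sector S A := by
    unfold siteOp sector
    rw [tensorMap_mul]
    congr 1
    ext1 j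
    rcases eq_or_ne j i with rfl | hj
    · simp [hi, S.invSqrt_mul_projΩ]
    · simp [Function.update_of_ne hj]
  unfold siteEnergy
  rw [root_eq (ξ := sector S A x)
    (congrArg (fun T : HTensor ι 𝓗 →L[ℂ] HTensor ι 𝓗 => T x) h), sub_self]

/-- The gap of `H` in terms of `(H + 1) ^ (-1/2)`. -/
lemma two_mul_norm_sq_le {i : ι} {A : Finset ι} (hi : i ∈ A) (x : HTensor ι 𝓗) :
    2 * ‖siteOp i S.invSqrt (sector S A x)‖ ^ 2 ≤ ‖sector S A x‖ ^ 2 := by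
  -- At an excited site P_Ω vanishes, so `gapOp` reduces to √2 (H + 1)^{-1/2}.
  have h : siteOp i S.gapOp * sector S A =
      ((Real.sqrt 2 : ℝ) : ℂ) • (siteOp i S.invSqrt * sector S A) := by
    unfold SiteData.gapOp
    rw [← siteOp_mul, mul_assoc, siteOp_add, siteOp_smul, sub_eq_add_neg, siteOp_add,
      siteOp_one, ← neg_one_smul ℂ S.projΩ, siteOp_smul, add_mul, smul_mul_assoc, add_mul,
      smul_mul_assoc, siteOp_projΩ_mul_sector, if_pos hi, one_mul, smul_zero, add_zero, zero_add,
      mul_smul_comm]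
  have h1 := norm_siteOp_le i S.gapOp S.norm_gapOp_le (sector S A x)
  have h2 : siteOp i S.gapOp (sector S A x) =
      ((Real.sqrt 2 : ℝ) : ℂ) • siteOp i S.invSqrt (sector S A x) :=
    congrArg (fun T : HTensor ι 𝓗 →L[ℂ] HTensor ι 𝓗 => T x) h
  rw [h2] at h1
  have h3 := pow_le_pow_left₀ (norm_nonneg _) h1 2
  rwa [norm_smul, mul_pow, Complex.norm_real, Real.norm_eq_abs, sq_abs,
    Real.sq_sqrt (by norm_num)] at h3

/-- Apply the bound on (H_i + 1)^{-1/2} to the vector (H_i + 1)^{1/2} x: the resulting H_i + 1 ≥ 2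
is H_i ≥ 1. -/
lemma norm_sq_le_siteEnergy_sector {i : ι} {A : Finset ι} (hi : i ∈ A) {x : HTensor ι 𝓗}
    (hx : x ∈ (sqrtSite S i).domain) :
    ‖sector S A x‖ ^ 2 ≤ siteEnergy S i (sector S A x) := by
  have hc := commute_siteOp_sector (i := i) S (commute_invSqrt_projΩ S) A
  have h := two_mul_norm_sq_le (S := S) hi (root S i x)
  rw [apply_comm hc, siteOp_root hx, ← root_map hc hx] at h
  unfold siteEnergy
  linarith

lemma siteEnergy_sector_nonneg {i : ι} (A : Finset ι) {x : HTensor ι 𝓗}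
    (hx : x ∈ (sqrtSite S i).domain) : 0 ≤ siteEnergy S i (sector S A x) := by
  by_cases hi : i ∈ A
  · exact (sq_nonneg _).trans (norm_sq_le_siteEnergy_sector hi hx)
  · rw [siteEnergy_sector_of_notMem hi]

lemma siteEnergy_nonneg {i : ι} {x : HTensor ι 𝓗} (hx : x ∈ (sqrtSite S i).domain) :
    0 ≤ siteEnergy S i x := by
  rw [siteEnergy_eq_sum_sector hx]
  exact Finset.sum_nonneg fun A _ => siteEnergy_sector_nonneg A hx

lemma energyOn_nonneg {B : Finset ι} {x : HTensor ι 𝓗} (hx : x ∈ formDomain S B) :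
    0 ≤ energyOn S B x :=
  Finset.sum_nonneg fun _ hi => siteEnergy_nonneg (formDomain_le S hi hx)

lemma siteEnergy_diagOp_le {i : ι} {x : HTensor ι 𝓗} (hx : x ∈ (sqrtSite S i).domain)
    {F : Finset ι → ℝ} {c : ℝ} (hF : ∀ A, F A ^ 2 ≤ c) :
    siteEnergy S i (diagOp S F x) ≤ c * siteEnergy S i x := by
  rw [siteEnergy_diagOp hx, siteEnergy_eq_sum_sector hx, Finset.mul_sum]
  exact Finset.sum_le_sum fun A _ =>
    mul_le_mul_of_nonneg_right (hF A) (siteEnergy_sector_nonneg A hx)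

lemma energyOn_diagOp_le {B : Finset ι} {x : HTensor ι 𝓗} (hx : x ∈ formDomain S B)
    {F : Finset ι → ℝ} {c : ℝ} (hF : ∀ A, F A ^ 2 ≤ c) :
    energyOn S B (diagOp S F x) ≤ c * energyOn S B x := by
  unfold energyOn
  rw [Finset.mul_sum]
  exact Finset.sum_le_sum fun i hi => siteEnergy_diagOp_le (formDomain_le S hi hx) hF

/-- The spectral gap: `H⁰_B ≥ P⁺_B`. -/
lemma norm_sq_projPlus_le {B : Finset ι} {x : HTensor ι 𝓗} (hx : x ∈ formDomain S B) :
    ‖projPlus S B x‖ ^ 2 ≤ energyOn S B (projPlus S B x) := by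
  rw [projPlus_eq_diagOp]
  unfold energyOn
  rw [norm_sq_diagOp, Finset.sum_congr rfl fun i hi =>
    siteEnergy_diagOp (formDomain_le S hi hx) _, Finset.sum_comm]
  refine Finset.sum_le_sum fun A _ => ?_
  rw [← Finset.mul_sum]
  split_ifs with h
  · simp
  -- A sector that meets B has an excited site in B; its energy alone dominates the norm, and the
  -- other energies are non-negative.
  · obtain ⟨j, hj⟩ := Finset.nonempty_iff_ne_empty.2 h
    rw [Finset.mem_inter] at hj
    have h1 := norm_sq_le_siteEnergy_sector hj.1 (formDomain_le S hj.2 hx)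
    have h2 := Finset.single_le_sum (f := fun i => siteEnergy S i (sector S A x))
      (fun i hi => siteEnergy_sector_nonneg A (formDomain_le S hi hx)) hj.2
    linarith

lemma energyOn_projPlus_le {A B : Finset ι} {x : HTensor ι 𝓗} (hx : x ∈ formDomain S B) :
    energyOn S B (projPlus S A x) ≤ energyOn S B x := by
  rw [projPlus_eq_diagOp]
  refine (energyOn_diagOp_le hx (c := 1) fun A => ?_).trans_eq (one_mul _)
  split_ifs <;> simp

lemma projMinus_projPlus (A : Finset ι) (x : HTensor ι 𝓗) :
    projMinus S A (projPlus S A x) = 0 := by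
  rw [projMinus_eq_diagOp, projPlus_eq_diagOp, ← mul_apply_eq_comp, diagOp_mul]
  have : ((fun B : Finset ι => if B ∩ A = ∅ then (1 : ℝ) else 0) *
      fun B => if B ∩ A = ∅ then 0 else 1) = fun _ => 0 := by
    ext B
    rw [Pi.mul_apply]
    split_ifs <;> simp
  rw [this, diagOp_const]
  simp

lemma projPlus_projMinus (A : Finset ι) (x : HTensor ι 𝓗) :
    projPlus S A (projMinus S A x) = 0 := by
  have h := projMinus_projPlus (S := S) A x
  rw [projPlus] at *
  simp only [sub_apply, one_apply_eq_self, map_sub] at *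
  exact h

lemma adjoint_projPlus (A : Finset ι) :
    ContinuousLinearMap.adjoint (projPlus S A) = projPlus S A := by
  rw [projPlus_eq_diagOp, adjoint_diagOp]

lemma adjoint_projMinus (A : Finset ι) :
    ContinuousLinearMap.adjoint (projMinus S A) = projMinus S A := by
  rw [projMinus_eq_diagOp, adjoint_diagOp]

lemma projMinus_add_projPlus (A : Finset ι) (x : HTensor ι 𝓗) :
    projMinus S A x + projPlus S A x = x := by
  simp [projPlus]

end FormDomain

/-! ### Locality and block-diagonality of forms and operators. -/

section Locality

set_option linter.unusedSectionVars false

variable {ι : Type*} [Fintype ι] [DecidableEq ι]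
variable {𝓗 : Type*} [NormedAddCommGroup 𝓗] [InnerProductSpace ℂ 𝓗] [CompleteSpace 𝓗]
variable {S : SiteData 𝓗} {A B : Finset ι}

namespace Form

lemma eval_zero (x y : HTensor ι 𝓗) : (0 : Form S A).eval x y = 0 := by
  unfold Form.eval
  split_ifs <;> simp

lemma eval_sub (v w : Form S A) (x y : HTensor ι 𝓗) :
    (v - w).eval x y = v.eval x y - w.eval x y := by
  unfold Form.eval
  split_ifs <;> simp

lemma eval_smul (c : ℂ) (v : Form S A) (x y : HTensor ι 𝓗) :
    (c • v).eval x y = c * v.eval x y := by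
  unfold Form.eval
  split_ifs <;> simp

lemma eval_sum {κ : Type*} (s : Finset κ) (f : κ → Form S A) (x y : HTensor ι 𝓗) :
    (∑ k ∈ s, f k).eval x y = ∑ k ∈ s, (f k).eval x y := by
  classical
  induction s using Finset.induction_on with
  | empty => simp [eval_zero]
  | insert k s hk ih => rw [Finset.sum_insert hk, Finset.sum_insert hk, Form.eval_add, ih]

lemma eval_add_right (v : Form S A) {x y z : HTensor ι 𝓗} (hx : x ∈ formDomain S A)
    (hy : y ∈ formDomain S A) (hz : z ∈ formDomain S A) :
    v.eval x (y + z) = v.eval x y + v.eval x z := by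
  rw [v.eval_of_mem hx hy, v.eval_of_mem hx hz, v.eval_of_mem hx (add_mem hy hz), ← map_add]
  rfl

lemma eval_add_left (v : Form S A) {x y z : HTensor ι 𝓗} (hx : x ∈ formDomain S A)
    (hy : y ∈ formDomain S A) (hz : z ∈ formDomain S A) :
    v.eval (x + y) z = v.eval x z + v.eval y z := by
  rw [v.eval_of_mem hx hz, v.eval_of_mem hy hz, v.eval_of_mem (add_mem hx hy) hz,
    ← LinearMap.add_apply, ← map_add]
  rfl

lemma eval_smul_right (v : Form S A) (c : ℂ) {x y : HTensor ι 𝓗} (hx : x ∈ formDomain S A)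
    (hy : y ∈ formDomain S A) : v.eval x (c • y) = c * v.eval x y := by
  rw [v.eval_of_mem hx hy, v.eval_of_mem hx (Submodule.smul_mem _ c hy), ← smul_eq_mul,
    ← map_smul]
  rfl

lemma eval_smul_left (v : Form S A) (c : ℂ) {x y : HTensor ι 𝓗} (hx : x ∈ formDomain S A)
    (hy : y ∈ formDomain S A) : v.eval (c • x) y = starRingEnd ℂ c * v.eval x y := by
  rw [v.eval_of_mem hx hy, v.eval_of_mem (Submodule.smul_mem _ c hx) hy, ← smul_eq_mul,
    ← LinearMap.smul_apply, ← LinearMap.map_smulₛₗ]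
  rfl

lemma eval_sum_right {κ : Type*} (v : Form S A) (s : Finset κ) {x : HTensor ι 𝓗}
    {y : κ → HTensor ι 𝓗} (hx : x ∈ formDomain S A) (hy : ∀ k, y k ∈ formDomain S A) :
    v.eval x (∑ k ∈ s, y k) = ∑ k ∈ s, v.eval x (y k) := by
  classical
  induction s using Finset.induction_on with
  | empty =>
    rw [Finset.sum_empty, Finset.sum_empty, v.eval_of_mem hx (zero_mem _)]
    exact map_zero (v ⟨x, hx⟩)
  | insert k s hk ih =>
    rw [Finset.sum_insert hk, Finset.sum_insert hk,
      v.eval_add_right hx (hy k) (sum_mem fun k _ => hy k), ih]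

lemma eval_sum_left {κ : Type*} (v : Form S A) (s : Finset κ) {x : κ → HTensor ι 𝓗}
    {y : HTensor ι 𝓗} (hx : ∀ k, x k ∈ formDomain S A) (hy : y ∈ formDomain S A) :
    v.eval (∑ k ∈ s, x k) y = ∑ k ∈ s, v.eval (x k) y := by
  classical
  induction s using Finset.induction_on with
  | empty =>
    rw [Finset.sum_empty, Finset.sum_empty, v.eval_of_mem (zero_mem _) hy]
    change v 0 _ = 0
    simp
  | insert k s hk ih =>
    rw [Finset.sum_insert hk, Finset.sum_insert hk,
      v.eval_add_left (hx k) (sum_mem fun k _ => hx k) hy, ih]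

lemma eval_zero_right (v : Form S A) {x : HTensor ι 𝓗} (hx : x ∈ formDomain S A) :
    v.eval x 0 = 0 := by
  simpa using v.eval_sum_right (∅ : Finset ℕ) (y := fun _ => 0) hx (fun _ => zero_mem _)

lemma eval_zero_left (v : Form S A) {y : HTensor ι 𝓗} (hy : y ∈ formDomain S A) :
    v.eval 0 y = 0 := by
  simpa using v.eval_sum_left (∅ : Finset ℕ) (x := fun _ => 0) (fun _ => zero_mem _) hy

lemma eval_extend (v : Form S A) (h : A ⊆ B) {x y : HTensor ι 𝓗} (hx : x ∈ formDomain S B)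
    (hy : y ∈ formDomain S B) : (v.extend B).eval x y = v.eval x y := by
  rw [Form.eval_of_mem _ hx hy,
    v.eval_of_mem (formDomain_anti S h hx) (formDomain_anti S h hy), Form.extend, dif_pos h]
  rfl

lemma eval_tsum {f : ℕ → Form S A} (h : ∀ x y, Summable fun n => f n x y)
    {x y : HTensor ι 𝓗} (hx : x ∈ formDomain S A) (hy : y ∈ formDomain S A) :
    (Form.tsum f).eval x y = ∑' n, (f n).eval x y := by
  rw [Form.eval_of_mem _ hx hy, Form.tsum, dif_pos h]
  simp only [Form.eval_of_mem _ hx hy]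
  rfl

lemma eval_sandwich (v : Form S A) {X Y : HTensor ι 𝓗 →L[ℂ] HTensor ι 𝓗}
    (h : (∀ x ∈ formDomain S A, (ContinuousLinearMap.adjoint X : _ →ₗ[ℂ] _) x ∈ formDomain S A) ∧
      ∀ x ∈ formDomain S A, (Y : _ →ₗ[ℂ] _) x ∈ formDomain S A)
    {x y : HTensor ι 𝓗} (hx : x ∈ formDomain S A) (hy : y ∈ formDomain S A) :
    (v.sandwich X Y).eval x y = v.eval (ContinuousLinearMap.adjoint X x) (Y y) := by
  rw [Form.eval_of_mem _ hx hy, v.eval_of_mem (x := ContinuousLinearMap.adjoint X x) (y := Y y)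
    (h.1 x hx) (h.2 y hy), Form.sandwich, dif_pos h]
  rfl

lemma isLocal_zero : (0 : Form S A).IsLocal := fun j _ b x _ y _ => by
  rw [eval_zero, eval_zero]

lemma IsLocal.add {v w : Form S A} (hv : v.IsLocal) (hw : w.IsLocal) : (v + w).IsLocal :=
  fun j hj b x hx y hy => by
    rw [Form.eval_add, Form.eval_add, hv j hj b x hx y hy, hw j hj b x hx y hy]

lemma IsLocal.sub {v w : Form S A} (hv : v.IsLocal) (hw : w.IsLocal) : (v - w).IsLocal :=
  fun j hj b x hx y hy => by
    rw [Form.eval_sub, Form.eval_sub, hv j hj b x hx y hy, hw j hj b x hx y hy]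

lemma IsLocal.smul {v : Form S A} (hv : v.IsLocal) (c : ℂ) : (c • v).IsLocal :=
  fun j hj b x hx y hy => by
    rw [Form.eval_smul, Form.eval_smul, hv j hj b x hx y hy]

lemma isLocal_sum {κ : Type*} {s : Finset κ} {f : κ → Form S A}
    (h : ∀ k ∈ s, (f k).IsLocal) : (∑ k ∈ s, f k).IsLocal :=
  fun j hj b x hx y hy => by
    rw [Form.eval_sum, Form.eval_sum]
    exact Finset.sum_congr rfl fun k hk => h k hk j hj b x hx y hy

lemma adjoint_siteOp_mem {j : ι} (hj : j ∉ A) (b : 𝓗 →L[ℂ] 𝓗) {x : HTensor ι 𝓗}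
    (hx : x ∈ formDomain S A) :
    ContinuousLinearMap.adjoint (siteOp j b) x ∈ formDomain S A := by
  rw [adjoint_siteOp]
  exact siteOp_mem hj _ hx

/-- A series without a sum is read as 0, which is local too. Locality along the recursion therefore
requires no convergence. -/
lemma isLocal_tsum {f : ℕ → Form S A} (h : ∀ n, (f n).IsLocal) : (Form.tsum f).IsLocal := by
  by_cases hs : ∀ x y, Summable fun n => f n x y
  · intro j hj b x hx y hy
    rw [eval_tsum hs hx (siteOp_mem hj b hy), eval_tsum hs (adjoint_siteOp_mem hj b hx) hy]
    exact tsum_congr fun n => h n j hj b x hx y hy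
  · rw [Form.tsum, dif_neg hs]
    exact isLocal_zero

lemma IsLocal.extend {v : Form S A} (hv : v.IsLocal) (B : Finset ι) : (v.extend B).IsLocal := by
  by_cases h : A ⊆ B
  · intro j hj b x hx y hy
    rw [v.eval_extend h hx (siteOp_mem hj b hy),
      v.eval_extend h (adjoint_siteOp_mem hj b hx) hy]
    exact hv j (fun hA => hj (h hA)) b x (formDomain_anti S h hx) y (formDomain_anti S h hy)
  · rw [Form.extend, dif_neg h]
    exact isLocal_zero

end Form

/-- The operator `X` acts as the identity on the factors outside `A`. -/
def IsLocalOp (A : Finset ι) (X : HTensor ι 𝓗 →L[ℂ] HTensor ι 𝓗) : Prop :=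
  ∀ j ∉ A, ∀ b : 𝓗 →L[ℂ] 𝓗, Commute (siteOp j b) X

lemma isLocalOp_one : IsLocalOp A (1 : HTensor ι 𝓗 →L[ℂ] HTensor ι 𝓗) :=
  fun _ _ _ => Commute.one_right _

lemma IsLocalOp.adjoint {X : HTensor ι 𝓗 →L[ℂ] HTensor ι 𝓗} (h : IsLocalOp A X) :
    IsLocalOp A (ContinuousLinearMap.adjoint X) := by
  intro j hj b
  have h1 := h j hj (ContinuousLinearMap.adjoint b)
  have h2 := congrArg (star : (HTensor ι 𝓗 →L[ℂ] HTensor ι 𝓗) → _) h1.eq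
  rw [star_mul, star_mul, ContinuousLinearMap.star_eq_adjoint,
    ContinuousLinearMap.star_eq_adjoint, adjoint_siteOp,
    ContinuousLinearMap.adjoint_adjoint] at h2
  exact h2.symm

lemma IsLocalOp.mono {X : HTensor ι 𝓗 →L[ℂ] HTensor ι 𝓗} (h : IsLocalOp A X) (hAB : A ⊆ B) :
    IsLocalOp B X := fun j hj b => h j (fun hA => hj (hAB hA)) b

lemma isLocalOp_projMinus (S : SiteData 𝓗) (A : Finset ι) : IsLocalOp A (projMinus S A) := by
  intro j hj b
  refine commute_siteOp_tensorMap ?_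
  rw [if_neg hj]
  exact Commute.one_right _

lemma isLocalOp_projPlus (S : SiteData 𝓗) (A : Finset ι) : IsLocalOp A (projPlus S A) :=
  fun j hj b => (Commute.one_right _).sub_right (isLocalOp_projMinus S A j hj b)

lemma isLocalOp_tsum {f : ℕ → HTensor ι 𝓗 →L[ℂ] HTensor ι 𝓗} (h : ∀ n, IsLocalOp A (f n)) :
    IsLocalOp A (∑' n, f n) := by
  intro j hj b
  by_cases hs : Summable f
  · rw [Commute, SemiconjBy, ← hs.tsum_mul_left, ← hs.tsum_mul_right]
    exact tsum_congr fun n => (h n j hj b).eq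
  · rw [tsum_eq_zero_of_not_summable hs]
    exact Commute.zero_right _

namespace Form

lemma IsLocal.sandwich {v : Form S A} (hv : v.IsLocal) {X Y : HTensor ι 𝓗 →L[ℂ] HTensor ι 𝓗}
    (hX : IsLocalOp A X) (hY : IsLocalOp A Y) : (v.sandwich X Y).IsLocal := by
  by_cases h : (∀ x ∈ formDomain S A,
      (ContinuousLinearMap.adjoint X : _ →ₗ[ℂ] _) x ∈ formDomain S A) ∧
      ∀ x ∈ formDomain S A, (Y : _ →ₗ[ℂ] _) x ∈ formDomain S A
  · intro j hj b x hx y hy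
    rw [v.eval_sandwich h hx (siteOp_mem hj b hy),
      v.eval_sandwich h (adjoint_siteOp_mem hj b hx) hy, ← apply_comm (hY j hj b),
      adjoint_siteOp, ← apply_comm (hX.adjoint j hj _), ← adjoint_siteOp]
    exact hv j hj b _ (h.1 x hx) _ (h.2 y hy)
  · rw [Form.sandwich, dif_neg h]
    exact isLocal_zero

lemma IsLocal.ad {v : Form S A} (hv : v.IsLocal) {X : HTensor ι 𝓗 →L[ℂ] HTensor ι 𝓗}
    (hX : IsLocalOp A X) : (Form.ad X v).IsLocal :=
  (hv.sandwich hX isLocalOp_one).sub (hv.sandwich isLocalOp_one hX)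

lemma IsLocal.diag {v : Form S A} (hv : v.IsLocal) : v.diag.IsLocal :=
  (hv.sandwich (isLocalOp_projPlus S A) (isLocalOp_projPlus S A)).add
    (hv.sandwich (isLocalOp_projMinus S A) (isLocalOp_projMinus S A))

lemma isLocal_foldr_ad {κ : Type*} {X : κ → HTensor ι 𝓗 →L[ℂ] HTensor ι 𝓗}
    (hX : ∀ r, IsLocalOp A (X r)) {v : Form S A} (hv : v.IsLocal) (l : List κ) :
    (l.foldr (fun r w => Form.ad (X r) w) v).IsLocal := by
  induction l with
  | nil => exact hv
  | cons r l ih => exact ih.ad (hX r)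

lemma isLocal_adExp {v : Form S A} (hv : v.IsLocal) {X : HTensor ι 𝓗 →L[ℂ] HTensor ι 𝓗}
    (hX : IsLocalOp A X) : (adExp X v).IsLocal := by
  refine isLocal_tsum fun n => IsLocal.smul ?_ _
  induction n + 1 with
  | zero => exact hv
  | succ n ih =>
    rw [Function.iterate_succ_apply']
    exact ih.ad hX

lemma isLocal_formH0 (S : SiteData 𝓗) (A : Finset ι) : (formH0 S A).IsLocal := by
  intro j hj b x hx y hy
  rw [formH0_eval hx (siteOp_mem hj b hy), formH0_eval (adjoint_siteOp_mem hj b hx) hy]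
  refine Finset.sum_congr rfl fun i hi => ?_
  have hij : ∀ c : 𝓗 →L[ℂ] 𝓗, Commute (siteOp i S.invSqrt) (siteOp j c) := fun c =>
    commute_siteOp fun h => absurd (h ▸ hi) hj
  unfold siteForm
  rw [root_map (hij b) (formDomain_le S hi hy), adjoint_siteOp,
    root_map (hij _) (formDomain_le S hi hx), ← adjoint_siteOp,
    ContinuousLinearMap.adjoint_inner_left, ContinuousLinearMap.adjoint_inner_left]

end Form

/-- Locality follows from uniqueness. Conjugating T by an invertible operator on a factor outside A
gives another solution of the same equation, hence T itself. Every bounded operator on a factor is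
an invertible one minus a scalar. Where the equation has no unique solution, the term is 0 and
nothing is left to prove. -/
lemma isLocalOp_resolventTerm {g v : Form S A} (hg : g.IsLocal) (hv : v.IsLocal) (E : ℂ) :
    IsLocalOp A (resolventTerm g E v) := by
  by_cases h : ∃! T, IsResolventTerm g E v T
  swap
  · rw [resolventTerm, dif_neg h]
    exact fun _ _ _ => Commute.zero_right _
  rw [resolventTerm, dif_pos h]
  have hT := h.choose_spec.1
  set T := h.choose
  intro j hj
  have hunit : ∀ b : (𝓗 →L[ℂ] 𝓗)ˣ, Commute (siteOp j (b : 𝓗 →L[ℂ] 𝓗)) T := by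
    intro b
    set X : HTensor ι 𝓗 →L[ℂ] HTensor ι 𝓗 := siteOp j (b : 𝓗 →L[ℂ] 𝓗)
    set Y : HTensor ι 𝓗 →L[ℂ] HTensor ι 𝓗 := siteOp j ((b⁻¹ : (𝓗 →L[ℂ] 𝓗)ˣ) : 𝓗 →L[ℂ] 𝓗)
    have hXY : X * Y = 1 := by rw [siteOp_mul, Units.mul_inv, siteOp_one]
    have hYX : Y * X = 1 := by rw [siteOp_mul, Units.inv_mul, siteOp_one]
    have hPp : Commute Y (projPlus S A) := isLocalOp_projPlus S A j hj _
    have hPm : Commute Y (projMinus S A) := isLocalOp_projMinus S A j hj _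
    have hPm' : Commute X (projMinus S A) := isLocalOp_projMinus S A j hj _
    have hres : IsResolventTerm g E v (Y * T * X) := by
      intro y
      obtain ⟨h1, h2, h3⟩ := hT (X y)
      change Y (T (X y)) ∈ _ ∧ projPlus S A (Y (T (X y))) = Y (T (X y)) ∧ _
      refine ⟨siteOp_mem hj _ h1, ?_, fun z hz => ?_⟩
      · rw [← apply_comm hPp, h2]
      · change g.eval z (Y (T (X y))) - E * inner ℂ z (Y (T (X y))) = _
        have hz' := Form.adjoint_siteOp_mem hj ((b⁻¹ : (𝓗 →L[ℂ] 𝓗)ˣ) : 𝓗 →L[ℂ] 𝓗) hz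
        rw [hg j hj _ z hz _ h1, ← ContinuousLinearMap.adjoint_inner_left, h3 _ hz',
          adjoint_siteOp, ← apply_comm (isLocalOp_projPlus S A j hj _), ← adjoint_siteOp,
          ← hv j hj _ _ (projPlus_mem A hz) _ (projMinus_mem A _), apply_comm hPm]
        congr 2
        exact congrArg (fun T : HTensor ι 𝓗 →L[ℂ] HTensor ι 𝓗 => T y) hYX
    have := h.unique hres hT
    rw [Commute, SemiconjBy]
    calc X * T = X * (Y * T * X) := by rw [this]
      _ = (X * Y) * T * X := by simp only [mul_assoc]
      _ = T * X := by rw [hXY, one_mul]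
  intro b
  -- |c| > ‖b‖, so c + b is invertible by the Neumann series.
  set c : ℂ := ((‖b‖ + 1 : ℝ) : ℂ) with hc
  have hcn : ‖c‖ = ‖b‖ + 1 := by
    rw [hc, Complex.norm_real, Real.norm_eq_abs, abs_of_nonneg (by positivity)]
  have hu : IsUnit (c • (1 : 𝓗 →L[ℂ] 𝓗) + b) := by
    have hb : ‖-(c⁻¹ • b)‖ < 1 := by
      rw [norm_neg, norm_smul, norm_inv, hcn, inv_mul_eq_div, div_lt_one (by positivity)]
      linarith
    have h1 : IsUnit (1 - -(c⁻¹ • b)) := isUnit_one_sub_of_norm_lt_one hb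
    have hc0 : c ≠ 0 := norm_ne_zero_iff.1 (by rw [hcn]; positivity)
    have h2 := h1.smul (Units.mk0 c hc0)
    convert h2 using 1
    rw [Units.smul_mk0, sub_neg_eq_add, smul_add, smul_smul, mul_inv_cancel₀ hc0, one_smul]
  obtain ⟨u, hu⟩ := hu
  have h1 := hunit u
  rw [hu, siteOp_add, siteOp_smul, siteOp_one] at h1
  have h2 := h1.sub_left (((Commute.one_left T).smul_left c))
  rwa [add_sub_cancel_left] at h2

lemma isLocalOp_antiTerm {g v : Form S A} (hg : g.IsLocal) (hv : v.IsLocal) (E : ℂ) :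
    IsLocalOp A (antiTerm g E v) := fun j hj b =>
  (isLocalOp_resolventTerm hg hv E j hj b).sub_right
    ((isLocalOp_resolventTerm hg hv E).adjoint j hj b)

lemma isLocal_seriesV {g v : Form S A} (hg : g.IsLocal) (hv : v.IsLocal) (E : ℂ) (n : ℕ) :
    (seriesV g E v n).IsLocal := by
  induction n using Nat.strong_induction_on with
  | _ n ih =>
    match n with
    | 0 =>
      rw [seriesV]
      exact Form.isLocal_zero
    | 1 =>
      rw [seriesV]
      exact hv
    | j + 2 =>
      have hX : ∀ r : ℕ, IsLocalOp A
          (if _h : r < j + 2 then antiTerm g E (seriesV g E v r) else 0) := by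
        intro r
        split_ifs with h
        · exact isLocalOp_antiTerm hg (ih r h) E
        · exact fun _ _ _ => Commute.zero_right _
      rw [seriesV]
      refine Form.IsLocal.add (Form.isLocal_sum fun c _ => ?_) (Form.isLocal_sum fun c _ => ?_)
      · split_ifs
        · exact (Form.isLocal_foldr_ad hX hg _).smul _
        · exact Form.isLocal_zero
      · exact (Form.isLocal_foldr_ad hX hv _).smul _

lemma isLocalOp_generator {g v : Form S A} (hg : g.IsLocal) (hv : v.IsLocal) (E : ℂ) (t : ℝ) :
    IsLocalOp A (generator t g E v) :=
  isLocalOp_tsum fun n j hj b =>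
    (isLocalOp_antiTerm hg (isLocal_seriesV hg hv E (n + 1)) E j hj b).smul_right _

lemma isLocal_diagonalized {g v : Form S A} (hg : g.IsLocal) (hv : v.IsLocal) (E : ℂ) (t : ℝ) :
    (diagonalized t g E v).IsLocal :=
  Form.isLocal_tsum fun n => ((isLocal_seriesV hg hv E (n + 1)).diag).smul _

/-- `v` is block diagonal: `P⁺ v P⁻ = P⁻ v P⁺ = 0`. -/
def Form.IsBlockDiag (v : Form S A) : Prop :=
  ∀ x ∈ formDomain S A, ∀ y ∈ formDomain S A,
    v.eval (projPlus S A x) (projMinus S A y) = 0 ∧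
    v.eval (projMinus S A x) (projPlus S A y) = 0

lemma Form.isBlockDiag_zero : (0 : Form S A).IsBlockDiag := fun x _ y _ => by
  simp [Form.eval_zero]

lemma projPlus_preserves (S : SiteData 𝓗) (A : Finset ι) :
    (∀ x ∈ formDomain S A,
      (ContinuousLinearMap.adjoint (projPlus S A) : _ →ₗ[ℂ] _) x ∈ formDomain S A) ∧
      ∀ x ∈ formDomain S A, (projPlus S A : _ →ₗ[ℂ] _) x ∈ formDomain S A := by
  rw [adjoint_projPlus]
  exact ⟨fun x hx => projPlus_mem A hx, fun x hx => projPlus_mem A hx⟩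

lemma projMinus_preserves (S : SiteData 𝓗) (A : Finset ι) :
    (∀ x ∈ formDomain S A,
      (ContinuousLinearMap.adjoint (projMinus S A) : _ →ₗ[ℂ] _) x ∈ formDomain S A) ∧
      ∀ x ∈ formDomain S A, (projMinus S A : _ →ₗ[ℂ] _) x ∈ formDomain S A := by
  rw [adjoint_projMinus]
  exact ⟨fun x _ => projMinus_mem A x, fun x _ => projMinus_mem A x⟩

lemma Form.isBlockDiag_diag (v : Form S A) : v.diag.IsBlockDiag := by
  intro x hx y hy
  have hpx := projPlus_mem A hx
  have hpy := projPlus_mem A hy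
  have hmx := projMinus_mem (S := S) A x
  have hmy := projMinus_mem (S := S) A y
  unfold Form.diag
  rw [Form.eval_add, Form.eval_add, v.eval_sandwich (projPlus_preserves S A) hpx hmy,
    v.eval_sandwich (projPlus_preserves S A) hmx hpy,
    v.eval_sandwich (projMinus_preserves S A) hpx hmy,
    v.eval_sandwich (projMinus_preserves S A) hmx hpy, adjoint_projPlus, adjoint_projMinus,
    projMinus_projPlus, projMinus_projPlus, projPlus_projMinus, projPlus_projMinus,
    v.eval_zero_right (projPlus_mem A hpx), v.eval_zero_right (projMinus_mem A _),
    v.eval_zero_left (projPlus_mem A hpy), v.eval_zero_left (projMinus_mem A _)]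
  simp

lemma Form.isBlockDiag_tsum {f : ℕ → Form S A} (h : ∀ n, (f n).IsBlockDiag) :
    (Form.tsum f).IsBlockDiag := by
  by_cases hs : ∀ x y, Summable fun n => f n x y
  · intro x hx y hy
    rw [Form.eval_tsum hs (projPlus_mem A hx) (projMinus_mem A y),
      Form.eval_tsum hs (projMinus_mem A x) (projPlus_mem A hy)]
    simp only [(h _ x hx y hy).1, (h _ x hx y hy).2, tsum_zero, and_self]
  · rw [Form.tsum, dif_neg hs]
    exact Form.isBlockDiag_zero

/-- Every term of the series is a block-diagonal part, so nothing about the v_j is required; the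
default value 0 of a divergent series is block diagonal as well. -/
lemma isBlockDiag_diagonalized (t : ℝ) (g : Form S A) (E : ℂ) (v : Form S A) :
    (diagonalized t g E v).IsBlockDiag := by
  refine Form.isBlockDiag_tsum fun n x hx y hy => ?_
  have h := (seriesV g E v (n + 1)).isBlockDiag_diag x hx y hy
  rw [Form.eval_smul, Form.eval_smul, h.1, h.2]
  simp

end Locality

/-! ### Bounded local forms and their comparison with H⁰. -/

section BoundedForms

set_option linter.unusedSectionVars false

variable {ι : Type*} [Fintype ι] [DecidableEq ι]
variable {𝓗 : Type*} [NormedAddCommGroup 𝓗] [InnerProductSpace ℂ 𝓗] [CompleteSpace 𝓗]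
variable {S : SiteData 𝓗} {A B : Finset ι}

variable (S) in
/-- `‖(H⁰_A + 1) ^ (1/2) x‖` as a real number, for `x` in the form domain. -/
def formNorm (A : Finset ι) (x : HTensor ι 𝓗) : ℝ := Real.sqrt (energyOn S A x + ‖x‖ ^ 2)

lemma formNorm_nonneg (x : HTensor ι 𝓗) : 0 ≤ formNorm S A x := Real.sqrt_nonneg _

/-- `|v(x, y)| ≤ C ‖(H⁰_A + 1) ^ (1/2) x‖ ‖(H⁰_A + 1) ^ (1/2) y‖`. -/
def Form.BoundedBy (v : Form S A) (C : ℝ) : Prop :=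
  ∀ x ∈ formDomain S A, ∀ y ∈ formDomain S A,
    ‖v.eval x y‖ ≤ C * formNorm S A x * formNorm S A y

/-- Every C + ε exceeds the infimum and so bounds v; letting ε tend to 0 shows that C itself is
admissible. -/
lemma Form.boundedBy_of_normH0_le {v : Form S A} {C : ℝ} (hC : 0 ≤ C)
    (h : v.normH0 ≤ ENNReal.ofReal C) : v.BoundedBy C := by
  intro x hx y hy
  set W := formNorm S A x * formNorm S A y with hW
  have hW0 : 0 ≤ W := mul_nonneg (formNorm_nonneg _) (formNorm_nonneg _)
  have hε : ∀ ε > 0, ‖v.eval x y‖ ≤ (C + ε) * W := by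
    intro ε hε
    have hlt : v.normH0 < ENNReal.ofReal (C + ε) :=
      h.trans_lt (ENNReal.ofReal_lt_ofReal_iff (by linarith) |>.2 (by linarith))
    obtain ⟨C', hC', hlt'⟩ := sInf_lt_iff.1 hlt
    have h1 := hC' x hx y hy
    rw [weight_of_mem hx, weight_of_mem hy, mul_assoc,
      ← ENNReal.ofReal_mul (Real.sqrt_nonneg _)] at h1
    have h2 : ‖v.eval x y‖ₑ ≤ ENNReal.ofReal ((C + ε) * W) := by
      rw [ENNReal.ofReal_mul (by linarith)]
      exact h1.trans (mul_le_mul_left hlt'.le _)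
    rw [← ofReal_norm] at h2
    exact (ENNReal.ofReal_le_ofReal_iff (by positivity)).1 h2
  rw [mul_assoc, ← hW]
  by_contra! hc
  -- The denominator W + 1 rather than W also covers W = 0 and makes ε W strictly smaller than the
  -- supposed excess.
  have h1 := hε ((‖v.eval x y‖ - C * W) / (W + 1)) (div_pos (by linarith) (by linarith))
  rw [add_mul, div_mul_eq_mul_div] at h1
  have h2 : (‖v.eval x y‖ - C * W) * W / (W + 1) < ‖v.eval x y‖ - C * W := by
    rw [div_lt_iff₀ (by linarith)]
    nlinarith
  linarith

lemma formNorm_projMinus (x : HTensor ι 𝓗) :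
    formNorm S A (projMinus S A x) = ‖projMinus S A x‖ := by
  have h : energyOn S A (projMinus S A x) = 0 :=
    Finset.sum_eq_zero fun i hi => by rw [siteEnergy, root_projMinus hi, sub_self]
  rw [formNorm, h, zero_add, Real.sqrt_sq (norm_nonneg _)]

lemma norm_projMinus_le (x : HTensor ι 𝓗) : ‖projMinus S A x‖ ≤ ‖x‖ := by
  rw [projMinus_eq_diagOp]
  refine le_of_sq_le_sq ?_ (norm_nonneg _)
  rw [norm_sq_diagOp, norm_sq_eq_sum_sector S x]
  refine Finset.sum_le_sum fun B _ => ?_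
  split_ifs
  · simp
  · simp

lemma vacuum_mem (S : SiteData 𝓗) (A : Finset ι) : vacuum S ∈ formDomain S A := by
  rw [← projMinus_vacuum A]
  exact projMinus_mem A _

lemma norm_vacuum : ‖(vacuum S : HTensor ι 𝓗)‖ = 1 := by
  have h := inner_self_eq_norm_sq_to_K (𝕜 := ℂ) (vacuum S : HTensor ι 𝓗)
  have h2 : inner ℂ (vacuum S : HTensor ι 𝓗) (vacuum S) = 1 := by
    unfold vacuum
    rw [inner_htprod]
    refine Finset.prod_eq_one fun i _ => ?_
    rw [inner_self_eq_norm_sq_to_K, S.norm_Ω]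
    simp
  rw [h2] at h
  have h3 : (‖(vacuum S : HTensor ι 𝓗)‖ ^ 2 : ℝ) = 1 := by
    refine Complex.ofReal_injective ?_
    push_cast
    exact h.symm
  nlinarith [norm_nonneg (vacuum S : HTensor ι 𝓗)]

lemma siteForm_vacuum (i : ι) : siteForm S i (vacuum S : HTensor ι 𝓗) (vacuum S) = 0 := by
  have h := root_projMinus (S := S) (Finset.mem_singleton_self i) (vacuum S)
  rw [projMinus_vacuum] at h
  rw [siteForm, h, sub_self]

lemma Form.BoundedBy.norm_vacuum_le {v : Form S A} {C : ℝ} (hv : v.BoundedBy C) :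
    ‖v.eval (vacuum S) (vacuum S)‖ ≤ C := by
  have h := hv _ (vacuum_mem S A) _ (vacuum_mem S A)
  have h1 : formNorm S A (vacuum S) = 1 := by
    rw [← projMinus_vacuum A, formNorm_projMinus, projMinus_vacuum, norm_vacuum]
  rwa [h1, mul_one, mul_one] at h

lemma tensorMap_mem {b : ι → 𝓗 →L[ℂ] 𝓗} (hb : ∀ i ∈ A, b i = 1)
    {x : HTensor ι 𝓗} (hx : x ∈ formDomain S A) : tensorMap b x ∈ formDomain S A :=
  map_mem_formDomain (fun i hi => commute_siteOp_tensorMap (by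
    rw [hb i hi]
    exact Commute.one_right _)) hx

/-- A local form commutes with all product operators outside `A`. -/
lemma Form.IsLocal.eval_tensorMap {v : Form S A} (hv : v.IsLocal) (b : ι → 𝓗 →L[ℂ] 𝓗)
    (s : Finset ι) (hs : Disjoint s A) :
    ∀ x ∈ formDomain S A, ∀ y ∈ formDomain S A,
      v.eval x (tensorMap (fun i => if i ∈ s then b i else 1) y) =
        v.eval (ContinuousLinearMap.adjoint (tensorMap fun i => if i ∈ s then b i else 1) x) y := by
  induction s using Finset.induction_on with
  | empty =>
    intro x _ y _
    have h : tensorMap (fun i => if i ∈ (∅ : Finset ι) then b i else 1) = 1 := by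
      simpa using tensorMap_one (ι := ι) (E := 𝓗)
    rw [h, show ContinuousLinearMap.adjoint (1 : HTensor ι 𝓗 →L[ℂ] HTensor ι 𝓗) = 1 from
      star_one (HTensor ι 𝓗 →L[ℂ] HTensor ι 𝓗)]
    rfl
  | insert j s hj ih =>
    intro x hx y hy
    rw [Finset.disjoint_insert_left] at hs
    have h : tensorMap (fun i => if i ∈ insert j s then b i else 1) =
        siteOp j (b j) * tensorMap (fun i => if i ∈ s then b i else 1) := by
      unfold siteOp
      rw [tensorMap_mul]
      congr 1
      ext1 i
      rcases eq_or_ne i j with rfl | hij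
      · simp [hj]
      · simp [hij]
    have hmem : tensorMap (fun i => if i ∈ s then b i else 1) y ∈ formDomain S A :=
      tensorMap_mem (fun i hi => by
        rw [if_neg fun his => Finset.disjoint_left.1 hs.2 his hi]) hy
    have hadj : ∀ X Y : HTensor ι 𝓗 →L[ℂ] HTensor ι 𝓗, ContinuousLinearMap.adjoint (X * Y) =
      ContinuousLinearMap.adjoint Y * ContinuousLinearMap.adjoint X := star_mul
    rw [h, hadj, mul_apply_eq_comp, mul_apply_eq_comp, hv j hs.1 _ x hx _ hmem,
      ih hs.2 _ (Form.adjoint_siteOp_mem hs.1 _ hx) y hy]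

/-- A product vector projected by P⁻_A is, up to a scalar, obtained from the vacuum by product
operators outside A. Moving these through v leaves only its vacuum expectation. -/
lemma Form.IsLocal.eval_projMinus_htprod {v : Form S A} (hv : v.IsLocal) (x y : ι → 𝓗) :
    v.eval (projMinus S A (htprod x)) (projMinus S A (htprod y)) =
      v.eval (vacuum S) (vacuum S) *
        inner ℂ (projMinus S A (htprod x)) (projMinus S A (htprod y)) := by
  -- The rank-one operator z ↦ ⟨Ω, z⟩ x_i turns Ω into x_i outside A.
  let bx : (ι → 𝓗) → ι → 𝓗 →L[ℂ] 𝓗 := fun x i => if i ∈ Finset.univ \ A then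
    InnerProductSpace.rankOne ℂ (x i) S.Ω else 1
  have hP : ∀ x : ι → 𝓗, projMinus S A (htprod x) =
      (∏ i, if i ∈ A then inner ℂ S.Ω (x i) else 1) • tensorMap (bx x) (vacuum S) := by
    intro x
    unfold vacuum projMinus
    rw [tensorMap_htprod, tensorMap_htprod, ← htprod_smul]
    congr 1
    ext1 i
    by_cases hi : i ∈ A
    · simp [hi, bx, S.projΩ_apply]
    · simp [hi, bx, S.norm_Ω]
  have hmem : ∀ x : ι → 𝓗, tensorMap (bx x) (vacuum S) ∈ formDomain S A := fun x =>
    tensorMap_mem (fun i hi => by simp [bx, hi]) (vacuum_mem S A)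
  have hadj : ∀ x : ι → 𝓗, tensorMap (bx x) = ContinuousLinearMap.adjoint
      (tensorMap fun i => if i ∈ Finset.univ \ A then
        InnerProductSpace.rankOne ℂ S.Ω (x i) else 1) := by
    intro x
    rw [adjoint_tensorMap]
    congr 1
    ext1 i
    by_cases hi : i ∈ A
    · simp only [hi, bx, Finset.mem_sdiff, not_true_eq_false, and_false, if_false]
      exact (star_one (𝓗 →L[ℂ] 𝓗)).symm
    · simp [hi, bx]
  have hvac : tensorMap (fun i => if i ∈ Finset.univ \ A then
      InnerProductSpace.rankOne ℂ S.Ω (x i) else 1) (tensorMap (bx y) (vacuum S)) =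
      (∏ i, if i ∈ A then 1 else inner ℂ (x i) (y i)) • vacuum S := by
    unfold vacuum
    rw [tensorMap_htprod, tensorMap_htprod, ← htprod_smul]
    congr 1
    ext1 i
    by_cases hi : i ∈ A
    · simp [hi, bx]
    · simp [hi, bx, S.norm_Ω]
  have hev : v.eval (tensorMap (bx x) (vacuum S)) (tensorMap (bx y) (vacuum S)) =
      (∏ i, if i ∈ A then 1 else inner ℂ (x i) (y i)) * v.eval (vacuum S) (vacuum S) := by
    rw [hadj x, ← hv.eval_tensorMap _ _ Finset.sdiff_disjoint _ (vacuum_mem S A) _ (hmem y),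
      hvac, v.eval_smul_right _ (vacuum_mem S A) (vacuum_mem S A)]
  have hin : inner ℂ (tensorMap (bx x) (vacuum S)) (tensorMap (bx y) (vacuum S)) =
      (∏ i, if i ∈ A then 1 else inner ℂ (x i) (y i)) := by
    rw [hadj x, ContinuousLinearMap.adjoint_inner_left, hvac, inner_smul_right,
      inner_self_eq_norm_sq_to_K, norm_vacuum]
    simp
  rw [hP x, hP y, v.eval_smul_left _ (hmem x) (Submodule.smul_mem _ _ (hmem y)),
    v.eval_smul_right _ (hmem x) (hmem y), inner_smul_left, inner_smul_right, hev, hin]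
  ring

/-- `P⁻_A v P⁻_A = ⟪Ω, v Ω⟫ P⁻_A` for a bounded local form `v`. -/
lemma Form.IsLocal.eval_projMinus {v : Form S A} (hv : v.IsLocal) {C : ℝ} (hC : 0 ≤ C)
    (hb : v.BoundedBy C) (x y : HTensor ι 𝓗) :
    v.eval (projMinus S A x) (projMinus S A y) =
      v.eval (vacuum S) (vacuum S) * inner ℂ (projMinus S A x) (projMinus S A y) := by
  have hbd : ∀ x y : HTensor ι 𝓗,
      ‖v.eval (projMinus S A x) (projMinus S A y)‖ ≤ C * ‖x‖ * ‖y‖ := by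
    intro x y
    have h := hb _ (projMinus_mem A x) _ (projMinus_mem A y)
    rw [formNorm_projMinus, formNorm_projMinus] at h
    refine h.trans ?_
    gcongr
    · exact norm_projMinus_le x
    · exact norm_projMinus_le y
  -- Both sides are bounded, so the identity extends from elementary tensors by density, first in y
  -- and then in x. The conjugation in R makes it linear in x.
  let L : HTensor ι 𝓗 → HTensor ι 𝓗 →L[ℂ] ℂ := fun x =>
    LinearMap.mkContinuous
      { toFun := fun y => v.eval (projMinus S A x) (projMinus S A y)
        map_add' := fun y z => by
          rw [map_add, v.eval_add_right (projMinus_mem A x) (projMinus_mem A y)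
            (projMinus_mem A z)]
        map_smul' := fun c y => by
          rw [map_smul, v.eval_smul_right c (projMinus_mem A x) (projMinus_mem A y)]
          rfl } (C * ‖x‖) (hbd x)
  let R : HTensor ι 𝓗 → HTensor ι 𝓗 →L[ℂ] ℂ := fun y =>
    LinearMap.mkContinuous
      { toFun := fun x => starRingEnd ℂ (v.eval (projMinus S A x) (projMinus S A y))
        map_add' := fun x z => by
          rw [map_add, v.eval_add_left (projMinus_mem A x) (projMinus_mem A z)
            (projMinus_mem A y), map_add]
        map_smul' := fun c x => by
          rw [map_smul, v.eval_smul_left c (projMinus_mem A x) (projMinus_mem A y), map_mul,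
            Complex.conj_conj]
          rfl } (C * ‖y‖) (fun x => by
            rw [mul_right_comm]
            simpa using hbd x y)
  have h1 : ∀ x : ι → 𝓗, L (htprod x) = v.eval (vacuum S) (vacuum S) •
      (innerSL ℂ (projMinus S A (htprod x))).comp (projMinus S A) := fun x =>
    htensor_clm_ext fun y => hv.eval_projMinus_htprod x y
  have h2 : ∀ y : HTensor ι 𝓗, R y = starRingEnd ℂ (v.eval (vacuum S) (vacuum S)) •
      (innerSL ℂ (projMinus S A y)).comp (projMinus S A) := fun y =>
    htensor_clm_ext fun x => by
      have := congrArg (fun f : HTensor ι 𝓗 →L[ℂ] ℂ => starRingEnd ℂ (f y)) (h1 x)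
      refine this.trans ?_
      simp
  have h3 := congrArg (fun f : HTensor ι 𝓗 →L[ℂ] ℂ => starRingEnd ℂ (f x)) (h2 y)
  simp only [smul_apply, ContinuousLinearMap.comp_apply, innerSL_apply_apply, smul_eq_mul,
    map_mul, Complex.conj_conj, inner_conj_symm] at h3
  refine Eq.trans ?_ h3
  exact (Complex.conj_conj _).symm

lemma norm_projPlus_le_sqrt {x : HTensor ι 𝓗} (hx : x ∈ formDomain S A) :
    ‖projPlus S A x‖ ≤ Real.sqrt (energyOn S A x) :=
  Real.le_sqrt_of_sq_le ((norm_sq_projPlus_le hx).trans (energyOn_projPlus_le hx))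

lemma formNorm_projPlus_le {x : HTensor ι 𝓗} (hx : x ∈ formDomain S A) :
    formNorm S A (projPlus S A x) ≤ Real.sqrt 2 * Real.sqrt (energyOn S A x) := by
  rw [← Real.sqrt_mul (by norm_num)]
  refine Real.sqrt_le_sqrt ?_
  have h1 := norm_sq_projPlus_le hx
  have h2 := energyOn_projPlus_le (A := A) hx
  linarith

/-- A bounded, local and block-diagonal form is, up to its vacuum expectation value, form bounded
by `H⁰_A`. -/
lemma Form.norm_eval_sub_vacuum_le {v : Form S A} (hv : v.IsLocal) (hd : v.IsBlockDiag) {C : ℝ}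
    (hC : 0 ≤ C) (hb : v.BoundedBy C) {x y : HTensor ι 𝓗} (hx : x ∈ formDomain S A)
    (hy : y ∈ formDomain S A) :
    ‖v.eval x y - v.eval (vacuum S) (vacuum S) * inner ℂ x y‖ ≤
      3 * C * (Real.sqrt (energyOn S A x) * Real.sqrt (energyOn S A y)) := by
  set c := v.eval (vacuum S) (vacuum S) with hc
  have hpx := projPlus_mem A hx
  have hpy := projPlus_mem A hy
  have hmx := projMinus_mem (S := S) A x
  have hmy := projMinus_mem (S := S) A y
  have e1 : v.eval x y = v.eval (projPlus S A x) (projPlus S A y) +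
      c * inner ℂ (projMinus S A x) (projMinus S A y) := by
    conv_lhs => rw [← projMinus_add_projPlus (S := S) A x, ← projMinus_add_projPlus (S := S) A y]
    rw [v.eval_add_left hmx hpx (add_mem hmy hpy), v.eval_add_right hmx hmy hpy,
      v.eval_add_right hpx hmy hpy, (hd x hx y hy).1, (hd x hx y hy).2,
      hv.eval_projMinus hC hb]
    ring
  have e2 : inner ℂ x y = inner ℂ (projPlus S A x) (projPlus S A y) +
      inner ℂ (projMinus S A x) (projMinus S A y) := by
    conv_lhs => rw [← projMinus_add_projPlus (S := S) A x, ← projMinus_add_projPlus (S := S) A y]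
    rw [inner_add_left, inner_add_right, inner_add_right]
    have h1 : inner ℂ (projMinus S A x) (projPlus S A y) = 0 := by
      rw [← adjoint_projMinus, ContinuousLinearMap.adjoint_inner_left, projMinus_projPlus,
        inner_zero_right]
    have h2 : inner ℂ (projPlus S A x) (projMinus S A y) = 0 := by
      rw [← adjoint_projPlus, ContinuousLinearMap.adjoint_inner_left, projPlus_projMinus,
        inner_zero_right]
    rw [h1, h2]
    ring
  -- The off-diagonal blocks vanish and the P⁻ block of v is exactly cancelled by the shift, so only
  -- the P⁺ block remains.
  have e3 : v.eval x y - c * inner ℂ x y = v.eval (projPlus S A x) (projPlus S A y) -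
      c * inner ℂ (projPlus S A x) (projPlus S A y) := by
    rw [e1, e2]
    ring
  rw [e3]
  refine (norm_sub_le _ _).trans ?_
  have b1 := hb _ hpx _ hpy
  have b2 : ‖c * inner ℂ (projPlus S A x) (projPlus S A y)‖ ≤
      C * (Real.sqrt (energyOn S A x) * Real.sqrt (energyOn S A y)) := by
    rw [norm_mul]
    refine mul_le_mul hb.norm_vacuum_le ?_ (norm_nonneg _) hC
    exact (norm_inner_le_norm _ _).trans
      (mul_le_mul (norm_projPlus_le_sqrt hx) (norm_projPlus_le_sqrt hy) (norm_nonneg _)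
        (Real.sqrt_nonneg _))
  -- On ran P⁺_A one has H⁰_A + 1 ≤ 2 H⁰_A, which accounts for 2 of the constant 3; the scalar c,
  -- with |c| ≤ C, accounts for the remaining 1.
  have b3 : C * formNorm S A (projPlus S A x) * formNorm S A (projPlus S A y) ≤
      2 * C * (Real.sqrt (energyOn S A x) * Real.sqrt (energyOn S A y)) := by
    calc _ ≤ C * (Real.sqrt 2 * Real.sqrt (energyOn S A x)) *
          (Real.sqrt 2 * Real.sqrt (energyOn S A y)) := by
          gcongr
          · exact formNorm_nonneg _
          · exact formNorm_projPlus_le hx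
          · exact formNorm_projPlus_le hy
      _ = (Real.sqrt 2 * Real.sqrt 2) * C *
          (Real.sqrt (energyOn S A x) * Real.sqrt (energyOn S A y)) := by ring
      _ = _ := by rw [Real.mul_self_sqrt (by norm_num)]
  linarith

lemma sector_mem (B : Finset ι) {x : HTensor ι 𝓗} (h : x ∈ formDomain S A) :
    sector S B x ∈ formDomain S A := by
  rw [sector_eq_diagOp]
  exact diagOp_mem _ h

/-- A local form does not couple sectors that differ outside `A`. -/
lemma Form.IsLocal.eval_sector {v : Form S A} (hv : v.IsLocal) {B B' : Finset ι}
    (h : B \ A ≠ B' \ A) {x y : HTensor ι 𝓗} (hx : x ∈ formDomain S A)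
    (hy : y ∈ formDomain S A) : v.eval (sector S B x) (sector S B' y) = 0 := by
  obtain ⟨j, hj⟩ : ∃ j, ¬(j ∈ B \ A ↔ j ∈ B' \ A) := by
    by_contra! hc
    exact h (Finset.ext hc)
  have hjA : j ∉ A := fun hA => hj (by simp [hA])
  have hP : ∀ (D : Finset ι) (z : HTensor ι 𝓗), siteOp j S.projΩ (sector S D z) =
      if j ∈ D then 0 else sector S D z := by
    intro D z
    have := congrArg (fun T : HTensor ι 𝓗 →L[ℂ] HTensor ι 𝓗 => T z)
      (siteOp_projΩ_mul_sector S j D)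
    refine Eq.trans this ?_
    split_ifs <;> rfl
  -- P_Ω at j preserves one of the two sectors and annihilates the other; moving it across v makes
  -- the matrix element vanish.
  have hl := hv j hjA S.projΩ _ (sector_mem B hx) _ (sector_mem B' hy)
  rw [adjoint_siteOp, S.adjoint_projΩ, hP, hP] at hl
  by_cases hB : j ∈ B
  · have hB' : j ∉ B' := fun hB' => hj (by simp [hB, hB'])
    rw [if_neg hB', if_pos hB, v.eval_zero_left (sector_mem B' hy)] at hl
    exact hl
  · have hB' : j ∈ B' := by
      by_contra hB'
      exact hj (by simp [hB, hB'])
    rw [if_pos hB', if_neg hB, v.eval_zero_right (sector_mem B hx)] at hl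
    exact hl.symm

lemma diagOp_apply (F : Finset ι → ℝ) (x : HTensor ι 𝓗) :
    diagOp S F x = ∑ B : Finset ι, (F B : ℂ) • sector S B x := by
  unfold diagOp
  rw [sum_apply]
  rfl

lemma sum_sector_apply (x : HTensor ι 𝓗) : ∑ B : Finset ι, sector S B x = x := by
  rw [← sum_apply, sum_sector]
  rfl

/-- A local form commutes with the functions of the excitations outside `A`. -/
lemma Form.IsLocal.eval_diagOp {v : Form S A} (hv : v.IsLocal) {p : Finset ι → ℝ}
    (hp : ∀ B B', B \ A = B' \ A → p B = p B') {x y : HTensor ι 𝓗} (hx : x ∈ formDomain S A)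
    (hy : y ∈ formDomain S A) : v.eval x (diagOp S p y) = v.eval (diagOp S p x) y := by
  have hs : ∀ (c : ℂ) (B : Finset ι) {z : HTensor ι 𝓗}, z ∈ formDomain S A →
      c • sector S B z ∈ formDomain S A := fun c B z hz =>
    Submodule.smul_mem _ _ (sector_mem B hz)
  have e1 : v.eval x (diagOp S p y) =
      ∑ B' : Finset ι, ∑ B : Finset ι, (p B' : ℂ) * v.eval (sector S B x) (sector S B' y) := by
    rw [diagOp_apply, v.eval_sum_right _ hx fun B => hs _ B hy]
    refine Finset.sum_congr rfl fun B' _ => ?_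
    rw [v.eval_smul_right _ hx (sector_mem B' hy), ← Finset.mul_sum,
      ← v.eval_sum_left _ (fun B => sector_mem B hx) (sector_mem B' hy), sum_sector_apply]
  have e2 : v.eval (diagOp S p x) y =
      ∑ B : Finset ι, ∑ B' : Finset ι, (p B : ℂ) * v.eval (sector S B x) (sector S B' y) := by
    rw [diagOp_apply, v.eval_sum_left _ (fun B => hs _ B hx) hy]
    refine Finset.sum_congr rfl fun B _ => ?_
    rw [v.eval_smul_left _ (sector_mem B hx) hy, ← Finset.mul_sum, Complex.conj_ofReal,
      ← v.eval_sum_right _ (sector_mem B hx) fun B' => sector_mem B' hy, sum_sector_apply]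
  rw [e1, e2, Finset.sum_comm]
  refine Finset.sum_congr rfl fun B _ => Finset.sum_congr rfl fun B' _ => ?_
  by_cases h : B \ A = B' \ A
  · rw [hp B B' h]
  · rw [hv.eval_sector h hx hy, mul_zero, mul_zero]

variable (S) in
/-- `(π_K + 1) ^ (1/2)`. -/
def numberRoot (K : Finset ι) : HTensor ι 𝓗 →L[ℂ] HTensor ι 𝓗 :=
  diagOp S fun B => Real.sqrt (((B ∩ K).card : ℝ) + 1)

lemma numberWeight_eq (K : Finset ι) :
    numberWeight S K = diagOp S fun B => (Real.sqrt (((B ∩ K).card : ℝ) + 1))⁻¹ := by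
  rw [numberWeight_eq_diagOp]
  congr 1
  ext B
  rw [Real.rpow_neg (by positivity), ← Real.sqrt_eq_rpow]

/-- The weighted version of `Form.norm_eval_sub_vacuum_le`: conjugation with `(π_K + 1) ^ (1/2)` costs
a factor that depends only on the number of sites of `A`. -/
lemma Form.norm_eval_sub_vacuum_weighted_le {v : Form S A} (hv : v.IsLocal)
    (hd : v.IsBlockDiag) {C : ℝ} (hC : 0 ≤ C) (hb : v.BoundedBy C) (K : Finset ι)
    {x : HTensor ι 𝓗} (hx : x ∈ formDomain S A) :
    ‖v.eval (numberWeight S K x) (numberRoot S K x) -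
      v.eval (vacuum S) (vacuum S) * inner ℂ (numberWeight S K x) (numberRoot S K x)‖ ≤
      3 * C * ((A.card + 1) * energyOn S A x) := by
  -- n is π_K + 1, and q is its analogue counting only the excitations outside A. Since √q commutes
  -- with v, the pair 1/√n, √n may be replaced by √(q/n), √(n/q), and q ≤ n ≤ (|A| + 1) q keeps both
  -- ratios under control.
  let n : Finset ι → ℝ := fun B => ((B ∩ K).card : ℝ) + 1
  let q : Finset ι → ℝ := fun B => (((B \ A) ∩ K).card : ℝ) + 1
  have hn : ∀ B, 1 ≤ n B := fun B => by simp [n]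
  have hq : ∀ B, 1 ≤ q B := fun B => by simp [q]
  have hqn : ∀ B, q B ≤ n B := fun B => by
    simp only [q, n]
    gcongr
    exact Finset.sdiff_subset
  have hnq : ∀ B, n B ≤ (A.card + 1) * q B := fun B => by
    have h1 : (B ∩ K).card ≤ ((B \ A) ∩ K).card + A.card := by
      refine (Finset.card_le_card ?_).trans (Finset.card_union_le _ _)
      intro i hi
      simp only [Finset.mem_inter, Finset.mem_union, Finset.mem_sdiff] at *
      tauto
    have h2 : ((B ∩ K).card : ℝ) ≤ ((B \ A) ∩ K).card + A.card := by exact_mod_cast h1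
    simp only [n, q]
    nlinarith [Nat.cast_nonneg (α := ℝ) A.card, Nat.cast_nonneg (α := ℝ) ((B \ A) ∩ K).card]
  let p : Finset ι → ℝ := fun B => Real.sqrt (q B)
  let F : Finset ι → ℝ := fun B => Real.sqrt (q B) * (Real.sqrt (n B))⁻¹
  let G : Finset ι → ℝ := fun B => Real.sqrt (n B) * (Real.sqrt (q B))⁻¹
  have hp : ∀ B B', B \ A = B' \ A → p B = p B' := fun B B' h => by simp only [p, q, h]
  have e1 : numberRoot S K x = diagOp S p (diagOp S G x) := by
    rw [← mul_apply_eq_comp, diagOp_mul]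
    unfold numberRoot
    congr 2
    ext B
    simp only [Pi.mul_apply, p, G, n]
    have : Real.sqrt (q B) ≠ 0 := (Real.sqrt_pos.2 (by linarith [hq B])).ne'
    field_simp
  have e2 : diagOp S p (numberWeight S K x) = diagOp S F x := by
    rw [numberWeight_eq, ← mul_apply_eq_comp, diagOp_mul]
    rfl
  have hw : numberWeight S K x ∈ formDomain S A := by
    rw [numberWeight_eq]
    exact diagOp_mem _ hx
  have e3 : inner ℂ (numberWeight S K x) (diagOp S p (diagOp S G x)) =
      inner ℂ (diagOp S p (numberWeight S K x)) (diagOp S G x) := by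
    rw [← ContinuousLinearMap.adjoint_inner_left, adjoint_diagOp]
  rw [e1, e3, hv.eval_diagOp hp hw (diagOp_mem G hx), e2]
  refine (Form.norm_eval_sub_vacuum_le hv hd hC hb (diagOp_mem F hx) (diagOp_mem G hx)).trans ?_
  have hF : energyOn S A (diagOp S F x) ≤ 1 * energyOn S A x := by
    refine energyOn_diagOp_le hx fun B => ?_
    have h0 : 0 < n B := by linarith [hn B]
    simp only [F]
    rw [mul_pow, inv_pow, Real.sq_sqrt h0.le, Real.sq_sqrt (by linarith [hq B]),
      ← div_eq_mul_inv, div_le_one h0]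
    exact hqn B
  have hG : energyOn S A (diagOp S G x) ≤ (A.card + 1) * energyOn S A x := by
    refine energyOn_diagOp_le hx fun B => ?_
    have h0 : 0 < q B := by linarith [hq B]
    simp only [G]
    rw [mul_pow, inv_pow, Real.sq_sqrt h0.le, Real.sq_sqrt (by linarith [hn B]),
      ← div_eq_mul_inv, div_le_iff₀ h0]
    exact hnq B
  have he := energyOn_nonneg hx
  have hle : energyOn S A x ≤ (A.card + 1) * energyOn S A x := by
    nlinarith [Nat.cast_nonneg (α := ℝ) A.card]
  rw [one_mul] at hF
  refine mul_le_mul_of_nonneg_left ?_ (by positivity)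
  rw [← Real.mul_self_sqrt (show 0 ≤ (A.card + 1) * energyOn S A x by positivity)]
  exact mul_le_mul (Real.sqrt_le_sqrt (hF.trans hle)) (Real.sqrt_le_sqrt hG)
    (Real.sqrt_nonneg _) (Real.sqrt_nonneg _)

end BoundedForms

/-! ### The order on rectangles and the summation over rectangles through a site. -/

section RectangleLemmas

namespace Rect

variable {d N : ℕ}

/-- The order on rectangles as a lexicographic order. -/
def key (J : Rect d N) : ℕ ×ₗ (Lex (Fin d → ℕᵒᵈ) ×ₗ Lex ((Fin d)ᵒᵈ → ℕ)) :=
  toLex (J.size, toLex (toLex fun j => OrderDual.toDual (J.k j),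
    toLex fun j => J.q (OrderDual.ofDual j)))

lemma key_injective : Function.Injective (key : Rect d N → _) := by
  intro J L h
  simp only [key, EmbeddingLike.apply_eq_iff_eq, Prod.mk.injEq] at h
  exact Rect.ext h.2.1 h.2.2

/-- The dual order on side lengths puts larger ones first, and the dual index set makes the last
differing corner coordinate decide. Trichotomy and transitivity are then inherited from the
lexicographic order. -/
lemma lt_iff_key (J L : Rect d N) : J < L ↔ J.key < L.key := by
  have hk : (toLex fun j => OrderDual.toDual (J.k j) : Lex (Fin d → ℕᵒᵈ)) <
      toLex (fun j => OrderDual.toDual (L.k j)) ↔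
      ∃ j, (∀ l < j, L.k l = J.k l) ∧ L.k j < J.k j := by
    constructor
    · rintro ⟨j, h1, h2⟩
      exact ⟨j, fun l hl => (h1 l hl).symm, h2⟩
    · rintro ⟨j, h1, h2⟩
      exact ⟨j, fun l hl => (h1 l hl).symm, h2⟩
  have hq : (toLex fun j : (Fin d)ᵒᵈ => J.q (OrderDual.ofDual j)) <
      toLex (fun j : (Fin d)ᵒᵈ => L.q (OrderDual.ofDual j)) ↔
      ∃ j, (∀ l, j < l → L.q l = J.q l) ∧ J.q j < L.q j := by
    constructor
    · rintro ⟨j, h1, h2⟩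
      exact ⟨OrderDual.ofDual j, fun l hl => (h1 (OrderDual.toDual l) hl).symm, h2⟩
    · rintro ⟨j, h1, h2⟩
      exact ⟨OrderDual.toDual j, fun l hl => (h1 (OrderDual.ofDual l) hl).symm, h2⟩
  have he : (toLex fun j => OrderDual.toDual (J.k j) : Lex (Fin d → ℕᵒᵈ)) =
      toLex (fun j => OrderDual.toDual (L.k j)) ↔ ∀ l, L.k l = J.k l := by
    constructor
    · intro h l
      exact (congrFun (congrArg ofLex h) l).symm
    · intro h
      exact congrArg toLex (funext fun l => congrArg OrderDual.toDual (h l).symm)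
  unfold key
  rw [Prod.Lex.toLex_lt_toLex, Prod.Lex.toLex_lt_toLex, hk, hq, he]
  change (J.size < L.size ∨ _ ∨ _) ↔ _
  constructor
  · rintro (h | ⟨h, h'⟩ | ⟨h, h'⟩)
    · exact Or.inl h
    · exact Or.inr ⟨h, Or.inl h'⟩
    -- The third clause of the order does not mention sizes; their equality follows from that of the
    -- side lengths.
    · refine Or.inr ⟨?_, Or.inr ⟨h, h'⟩⟩
      change ∑ l, J.k l = ∑ l, L.k l
      exact Finset.sum_congr rfl fun l _ => (h l).symm
  · rintro (h | ⟨h, h' | h'⟩)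
    · exact Or.inl h
    · exact Or.inr (Or.inl ⟨h, h'⟩)
    · exact Or.inr (Or.inr h')

lemma lt_trichotomy' (J L : Rect d N) : J < L ∨ J = L ∨ L < J := by
  rw [lt_iff_key, lt_iff_key, ← key_injective.eq_iff]
  exact lt_trichotomy _ _

lemma index_lt {J L : Rect d N} (h : J < L) : J.index < L.index := by
  unfold index
  refine Set.ncard_lt_ncard (s := {M : Rect d N | M < J}) (t := {M | M < L}) ?_ (Set.toFinite _)
  refine ⟨fun M hM => ?_, fun hc => ?_⟩
  · simp only [Set.mem_ofPred_eq, lt_iff_key] at *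
    exact hM.trans h
  · have : J < J := hc h
    rw [lt_iff_key] at this
    exact lt_irrefl _ this

lemma index_injective : Function.Injective (index : Rect d N → ℕ) := by
  intro J L h
  rcases lt_trichotomy' J L with h' | h' | h'
  · exact absurd h (index_lt h').ne
  · exact h'
  · exact absurd h (index_lt h').ne'

lemma mem_sites {J : Rect d N} {i : Site d N} :
    i ∈ J.sites ↔ ∀ j, J.q j ≤ (i j : ℕ) ∧ (i j : ℕ) ≤ J.q j + J.k j := by
  simp [sites]

/-- It suffices to test the inclusion on the two opposite corners of J. -/
lemma le_of_sites_subset {J K : Rect d N} (h : J.sites ⊆ K.sites) (j : Fin d) :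
    K.q j ≤ J.q j ∧ J.q j + J.k j ≤ K.q j + K.k j := by
  have h1 := mem_sites.1 (h (x := fun j => ⟨J.q j, Finset.mem_Icc.2
    ⟨J.one_le j, by have := J.le_N j; omega⟩⟩) (mem_sites.2 fun j => by simp)) j
  have h2 := mem_sites.1 (h (x := fun j => ⟨J.q j + J.k j, Finset.mem_Icc.2
    ⟨by have := J.one_le j; omega, J.le_N j⟩⟩) (mem_sites.2 fun j => by simp)) j
  exact ⟨h1.1, h2.2⟩

/-- Equal sizes would force equal side lengths and hence equal rectangles. Consequently strict
subrectangles come earlier in the order. -/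
lemma size_lt_of_ssubset {J K : Rect d N} (h : J.sites ⊂ K.sites) : J.size < K.size := by
  have hle := le_of_sites_subset h.1
  have hk : ∀ j, J.k j ≤ K.k j := fun j => by have := hle j; omega
  refine lt_of_le_of_ne (Finset.sum_le_sum fun j _ => hk j) fun he => h.2 ?_
  have he' := (Finset.sum_eq_sum_iff_of_le fun j _ => hk j).1 he
  intro i hi
  rw [mem_sites] at *
  intro j
  have h1 := hle j
  have h2 := he' j (Finset.mem_univ j)
  have h3 := hi j
  omega

lemma lt_of_size_lt {J K : Rect d N} (h : J.size < K.size) : J < K := Or.inl h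

lemma card_sites_le (J : Rect d N) : J.sites.card ≤ (J.size + 1) ^ d := by
  have h1 : J.sites ⊆ Fintype.piFinset fun j => ({i | J.q j ≤ (i : ℕ) ∧ (i : ℕ) ≤ J.q j + J.k j} :
      Finset (Finset.Icc 1 N)) := by
    intro i hi
    rw [mem_sites] at hi
    simpa using hi
  refine (Finset.card_le_card h1).trans ?_
  rw [Fintype.card_piFinset]
  refine (Finset.prod_le_pow_card _ _ (J.size + 1) fun j _ => ?_).trans (by simp)
  have h2 : ({i | J.q j ≤ (i : ℕ) ∧ (i : ℕ) ≤ J.q j + J.k j} : Finset (Finset.Icc 1 N)).card ≤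
      (Finset.Icc (J.q j) (J.q j + J.k j)).card := by
    refine Finset.card_le_card_of_injOn (fun i => (i : ℕ)) (fun i hi => ?_)
      Subtype.val_injective.injOn
    simpa using hi
  rw [Nat.card_Icc] at h2
  have h3 : J.k j ≤ J.size := Finset.single_le_sum (f := J.k) (fun _ _ => Nat.zero_le _)
    (Finset.mem_univ j)
  omega

lemma sum_inv_sq_le (M : ℕ) : ∑ n ∈ Finset.range (M + 1), (1 / ((n : ℝ) + 1) ^ 2) ≤ 2 := by
  -- The term -1/(M + 1) makes the induction telescope.
  have h : ∑ n ∈ Finset.range (M + 1), (1 / ((n : ℝ) + 1) ^ 2) ≤ 2 - 1 / ((M : ℝ) + 1) := by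
    induction M with
    | zero => norm_num
    | succ M ih =>
      rw [Finset.sum_range_succ]
      have : 1 / ((M + 1 : ℕ) + 1 : ℝ) ^ 2 ≤ 1 / ((M : ℝ) + 1) - 1 / ((M + 1 : ℕ) + 1 : ℝ) := by
        push_cast
        rw [div_sub_div _ _ (by positivity) (by positivity), div_le_div_iff₀ (by positivity)
          (by positivity)]
        nlinarith
      linarith
  have : 0 ≤ 1 / ((M : ℝ) + 1) := by positivity
  linarith

open Classical in
-- A rectangle through i is determined by the 2d distances from i to its faces, each at most the
-- size. Distributing the exponent 4d as 2 per distance bounds the sum by a product of 2d sums ∑ (n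
-- + 1)^{-2} ≤ 2, uniformly in N.
lemma sum_inv_size_pow_le (i : Site d N) :
    ∑ J : Rect d N with i ∈ J.sites, 1 / ((J.size : ℝ) + 1) ^ (4 * d) ≤ 4 ^ d := by
  let w : ℕ → ℝ := fun n => 1 / ((n : ℝ) + 1) ^ 2
  let φ : Rect d N → Fin d → ℕ × ℕ := fun J j =>
    ((i j : ℕ) - J.q j, J.q j + J.k j - (i j : ℕ))
  let s : Finset (Rect d N) := {J | i ∈ J.sites}
  have hinj : Set.InjOn φ s := by
    intro J hJ L hL h
    have hJ' := mem_sites.1 (Finset.mem_filter.1 hJ).2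
    have hL' := mem_sites.1 (Finset.mem_filter.1 hL).2
    have hq : ∀ j, J.q j = L.q j ∧ J.k j = L.k j := by
      intro j
      have h1 := congrFun h j
      simp only [φ, Prod.mk.injEq] at h1
      have h2 := hJ' j
      have h3 := hL' j
      omega
    exact Rect.ext (funext fun j => (hq j).2) (funext fun j => (hq j).1)
  have hterm : ∀ J ∈ s, 1 / ((J.size : ℝ) + 1) ^ (4 * d) ≤
      ∏ j, w (φ J j).1 * w (φ J j).2 := by
    intro J hJ
    have hJ' := mem_sites.1 (Finset.mem_filter.1 hJ).2
    have h1 : 1 / ((J.size : ℝ) + 1) ^ (4 * d) =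
        ∏ _j : Fin d, (1 / ((J.size : ℝ) + 1) ^ 2) * (1 / ((J.size : ℝ) + 1) ^ 2) := by
      rw [Finset.prod_const, Finset.card_univ, Fintype.card_fin, pow_mul]
      rw [← one_div_pow]
      congr 1
      field_simp
    rw [h1]
    refine Finset.prod_le_prod (fun _ _ => by positivity) fun j _ => ?_
    have h3 : J.k j ≤ J.size := Finset.single_le_sum (f := J.k) (fun _ _ => Nat.zero_le _)
      (Finset.mem_univ j)
    have h4 := hJ' j
    have ha : (((φ J j).1 : ℕ) : ℝ) ≤ J.size := by
      have : (φ J j).1 ≤ J.size := by simp only [φ]; omega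
      exact_mod_cast this
    have hb : (((φ J j).2 : ℕ) : ℝ) ≤ J.size := by
      have : (φ J j).2 ≤ J.size := by simp only [φ]; omega
      exact_mod_cast this
    simp only [w]
    gcongr
  have hmaps : s.image φ ⊆ Fintype.piFinset fun _ : Fin d =>
      Finset.range (N + 1) ×ˢ Finset.range (N + 1) := by
    intro c hc
    obtain ⟨J, hJ, rfl⟩ := Finset.mem_image.1 hc
    have hJ' := mem_sites.1 (Finset.mem_filter.1 hJ).2
    rw [Fintype.mem_piFinset]
    intro j
    have h1 := hJ' j
    have h2 := J.le_N j
    simp only [φ, Finset.mem_product, Finset.mem_range]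
    omega
  calc ∑ J ∈ s, 1 / ((J.size : ℝ) + 1) ^ (4 * d)
      ≤ ∑ J ∈ s, ∏ j, w (φ J j).1 * w (φ J j).2 := Finset.sum_le_sum hterm
    _ = ∑ c ∈ s.image φ, ∏ j, w (c j).1 * w (c j).2 := 
        (Finset.sum_image (f := fun c : Fin d → ℕ × ℕ => ∏ j, w (c j).1 * w (c j).2) hinj).symm
    _ ≤ ∑ c ∈ Fintype.piFinset fun _ : Fin d => Finset.range (N + 1) ×ˢ Finset.range (N + 1),
          ∏ j, w (c j).1 * w (c j).2 :=
        Finset.sum_le_sum_of_subset_of_nonneg hmaps fun c _ _ =>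
          Finset.prod_nonneg fun j _ => by simp only [w]; positivity
    _ = ∏ _j : Fin d, ∑ c ∈ Finset.range (N + 1) ×ˢ Finset.range (N + 1), w c.1 * w c.2 :=
        (Finset.prod_univ_sum (fun _ : Fin d => Finset.range (N + 1) ×ˢ Finset.range (N + 1))
          fun _ c => w c.1 * w c.2).symm
    _ ≤ 4 ^ d := by
        have hw := sum_inv_sq_le N
        have hw0 : 0 ≤ ∑ n ∈ Finset.range (N + 1), w n :=
          Finset.sum_nonneg fun n _ => by simp only [w]; positivity
        rw [Finset.prod_const, Finset.card_univ, Fintype.card_fin, Finset.sum_product,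
          ← Finset.sum_mul_sum]
        refine pow_le_pow_left₀ (mul_nonneg hw0 hw0) ?_ d
        change ∑ n ∈ Finset.range (N + 1), w n ≤ 2 at hw
        nlinarith

/-- The decay r^{-20d} pays both for the number of sites, at most (r + 1)^d, and for the weight (r +
1)^{4d} used in the summation, since (r + 1)^{5d} ≤ (2r)^{5d} for r ≥ 1. -/
lemma card_sites_div_le (J : Rect d N) (hJ : 1 ≤ J.size) :
    ((J.sites.card : ℝ) + 1) / (J.size : ℝ) ^ (20 * d) ≤
      2 * 2 ^ (5 * d) * (1 / ((J.size : ℝ) + 1) ^ (4 * d)) := by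
  have hr : (1 : ℝ) ≤ J.size := by exact_mod_cast hJ
  set r : ℝ := (J.size : ℝ) with hrdef
  have h1 : (J.sites.card : ℝ) + 1 ≤ 2 * (r + 1) ^ d := by
    have h2 : (J.sites.card : ℝ) ≤ (r + 1) ^ d := by
      rw [hrdef]
      exact_mod_cast card_sites_le J
    have h3 : 1 ≤ (r + 1) ^ d := one_le_pow₀ (by linarith)
    linarith
  rw [div_le_iff₀ (by positivity), mul_one_div, div_mul_eq_mul_div, le_div_iff₀ (by positivity)]
  have h4 : (r + 1) ^ d * (r + 1) ^ (4 * d) ≤ 2 ^ (5 * d) * r ^ (20 * d) := by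
    rw [← pow_add, show d + 4 * d = 5 * d by ring]
    calc (r + 1) ^ (5 * d) ≤ (2 * r) ^ (5 * d) := by gcongr; linarith
      _ = 2 ^ (5 * d) * r ^ (5 * d) := mul_pow _ _ _
      _ ≤ 2 ^ (5 * d) * r ^ (20 * d) := by
        gcongr
        norm_num
  calc ((J.sites.card : ℝ) + 1) * (r + 1) ^ (4 * d)
      ≤ (2 * (r + 1) ^ d) * (r + 1) ^ (4 * d) := by gcongr
    _ = 2 * ((r + 1) ^ d * (r + 1) ^ (4 * d)) := by ring
    _ ≤ 2 * (2 ^ (5 * d) * r ^ (20 * d)) := by gcongr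
    _ = _ := by ring

end Rect

end RectangleLemmas

/-! ### Locality and block-diagonality along the recursion. -/

section AlgorithmLemmas

variable {d N : ℕ}
variable {𝓗 : Type*} [NormedAddCommGroup 𝓗] [InnerProductSpace ℂ 𝓗] [CompleteSpace 𝓗]
variable {S : SiteData 𝓗}

lemma isLocal_formG (t : ℝ) {W : Potentials S d N} (hW : ∀ J, (W J).IsLocal) (K : Rect d N) :
    (formG t W K).IsLocal :=
  (Form.isLocal_formH0 S K.sites).add
    ((Form.isLocal_sum fun J _ => (hW J).extend K.sites).smul _)

lemma isLocalOp_stepGenerator (t : ℝ) {W : Potentials S d N} (hW : ∀ J, (W J).IsLocal)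
    (s : Rect d N) : IsLocalOp s.sites (stepGenerator t W s) :=
  isLocalOp_generator (isLocal_formG t hW s) (hW s) _ t

lemma isLocal_step (t : ℝ) (s : Rect d N) {W : Potentials S d N} (hW : ∀ J, (W J).IsLocal)
    (J : Rect d N) : (step t s W J).IsLocal := by
  unfold step
  split_ifs with h1 h2
  · exact isLocal_diagonalized (isLocal_formG t hW J) (hW J) _ t
  · exact (hW J).add (Form.isLocal_sum fun L _ =>
      Form.isLocal_adExp ((hW L).extend J.sites) ((isLocalOp_stepGenerator t hW s).mono h2.1))
  · exact hW J

lemma isLocal_initial {V : Potentials S d N} (hV : IsInteraction V) (J : Rect d N) :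
    (initial V J).IsLocal := by
  unfold initial
  split_ifs with h1 h2
  · exact Form.isLocal_formH0 S J.sites
  · exact hV.isLocal J h2
  · exact Form.isLocal_zero

lemma isLocal_effectiveAux (t : ℝ) {V : Potentials S d N} (hV : IsInteraction V) (n : ℕ) :
    ∀ J : Rect d N, (effectiveAux t V n J).IsLocal := by
  induction n with
  | zero => exact isLocal_initial hV
  | succ n ih =>
    intro J
    rw [effectiveAux]
    split_ifs with h
    · exact isLocal_step t _ ih J
    · exact ih J

/-- A single site at the corner of J precedes it, so step number 0 treats no rectangle of positive
size. -/
lemma Rect.index_pos {J : Rect d N} (hJ : 1 ≤ J.size) : 0 < J.index := by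
  let L : Rect d N := ⟨fun _ => 0, J.q, J.one_le, fun j => by have := J.le_N j; omega⟩
  have hL : L.size = 0 := by simp [L, Rect.size]
  exact (Nat.zero_le _).trans_lt (Rect.index_lt (Rect.lt_of_size_lt (J := L) (by omega)))

/-- Once its rectangle has been treated, a potential is block diagonal and does not change. -/
lemma isBlockDiag_effectiveAux (t : ℝ) (V : Potentials S d N) (n : ℕ) :
    ∀ J : Rect d N, 1 ≤ J.size → J.index ≤ n → (effectiveAux t V n J).IsBlockDiag := by
  induction n with
  | zero =>
    intro J hJ hn
    have := Rect.index_pos hJ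
    omega
  | succ n ih =>
    intro J hJ hn
    rw [effectiveAux]
    split_ifs with h
    · have hs := h.choose_spec.1
      set s := h.choose
      by_cases hJs : J = s
      · subst hJs
        rw [step, if_pos rfl]
        exact isBlockDiag_diagonalized t _ _ _
      · have hlt : J.index ≤ n := by
          rcases Nat.lt_or_ge J.index (n + 1) with h' | h'
          · omega
          · exact absurd (Rect.index_injective (by omega : J.index = s.index)) hJs
        -- A step at s changes only s and rectangles strictly containing s, all of which come after
        -- s; the earlier J is left alone.
        have hns : ¬ s.sites ⊂ J.sites := fun hc => by
          have := Rect.index_lt (Rect.lt_of_size_lt (Rect.size_lt_of_ssubset hc))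
          omega
        rw [step, if_neg hJs, if_neg hns]
        exact ih J hJ hlt
    · refine ih J hJ ?_
      rcases Nat.lt_or_ge J.index (n + 1) with h' | h'
      · omega
      · exact absurd ⟨J, by omega, hJ⟩ h

end AlgorithmLemmas

/-! ### Representation of bounded sesquilinear forms. -/

section LaxMilgram

/-- A bounded sesquilinear form is given by a bounded operator. -/
lemma exists_clm_inner_eq {E F : Type*} [NormedAddCommGroup E] [InnerProductSpace ℂ E]
    [CompleteSpace E] [NormedAddCommGroup F] [NormedSpace ℂ F] (c : E → F → ℂ)
    (add_left : ∀ h h' y, c (h + h') y = c h y + c h' y)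
    (smul_left : ∀ (a : ℂ) h y, c (a • h) y = starRingEnd ℂ a * c h y)
    (add_right : ∀ h y y', c h (y + y') = c h y + c h y')
    (smul_right : ∀ (a : ℂ) h y, c h (a • y) = a * c h y)
    (C : ℝ) (hC : 0 ≤ C) (bound : ∀ h y, ‖c h y‖ ≤ C * ‖h‖ * ‖y‖) :
    ∃ R : F →L[ℂ] E, ∀ h y, inner ℂ h (R y) = c h y := by
  -- The form is conjugate linear in h, so its conjugate is the functional to which Riesz
  -- representation applies.
  let f : F → StrongDual ℂ E := fun y => LinearMap.mkContinuous
    { toFun := fun h => starRingEnd ℂ (c h y)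
      map_add' := fun h h' => by rw [add_left, map_add]
      map_smul' := fun a h => by rw [smul_left, map_mul, Complex.conj_conj]; rfl } (C * ‖y‖)
    (fun h => by
      rw [mul_right_comm]
      simpa using bound h y)
  let r : F → E := fun y => (InnerProductSpace.toDual ℂ E).symm (f y)
  have hr : ∀ h y, inner ℂ h (r y) = c h y := by
    intro h y
    rw [← inner_conj_symm, InnerProductSpace.toDual_symm_apply]
    exact Complex.conj_conj _
  refine ⟨LinearMap.mkContinuous
    { toFun := r
      map_add' := fun y y' => ext_inner_left ℂ fun h => by
        rw [inner_add_right, hr, hr, hr, add_right]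
      map_smul' := fun a y => ext_inner_left ℂ fun h => by
        rw [RingHom.id_apply, inner_smul_right, hr, hr, smul_right] } C (fun y => ?_), hr⟩
  change ‖(InnerProductSpace.toDual ℂ E).symm (f y)‖ ≤ C * ‖y‖
  rw [LinearIsometryEquiv.norm_map]
  exact LinearMap.mkContinuous_norm_le _ (by positivity) _

end LaxMilgram

/-! ### Coercivity of G_K - E_K, without and with number weights. -/

section Coercivity

variable {d N : ℕ}
variable {𝓗 : Type*} [NormedAddCommGroup 𝓗] [InnerProductSpace ℂ 𝓗] [CompleteSpace 𝓗]
variable {S : SiteData 𝓗}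

lemma Form.BoundedBy.mono {ι : Type*} [Fintype ι] [DecidableEq ι] {A : Finset ι} {v : Form S A}
    {C C' : ℝ} (h : v.BoundedBy C) (hC : C ≤ C') : v.BoundedBy C' := fun x hx y hy =>
  (h x hx y hy).trans (by
    have h1 := formNorm_nonneg (S := S) (A := A) x
    have h2 := formNorm_nonneg (S := S) (A := A) y
    gcongr)

/-- What the proof uses about the potentials of the rectangles inside `K`. -/
structure IsTreated (W : Potentials S d N) (K : Rect d N) : Prop where
  isLocal : ∀ J, (W J).IsLocal
  isBlockDiag : ∀ J, J.sites ⊂ K.sites → 1 ≤ J.size → (W J).IsBlockDiag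
  bounded : ∀ J, J.sites ⊂ K.sites → 1 ≤ J.size →
    (W J).BoundedBy (96 / (J.size : ℝ) ^ (20 * d))

/-- The form of `W_J - ⟪Ω, W_J Ω⟫`. -/
def shifted (W : Potentials S d N) (J : Rect d N) (x y : HTensor (Site d N) 𝓗) : ℂ :=
  (W J).eval x y - (W J).eval (vacuum S) (vacuum S) * inner ℂ x y

open Classical in
-- H⁰_K vanishes in the vacuum, so E_K is t times the sum of the vacuum expectations of the W_J, and
-- subtracting it shifts each potential by its own expectation.
lemma formG_sub_energy (t : ℝ) (W : Potentials S d N) (K : Rect d N)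
    {x y : HTensor (Site d N) 𝓗} (hx : x ∈ formDomain S K.sites)
    (hy : y ∈ formDomain S K.sites) :
    (formG t W K).eval x y - energy t W K * inner ℂ x y =
      ∑ i ∈ K.sites, siteForm S i x y +
        t * ∑ J : Rect d N with J.sites ⊂ K.sites ∧ 1 ≤ J.size, shifted W J x y := by
  have hG : ∀ {x y : HTensor (Site d N) 𝓗}, x ∈ formDomain S K.sites →
      y ∈ formDomain S K.sites → (formG t W K).eval x y = ∑ i ∈ K.sites, siteForm S i x y +
        t * ∑ J : Rect d N with J.sites ⊂ K.sites ∧ 1 ≤ J.size, (W J).eval x y := by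
    intro x y hx hy
    unfold formG
    rw [Form.eval_add, Form.eval_smul, Form.eval_sum, formH0_eval hx hy]
    congr 2
    refine Finset.sum_congr rfl fun J hJ => ?_
    exact (W J).eval_extend (Finset.mem_filter.1 hJ).2.1.1 hx hy
  unfold energy
  rw [hG hx hy, hG (vacuum_mem S _) (vacuum_mem S _),
    Finset.sum_eq_zero fun i _ => siteForm_vacuum i, zero_add]
  unfold shifted
  rw [Finset.sum_sub_distrib, ← Finset.sum_mul]
  ring

open Classical in
/-- The smallness of the interaction: contributions that are bounded rectangle by rectangle sum up to
at most half of `H⁰_K`. -/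
lemma norm_sum_le_half_energy {t : ℝ} (ht : 0 ≤ t) (ht' : t ≤ 1 / (1152 * 2 ^ (7 * d)))
    (K : Rect d N) {x : HTensor (Site d N) 𝓗} (hx : x ∈ formDomain S K.sites)
    (R : Rect d N → ℂ) (hR : ∀ J : Rect d N, J.sites ⊂ K.sites → 1 ≤ J.size →
      ‖R J‖ ≤ 3 * (96 / (J.size : ℝ) ^ (20 * d)) *
        ((J.sites.card + 1) * energyOn S J.sites x)) :
    ‖(t : ℂ) * ∑ J : Rect d N with J.sites ⊂ K.sites ∧ 1 ≤ J.size, R J‖ ≤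
      1 / 2 * energyOn S K.sites x := by
  have he : ∀ i ∈ K.sites, 0 ≤ siteEnergy S i x := fun i hi =>
    siteEnergy_nonneg (formDomain_le S hi hx)
  -- 288 = 3 · 96, and the rest is the bound of `Rect.card_sites_div_le`.
  let c : Rect d N → ℝ := fun J =>
    288 * (2 * 2 ^ (5 * d) * (1 / ((J.size : ℝ) + 1) ^ (4 * d)))
  have hc : ∀ J, 0 ≤ c J := fun J => by simp only [c]; positivity
  have hterm : ∀ J : Rect d N, J.sites ⊂ K.sites → 1 ≤ J.size →
      ‖R J‖ ≤ ∑ i ∈ K.sites, if i ∈ J.sites then c J * siteEnergy S i x else 0 := by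
    intro J hJ hs
    refine (hR J hJ hs).trans ?_
    have h0 : 0 ≤ energyOn S J.sites x := energyOn_nonneg (formDomain_anti S hJ.1 hx)
    have h1 := mul_le_mul_of_nonneg_right (Rect.card_sites_div_le J hs) h0
    have h2 : 3 * (96 / (J.size : ℝ) ^ (20 * d)) * ((J.sites.card + 1) * energyOn S J.sites x) =
        288 * (((J.sites.card : ℝ) + 1) / (J.size : ℝ) ^ (20 * d) * energyOn S J.sites x) := by
      ring
    rw [h2, ← Finset.sum_filter, Finset.filter_mem_eq_inter, Finset.inter_eq_right.2 hJ.1,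
      ← Finset.mul_sum]
    change _ ≤ c J * energyOn S J.sites x
    simp only [c]
    linarith
  rw [norm_mul, Complex.norm_real, Real.norm_eq_abs, abs_of_nonneg ht]
  have hsum : ‖∑ J : Rect d N with J.sites ⊂ K.sites ∧ 1 ≤ J.size, R J‖ ≤
      ∑ i ∈ K.sites, (576 * 2 ^ (7 * d)) * siteEnergy S i x := by
    calc _ ≤ ∑ J : Rect d N with J.sites ⊂ K.sites ∧ 1 ≤ J.size, ‖R J‖ := norm_sum_le _ _
      _ ≤ ∑ J : Rect d N with J.sites ⊂ K.sites ∧ 1 ≤ J.size,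
          ∑ i ∈ K.sites, if i ∈ J.sites then c J * siteEnergy S i x else 0 :=
        Finset.sum_le_sum fun J hJ =>
          hterm J (Finset.mem_filter.1 hJ).2.1 (Finset.mem_filter.1 hJ).2.2
      _ ≤ ∑ J : Rect d N, ∑ i ∈ K.sites, if i ∈ J.sites then c J * siteEnergy S i x else 0 := by
        refine Finset.sum_le_sum_of_subset_of_nonneg (Finset.filter_subset _ _) fun J _ _ =>
          Finset.sum_nonneg fun i hi => ?_
        split_ifs
        · exact mul_nonneg (hc J) (he i hi)
        · exact le_rfl
      -- Regrouping by sites leaves one sum over rectangles through a fixed site. It is at most 288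
      -- · 2 · 2^{5d} · 4^d = 576 · 2^{7d}, and t is chosen so that the product is at most 1/2.
      _ = ∑ i ∈ K.sites, (∑ J : Rect d N with i ∈ J.sites, c J) * siteEnergy S i x := by
        rw [Finset.sum_comm]
        refine Finset.sum_congr rfl fun i _ => ?_
        rw [← Finset.sum_filter, Finset.sum_mul]
      _ ≤ _ := by
        refine Finset.sum_le_sum fun i hi => mul_le_mul_of_nonneg_right ?_ (he i hi)
        simp only [c]
        rw [← Finset.mul_sum, ← Finset.mul_sum]
        have h1 := Rect.sum_inv_size_pow_le i
        calc _ ≤ 288 * (2 * 2 ^ (5 * d) * (4 : ℝ) ^ d) := by gcongr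
          _ = 576 * 2 ^ (7 * d) := by
            rw [show (4 : ℝ) = 2 ^ 2 by norm_num, ← pow_mul, show 7 * d = 5 * d + 2 * d by ring,
              pow_add]
            ring
  rw [← Finset.mul_sum] at hsum
  change _ ≤ _ * energyOn S K.sites x at hsum
  have h0 := energyOn_nonneg hx
  calc _ ≤ (1 / (1152 * 2 ^ (7 * d))) * (576 * 2 ^ (7 * d) * energyOn S K.sites x) :=
        mul_le_mul ht' hsum (norm_nonneg _) (by positivity)
    _ = _ := by
      field_simp
      ring

variable {t : ℝ} {W : Potentials S d N} {K : Rect d N}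

lemma IsTreated.norm_shifted_le (hW : IsTreated W K) {J : Rect d N} (hJ : J.sites ⊂ K.sites)
    (hs : 1 ≤ J.size) {x y : HTensor (Site d N) 𝓗} (hx : x ∈ formDomain S K.sites)
    (hy : y ∈ formDomain S K.sites) :
    ‖shifted W J x y‖ ≤ 3 * (96 / (J.size : ℝ) ^ (20 * d)) *
      (Real.sqrt (energyOn S J.sites x) * Real.sqrt (energyOn S J.sites y)) :=
  Form.norm_eval_sub_vacuum_le (hW.isLocal J) (hW.isBlockDiag J hJ hs) (by positivity)
    (hW.bounded J hJ hs) (formDomain_anti S hJ.1 hx) (formDomain_anti S hJ.1 hy)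

/-- `G_K - E_K ≥ H⁰_K / 2`. -/
lemma IsTreated.half_energy_le (hW : IsTreated W K) (ht : 0 ≤ t)
    (ht' : t ≤ 1 / (1152 * 2 ^ (7 * d))) {x : HTensor (Site d N) 𝓗}
    (hx : x ∈ formDomain S K.sites) :
    1 / 2 * energyOn S K.sites x ≤
      ((formG t W K).eval x x - energy t W K * inner ℂ x x).re := by
  rw [formG_sub_energy t W K hx hx, Finset.sum_congr rfl fun i _ => siteForm_self i x,
    ← Complex.ofReal_sum, Complex.add_re, Complex.ofReal_re]
  have h := norm_sum_le_half_energy ht ht' K hx (fun J => shifted W J x x) fun J hJ hs => by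
    have h0 := energyOn_nonneg (formDomain_anti S hJ.1 hx)
    refine (hW.norm_shifted_le hJ hs hx hx).trans ?_
    rw [Real.mul_self_sqrt h0]
    -- The factor |J| + 1 is not needed without weights; it is inserted so that one summation bound
    -- serves both coercivity estimates.
    have : energyOn S J.sites x ≤ (J.sites.card + 1) * energyOn S J.sites x := by
      nlinarith [Nat.cast_nonneg (α := ℝ) J.sites.card]
    gcongr
  have h2 := (abs_le.1 ((Complex.abs_re_le_norm _).trans h)).1
  change _ ≤ energyOn S K.sites x + _
  linarith

lemma numberRoot_numberWeight (A : Finset (Site d N)) (x : HTensor (Site d N) 𝓗) :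
    numberRoot S A (numberWeight S A x) = x := by
  rw [numberWeight_eq, numberRoot, ← mul_apply_eq_comp, diagOp_mul]
  have : ((fun B : Finset (Site d N) => Real.sqrt (((B ∩ A).card : ℝ) + 1)) *
      fun B => (Real.sqrt (((B ∩ A).card : ℝ) + 1))⁻¹) = 1 := by
    ext B
    have h : Real.sqrt (((B ∩ A).card : ℝ) + 1) ≠ 0 := (Real.sqrt_pos.2 (by positivity)).ne'
    simp [h]
  rw [this, diagOp_one]
  rfl

lemma inner_numberWeight_numberRoot (A : Finset (Site d N)) (x : HTensor (Site d N) 𝓗) :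
    inner ℂ (numberWeight S A x) (numberRoot S A x) = inner ℂ x x := by
  conv_lhs => rw [numberRoot, ← ContinuousLinearMap.adjoint_inner_left, adjoint_diagOp]
  change inner ℂ (numberRoot S A (numberWeight S A x)) x = _
  rw [numberRoot_numberWeight]

/-- The weighted version of `IsTreated.half_energy_le`. -/
lemma IsTreated.half_energy_le_weighted (hW : IsTreated W K) (ht : 0 ≤ t)
    (ht' : t ≤ 1 / (1152 * 2 ^ (7 * d))) {x : HTensor (Site d N) 𝓗}
    (hx : x ∈ formDomain S K.sites) :
    1 / 2 * energyOn S K.sites x ≤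
      ‖(formG t W K).eval (numberWeight S K.sites x) (numberRoot S K.sites x) -
        energy t W K * inner ℂ (numberWeight S K.sites x) (numberRoot S K.sites x)‖ := by
  have hwt : numberWeight S K.sites x ∈ formDomain S K.sites := by
    rw [numberWeight_eq]
    exact diagOp_mem _ hx
  have hrt : numberRoot S K.sites x ∈ formDomain S K.sites := diagOp_mem _ hx
  -- The number weights commute with H_i and cancel, so the free part of the weighted form is still
  -- the full energy of x.
  have hsite : ∀ i ∈ K.sites, siteForm S i (numberWeight S K.sites x)
      (numberRoot S K.sites x) = siteEnergy S i x := by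
    intro i hi
    have hd := formDomain_le S hi hx
    rw [← siteForm_self]
    unfold siteForm
    rw [inner_numberWeight_numberRoot, root_map (X := numberRoot S K.sites)
      (commute_invSqrt_diagOp i _) hd, root_map (X := numberWeight S K.sites)
      (by rw [numberWeight_eq]; exact commute_invSqrt_diagOp i _) hd,
      inner_numberWeight_numberRoot]
  rw [formG_sub_energy t W K hwt hrt, Finset.sum_congr rfl hsite, ← Complex.ofReal_sum]
  have h := norm_sum_le_half_energy ht ht' K hx (fun J => shifted W J
    (numberWeight S K.sites x) (numberRoot S K.sites x)) fun J hJ hs =>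
      Form.norm_eval_sub_vacuum_weighted_le (hW.isLocal J) (hW.isBlockDiag J hJ hs)
        (by positivity) (hW.bounded J hJ hs) K.sites (formDomain_anti S hJ.1 hx)
  have h2 := (abs_le.1 ((Complex.abs_re_le_norm _).trans h)).1
  refine le_trans ?_ ((le_abs_self _).trans (Complex.abs_re_le_norm _))
  rw [Complex.add_re, Complex.ofReal_re]
  change _ ≤ energyOn S K.sites x + _
  linarith

end Coercivity

/-! ### Existence and uniqueness of (G - E)⁻¹ P⁺ V P⁻. -/

section Existence

set_option linter.unusedSectionVars false

variable {ι : Type*} [Fintype ι] [DecidableEq ι]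
variable {𝓗 : Type*} [NormedAddCommGroup 𝓗] [InnerProductSpace ℂ 𝓗] [CompleteSpace 𝓗]
variable (S : SiteData 𝓗) (A : Finset ι)

/-- `D((H⁰_A) ^ (1/2)) ∩ ran P⁺_A` as a Hilbert space: the vector `x` is represented by the family of
`x` and the `(H_i + 1) ^ (1/2) x`, `i ∈ A`. -/
def excitedSpace : Submodule ℂ (PiLp 2 fun _ : Option ι => HTensor ι 𝓗) where
  carrier := {f | (∀ i ∈ A, siteOp i S.invSqrt (f (some i)) = f none) ∧
    (∀ i ∉ A, f (some i) = 0) ∧ projPlus S A (f none) = f none}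
  add_mem' := by
    rintro f g ⟨h1, h2, h3⟩ ⟨h1', h2', h3'⟩
    refine ⟨fun i hi => ?_, fun i hi => ?_, ?_⟩
    · simp [h1 i hi, h1' i hi]
    · simp [h2 i hi, h2' i hi]
    · simp [h3, h3']
  zero_mem' := by simp
  smul_mem' := by
    rintro c f ⟨h1, h2, h3⟩
    refine ⟨fun i hi => ?_, fun i hi => ?_, ?_⟩
    · simp [h1 i hi]
    · simp [h2 i hi]
    · simp [h3]

/-- The square roots enter only through their bounded inverses, so each defining condition is
closed. The form domain becomes a complete space in this way. -/
lemma isClosed_excitedSpace :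
    IsClosed (excitedSpace S A : Set (PiLp 2 fun _ : Option ι => HTensor ι 𝓗)) := by
  have hc : ∀ j : Option ι, Continuous fun f : PiLp 2 fun _ : Option ι => HTensor ι 𝓗 => f j :=
    fun j => (PiLp.proj 2 (fun _ : Option ι => HTensor ι 𝓗) (𝕜 := ℂ) j).continuous
  have e : (excitedSpace S A : Set (PiLp 2 fun _ : Option ι => HTensor ι 𝓗)) =
      (⋂ i ∈ A, {f | siteOp i S.invSqrt (f (some i)) = f none}) ∩
      ((⋂ i ∈ Aᶜ, {f | f (some i) = 0}) ∩ {f | projPlus S A (f none) = f none}) := by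
    ext f
    simp [excitedSpace]
  rw [e]
  refine IsClosed.inter ?_ (IsClosed.inter ?_ ?_)
  · exact isClosed_biInter fun i _ =>
      isClosed_eq ((siteOp i S.invSqrt).continuous.comp (hc _)) (hc _)
  · exact isClosed_biInter fun i _ => isClosed_eq (hc _) continuous_const
  · exact isClosed_eq ((projPlus S A).continuous.comp (hc _)) (hc _)

instance : CompleteSpace (excitedSpace S A) := (isClosed_excitedSpace S A).completeSpace_coe

/-- The vector represented by an element of `excitedSpace`. -/
def excitedVec : excitedSpace S A →L[ℂ] HTensor ι 𝓗 :=
  (PiLp.proj 2 (fun _ : Option ι => HTensor ι 𝓗) none).comp (excitedSpace S A).subtypeL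

variable {S A}

lemma excitedVec_mem (f : excitedSpace S A) : excitedVec S A f ∈ formDomain S A :=
  mem_formDomain.2 fun i hi => mem_domain_sqrtSite.2 ⟨_, f.2.1 i hi⟩

lemma projPlus_excitedVec (f : excitedSpace S A) :
    projPlus S A (excitedVec S A f) = excitedVec S A f := f.2.2.2

lemma norm_sq_excited (f : excitedSpace S A) :
    ‖f‖ ^ 2 = energyOn S A (excitedVec S A f) + (A.card + 1) * ‖excitedVec S A f‖ ^ 2 := by
  have h1 : ‖f‖ ^ 2 = ‖excitedVec S A f‖ ^ 2 +
      ∑ i : ι, ‖(f : PiLp 2 fun _ : Option ι => HTensor ι 𝓗) (some i)‖ ^ 2 := by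
    rw [Submodule.coe_norm, PiLp.norm_sq_eq_of_L2, Fintype.sum_option]
    rfl
  have h2 : ∑ i : ι, ‖(f : PiLp 2 fun _ : Option ι => HTensor ι 𝓗) (some i)‖ ^ 2 =
      ∑ i ∈ A, ‖root S i (excitedVec S A f)‖ ^ 2 := by
    rw [← Finset.sum_subset (Finset.subset_univ A)]
    · exact Finset.sum_congr rfl fun i hi => by
        rw [show root S i (excitedVec S A f) = _ from root_eq (f.2.1 i hi)]
    · intro i _ hi
      rw [f.2.2.1 i hi]
      simp
  rw [h1, h2]
  unfold energyOn siteEnergy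
  rw [Finset.sum_sub_distrib, Finset.sum_const, nsmul_eq_mul]
  ring

lemma formNorm_excitedVec_le (f : excitedSpace S A) :
    formNorm S A (excitedVec S A f) ≤ ‖f‖ := by
  refine Real.sqrt_le_iff.2 ⟨norm_nonneg _, ?_⟩
  rw [norm_sq_excited]
  nlinarith [Nat.cast_nonneg (α := ℝ) A.card, sq_nonneg ‖excitedVec S A f‖,
    mul_nonneg (Nat.cast_nonneg (α := ℝ) A.card) (sq_nonneg ‖excitedVec S A f‖)]

lemma norm_excitedVec_le (f : excitedSpace S A) : ‖excitedVec S A f‖ ≤ ‖f‖ := by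
  refine le_trans (Real.le_sqrt_of_sq_le ?_) (formNorm_excitedVec_le f)
  linarith [energyOn_nonneg (excitedVec_mem f)]

lemma norm_sq_le_energyOn {x : HTensor ι 𝓗} (hx : x ∈ formDomain S A)
    (h : projPlus S A x = x) : ‖x‖ ^ 2 ≤ energyOn S A x := by
  simpa only [h] using norm_sq_projPlus_le hx

/-- On ran P⁺_A the gap lets the energy control the norm of the vector, so the energy alone is
equivalent to the Hilbert norm; this turns `hcoer` into coercivity. -/
lemma norm_sq_excited_le (f : excitedSpace S A) :
    ‖f‖ ^ 2 ≤ (A.card + 2) * energyOn S A (excitedVec S A f) := by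
  have h := norm_sq_le_energyOn (excitedVec_mem f) (projPlus_excitedVec f)
  rw [norm_sq_excited]
  nlinarith [mul_le_mul_of_nonneg_left h (Nat.cast_nonneg (α := ℝ) A.card)]

/-- The vectors in `D((H⁰_A) ^ (1/2)) ∩ ran P⁺_A` are represented in `excitedSpace`. -/
lemma exists_excitedVec_eq {x : HTensor ι 𝓗} (hx : x ∈ formDomain S A)
    (h : projPlus S A x = x) : ∃ f : excitedSpace S A, excitedVec S A f = x := by
  refine ⟨⟨WithLp.toLp 2 fun j : Option ι => j.elim x fun i => if i ∈ A then root S i x else 0,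
    fun i hi => ?_, fun i hi => ?_, h⟩, rfl⟩
  · simp [hi, siteOp_root (formDomain_le S hi hx)]
  · simp [hi]

/-- Existence and uniqueness of `(G - E)⁻¹ P⁺ v P⁻`, by the Lax-Milgram argument. -/
lemma existsUnique_resolventTerm {g v : Form S A} {E : ℂ} {Cg Cv : ℝ} (hCg : 0 ≤ Cg)
    (hCv : 0 ≤ Cv) (hg : g.BoundedBy Cg) (hv : v.BoundedBy Cv)
    (hcoer : ∀ x ∈ formDomain S A,
      1 / 2 * energyOn S A x ≤ (g.eval x x - E * inner ℂ x x).re)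
    (hoff : ∀ z, ∀ u ∈ formDomain S A, projPlus S A u = u →
      g.eval (projMinus S A z) u - E * inner ℂ (projMinus S A z) u = 0) :
    ∃! T, IsResolventTerm g E v T := by
  refine existsUnique_of_exists_of_unique ?_ fun T T' hT hT' => ?_
  · obtain ⟨b, hb⟩ := exists_clm_inner_eq (E := excitedSpace S A) (F := excitedSpace S A)
      (fun h f => g.eval (excitedVec S A h) (excitedVec S A f) -
        E * inner ℂ (excitedVec S A h) (excitedVec S A f))
      (fun h h' f => by
        simp only [map_add]
        rw [g.eval_add_left (excitedVec_mem h) (excitedVec_mem h') (excitedVec_mem f),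
          inner_add_left]
        ring)
      (fun a h f => by
        simp only [map_smul]
        rw [g.eval_smul_left a (excitedVec_mem h) (excitedVec_mem f), inner_smul_left]
        ring)
      (fun h f f' => by
        simp only [map_add]
        rw [g.eval_add_right (excitedVec_mem h) (excitedVec_mem f) (excitedVec_mem f'),
          inner_add_right]
        ring)
      (fun a h f => by
        simp only [map_smul]
        rw [g.eval_smul_right a (excitedVec_mem h) (excitedVec_mem f), inner_smul_right]
        ring)
      (Cg + ‖E‖) (by positivity)
      (fun h f => by
        refine (norm_sub_le _ _).trans ?_
        have h1 := hg _ (excitedVec_mem h) _ (excitedVec_mem f)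
        have h2 : Cg * formNorm S A (excitedVec S A h) * formNorm S A (excitedVec S A f) ≤
            Cg * ‖h‖ * ‖f‖ := by
          gcongr
          · exact formNorm_nonneg _
          · exact formNorm_excitedVec_le h
          · exact formNorm_excitedVec_le f
        have h3 : ‖E * inner ℂ (excitedVec S A h) (excitedVec S A f)‖ ≤ ‖E‖ * ‖h‖ * ‖f‖ := by
          rw [norm_mul, mul_assoc]
          refine mul_le_mul_of_nonneg_left ((norm_inner_le_norm _ _).trans ?_) (norm_nonneg _)
          exact mul_le_mul (norm_excitedVec_le h) (norm_excitedVec_le f) (norm_nonneg _)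
            (norm_nonneg _)
        linarith)
    obtain ⟨R, hR⟩ := exists_clm_inner_eq (E := excitedSpace S A) (F := HTensor ι 𝓗)
      (fun h y => v.eval (excitedVec S A h) (projMinus S A y))
      (fun h h' y => by
        simp only [map_add]
        exact v.eval_add_left (excitedVec_mem h) (excitedVec_mem h') (projMinus_mem A y))
      (fun a h y => by
        simp only [map_smul]
        exact v.eval_smul_left a (excitedVec_mem h) (projMinus_mem A y))
      (fun h y y' => by
        simp only [map_add]
        exact v.eval_add_right (excitedVec_mem h) (projMinus_mem A y) (projMinus_mem A y'))
      (fun a h y => by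
        simp only [map_smul]
        exact v.eval_smul_right a (excitedVec_mem h) (projMinus_mem A y))
      Cv hCv
      (fun h y => by
        refine (hv _ (excitedVec_mem h) _ (projMinus_mem A y)).trans ?_
        rw [formNorm_projMinus]
        gcongr
        · exact formNorm_excitedVec_le h
        · exact norm_projMinus_le y)
    -- b represents G - E on the excited space. The constant combines G - E ≥ H⁰/2 with ‖f‖² ≤ (|A|
    -- + 2) ⟨H⁰⟩.
    have hunit : IsUnit b := by
      refine ContinuousLinearMap.isUnit_of_forall_le_norm_inner_map b
        (c := (1 / (2 * (A.card + 2)) : NNReal)) (by positivity) fun f => ?_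
      have h1 := hcoer _ (excitedVec_mem f)
      have h2 := norm_sq_excited_le f
      rw [← inner_conj_symm, Complex.norm_conj, hb]
      refine le_trans ?_ (h1.trans ((le_abs_self _).trans (Complex.abs_re_le_norm _)))
      push_cast
      rw [mul_one_div, div_le_iff₀ (by positivity)]
      linarith
    obtain ⟨u, rfl⟩ := hunit
    refine ⟨(excitedVec S A).comp (((u⁻¹ : _ˣ) : excitedSpace S A →L[ℂ] excitedSpace S A).comp R),
      fun y => ?_⟩
    set f : excitedSpace S A := ((u⁻¹ : _ˣ) : excitedSpace S A →L[ℂ] excitedSpace S A) (R y)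
      with hf
    have hbf : (u : excitedSpace S A →L[ℂ] excitedSpace S A) f = R y := by
      rw [hf, ← mul_apply_eq_comp, Units.mul_inv]
      rfl
    change excitedVec S A f ∈ _ ∧ projPlus S A (excitedVec S A f) = excitedVec S A f ∧
      ∀ z ∈ formDomain S A, g.eval z (excitedVec S A f) - E * inner ℂ z (excitedVec S A f) = _
    refine ⟨excitedVec_mem f, projPlus_excitedVec f, fun z hz => ?_⟩
    have hpp : projPlus S A (projPlus S A z) = projPlus S A z := by
      have := projMinus_add_projPlus (S := S) A (projPlus S A z)
      rwa [projMinus_projPlus, zero_add] at this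
    obtain ⟨h, hh⟩ := exists_excitedVec_eq (projPlus_mem A hz) hpp
    have e1 := hb h f
    rw [hbf, hR, hh] at e1
    rw [e1]
    -- The equation was solved against test vectors in ran P⁺ only; `hoff` removes the P⁻ component
    -- of a general z.
    have e2 := hoff z _ (excitedVec_mem f) (projPlus_excitedVec f)
    conv_lhs => rw [← projMinus_add_projPlus (S := S) A z]
    rw [g.eval_add_left (projMinus_mem A z) (projPlus_mem A hz) (excitedVec_mem f),
      inner_add_left]
    linear_combination e2
  · ext y
    obtain ⟨h1, h2, h3⟩ := hT y
    obtain ⟨h1', h2', h3'⟩ := hT' y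
    set w := T y - T' y with hw
    have hwm : w ∈ formDomain S A := sub_mem h1 h1'
    have hwp : projPlus S A w = w := by rw [hw, map_sub, h2, h2']
    have hyw : T y = T' y + w := by rw [hw]; abel
    -- The difference w of two solutions, tested against itself, has zero energy by coercivity, and
    -- the gap on ran P⁺ then gives w = 0.
    have e : g.eval w w - E * inner ℂ w w = 0 := by
      have a1 := h3 w hwm
      have a2 := h3' w hwm
      rw [hyw, g.eval_add_right hwm h1' hwm, inner_add_right] at a1
      linear_combination a1 - a2
    have hc := hcoer w hwm
    rw [e, Complex.zero_re] at hc
    have hn := norm_sq_le_energyOn hwm hwp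
    have h0 : ‖w‖ = 0 := by nlinarith [norm_nonneg w]
    exact sub_eq_zero.1 (norm_eq_zero.1 h0)

lemma norm_root_le_formNorm {i : ι} (hi : i ∈ A) {x : HTensor ι 𝓗} (hx : x ∈ formDomain S A) :
    ‖root S i x‖ ≤ formNorm S A x := by
  refine Real.le_sqrt_of_sq_le ?_
  have h := Finset.single_le_sum (f := fun i => siteEnergy S i x)
    (fun i hi => siteEnergy_nonneg (formDomain_le S hi hx)) hi
  change siteEnergy S i x ≤ energyOn S A x at h
  unfold siteEnergy at h
  linarith

lemma norm_le_formNorm {x : HTensor ι 𝓗} (hx : x ∈ formDomain S A) :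
    ‖x‖ ≤ formNorm S A x :=
  Real.le_sqrt_of_sq_le (by linarith [energyOn_nonneg hx])

lemma boundedBy_formH0 : (formH0 S A).BoundedBy (A.card * 2) := by
  intro x hx y hy
  rw [formH0_eval hx hy]
  refine (norm_sum_le _ _).trans ?_
  rw [mul_assoc, mul_assoc, ← nsmul_eq_mul]
  refine Finset.sum_le_card_nsmul _ _ _ fun i hi => ?_
  refine (norm_sub_le _ _).trans ?_
  have h1 := (norm_inner_le_norm (𝕜 := ℂ) (root S i x) (root S i y)).trans
    (mul_le_mul (norm_root_le_formNorm hi hx) (norm_root_le_formNorm hi hy) (norm_nonneg _)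
      (formNorm_nonneg x))
  have h2 := (norm_inner_le_norm (𝕜 := ℂ) x y).trans
    (mul_le_mul (norm_le_formNorm hx) (norm_le_formNorm hy) (norm_nonneg _) (formNorm_nonneg x))
  linarith

lemma formNorm_mono {B : Finset ι} (h : B ⊆ A) {x : HTensor ι 𝓗} (hx : x ∈ formDomain S A) :
    formNorm S B x ≤ formNorm S A x := by
  refine Real.sqrt_le_sqrt ?_
  gcongr
  exact Finset.sum_le_sum_of_subset_of_nonneg h fun i hi _ =>
    siteEnergy_nonneg (formDomain_le S hi hx)

lemma energyOn_projMinus {B : Finset ι} (h : B ⊆ A) (x : HTensor ι 𝓗) :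
    energyOn S B (projMinus S A x) = 0 :=
  Finset.sum_eq_zero fun i hi => by rw [siteEnergy, root_projMinus (h hi), sub_self]

lemma inner_projMinus_eq_zero {u : HTensor ι 𝓗} (hu : projPlus S A u = u) (z : HTensor ι 𝓗) :
    inner ℂ (projMinus S A z) u = 0 := by
  rw [← adjoint_projMinus, ContinuousLinearMap.adjoint_inner_left, ← hu, projMinus_projPlus,
    inner_zero_right]

lemma siteForm_projMinus {i : ι} (hi : i ∈ A) {u : HTensor ι 𝓗} (hum : u ∈ formDomain S A)
    (hu : projPlus S A u = u) (z : HTensor ι 𝓗) : siteForm S i (projMinus S A z) u = 0 := by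
  have hr : projPlus S A (root S i u) = root S i u := by
    conv_rhs => rw [← hu]
    rw [projPlus_eq_diagOp, root_map (commute_invSqrt_diagOp i _) (formDomain_le S hi hum)]
  rw [siteForm, root_projMinus hi, inner_projMinus_eq_zero hu, inner_projMinus_eq_zero hr,
    sub_self]

end Existence

/-! ### The resolvent term of K and its weighted bound. -/

section Main

variable {d N : ℕ}
variable {𝓗 : Type*} [NormedAddCommGroup 𝓗] [InnerProductSpace ℂ 𝓗] [CompleteSpace 𝓗]
variable {S : SiteData 𝓗} {t : ℝ} {W : Potentials S d N} {K : Rect d N}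

open Classical in
-- Only continuity of the form is needed for the Lax-Milgram argument, so the constant may depend on
-- K and t.
lemma IsTreated.exists_boundedBy_formG (hW : IsTreated W K) (t : ℝ) :
    ∃ C, 0 ≤ C ∧ (formG t W K).BoundedBy C := by
  refine ⟨K.sites.card * 2 + ‖(t : ℂ)‖ * ∑ J : Rect d N with J.sites ⊂ K.sites ∧ 1 ≤ J.size,
    96 / (J.size : ℝ) ^ (20 * d), by positivity, fun x hx y hy => ?_⟩
  have hx0 := formNorm_nonneg (S := S) (A := K.sites) x
  have hy0 := formNorm_nonneg (S := S) (A := K.sites) y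
  unfold formG
  rw [Form.eval_add, Form.eval_smul, Form.eval_sum]
  refine (norm_add_le _ _).trans ?_
  rw [add_mul, add_mul, norm_mul, mul_assoc ‖(t : ℂ)‖, mul_assoc ‖(t : ℂ)‖, mul_assoc (∑ _ ∈ _, _),
    Finset.sum_mul]
  refine add_le_add (boundedBy_formH0 x hx y hy)
    (mul_le_mul_of_nonneg_left ((norm_sum_le _ _).trans ?_) (norm_nonneg _))
  refine Finset.sum_le_sum fun J hJ => ?_
  obtain ⟨hJ1, hJ2⟩ := (Finset.mem_filter.1 hJ).2
  rw [(W J).eval_extend hJ1.1 hx hy]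
  refine (hW.bounded J hJ1 hJ2 x (formDomain_anti S hJ1.1 hx) y
    (formDomain_anti S hJ1.1 hy)).trans ?_
  rw [mul_assoc]
  refine mul_le_mul_of_nonneg_left ?_ (by positivity)
  exact mul_le_mul (formNorm_mono hJ1.1 hx) (formNorm_mono hJ1.1 hy) (formNorm_nonneg _) hx0

lemma IsTreated.existsUnique_resolventTerm (hW : IsTreated W K) (ht : 0 ≤ t)
    (ht' : t ≤ 1 / (1152 * 2 ^ (7 * d))) {C : ℝ} (hC : 0 ≤ C) (hK : (W K).BoundedBy C) :
    ∃! T, IsResolventTerm (formG t W K) (energy t W K) (W K) T := by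
  obtain ⟨Cg, hCg, hg⟩ := hW.exists_boundedBy_formG t
  refine LieSchwinger.existsUnique_resolventTerm hCg hC hg hK
    (fun x hx => hW.half_energy_le ht ht' hx) fun z u hum hu => ?_
  -- G - E does not couple ran P⁻_K to ran P⁺_K: a vector P⁻_K z carries no energy in any
  -- subrectangle, and each shifted potential is bounded by energies.
  rw [formG_sub_energy t W K (projMinus_mem _ z) hum,
    Finset.sum_eq_zero fun i hi => siteForm_projMinus hi hum hu z,
    Finset.sum_eq_zero fun J hJ => ?_, mul_zero, add_zero]
  obtain ⟨hJ1, hJ2⟩ := (Finset.mem_filter.1 hJ).2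
  have h := hW.norm_shifted_le hJ1 hJ2 (projMinus_mem _ z) hum
  rw [energyOn_projMinus hJ1.1, Real.sqrt_zero, zero_mul, mul_zero] at h
  exact norm_le_zero_iff.1 h

/-- The weighted bound on `(G_K - E_K)⁻¹ P⁺_K W_K P⁻_K`. -/
lemma IsTreated.weightedNorm_le (hW : IsTreated W K) (ht : 0 ≤ t)
    (ht' : t ≤ 1 / (1152 * 2 ^ (7 * d))) {T : HTensor (Site d N) 𝓗 →L[ℂ] HTensor (Site d N) 𝓗}
    (hT : IsResolventTerm (formG t W K) (energy t W K) (W K) T) :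
    weightedNorm S K.sites T ≤ ENNReal.ofReal 4 * (W K).doublyWeightedNorm := by
  have h4 : ENNReal.ofReal 4 ≠ 0 := by simp
  have h4' : ENNReal.ofReal 4 ≠ ⊤ := ENNReal.ofReal_ne_top
  -- Moving the factor 4 to the left leaves a bare infimum on the right, so an arbitrary admissible
  -- C can be treated.
  rw [mul_comm, ← ENNReal.div_le_iff_le_mul (Or.inl h4) (Or.inl h4')]
  refine le_sInf fun C hC => ?_
  rw [ENNReal.div_le_iff_le_mul (Or.inl h4) (Or.inl h4'), mul_comm]
  rcases eq_or_ne C ⊤ with rfl | hCt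
  · rw [ENNReal.mul_top h4]
    exact le_top
  refine sInf_le fun y => ?_
  obtain ⟨hu, hup, hres⟩ := hT y
  set u := T y
  clear_value u
  set w := numberWeight S K.sites u with hw
  have hwm : w ∈ formDomain S K.sites := by
    rw [hw, numberWeight_eq]
    exact diagOp_mem _ hu
  have hMw : numberWeight S K.sites w ∈ formDomain S K.sites := by
    rw [numberWeight_eq]
    exact diagOp_mem _ hwm
  have hwp : projPlus S K.sites w = w := by
    conv_rhs => rw [hw, ← hup]
    rw [hw, numberWeight_eq, projPlus_eq_diagOp, ← mul_apply_eq_comp, ← mul_apply_eq_comp,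
      diagOp_mul, diagOp_mul, mul_comm]
  -- As w = M u with M = (π_K + 1)^{-1/2}, the right entry M⁻¹ w is u = T y, so the equation for T
  -- y, tested with M w, turns the weighted form into the matrix element of the potential.
  have h1 := hW.half_energy_le_weighted ht ht' hwm
  rw [hw, numberRoot_numberWeight, ← hw, hres _ hMw] at h1
  have h2 := hC w hwm y
  rw [weight_of_mem hwm] at h2 ⊢
  change _ ≤ C * ENNReal.ofReal (formNorm S K.sites w) * ‖y‖ₑ at h2
  change ENNReal.ofReal (formNorm S K.sites w) ≤ _
  obtain ⟨c, rfl⟩ : ∃ c : NNReal, C = c := ⟨C.toNNReal, (ENNReal.coe_toNNReal hCt).symm⟩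
  have hF := formNorm_nonneg (S := S) (A := K.sites) w
  rw [← ofReal_norm, ← ofReal_norm, ← ENNReal.ofReal_coe_nnreal,
    ← ENNReal.ofReal_mul (by positivity), ← ENNReal.ofReal_mul (by positivity),
    ENNReal.ofReal_le_ofReal_iff (by positivity)] at h2
  rw [← ofReal_norm, ← ENNReal.ofReal_coe_nnreal, ← ENNReal.ofReal_mul (by positivity),
    ← ENNReal.ofReal_mul (by positivity)]
  refine ENNReal.ofReal_le_ofReal ?_
  have h3 : formNorm S K.sites w ^ 2 ≤ 2 * energyOn S K.sites w := by
    have hn := norm_sq_le_energyOn hwm hwp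
    rw [formNorm, Real.sq_sqrt (by linarith [energyOn_nonneg hwm, sq_nonneg ‖w‖])]
    linarith
  have h5 : formNorm S K.sites w ^ 2 ≤ (4 * c * ‖y‖) * formNorm S K.sites w := by
    linarith
  -- `h5` reads F² ≤ 4c‖y‖ F; dividing by F requires F > 0, and F = 0 is trivial.
  rcases hF.eq_or_lt with h0 | h0
  · rw [← h0]
    positivity
  · rw [sq] at h5
    exact le_of_mul_le_mul_right h5 h0

/-- The hypotheses of `IsTreated` hold for the effective potentials under the inductive bounds. -/
lemma isTreated_effective {V : Potentials S d N} (hV : IsInteraction V) (ht : 0 ≤ t)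
    (ht1 : t ≤ 1) {a b : Rect d N → Rect d N} {s : Rect d N} (hs : s ⋖ K)
    (hind : ∀ J, J ≤ K → 1 ≤ J.size →
      InductiveBounds t s J (a J) (b J) (effective t V s J)) :
    IsTreated (effective t V s) K := by
  -- J precedes K and s is the immediate predecessor of K, so J has been treated by step s and the
  -- last of the four inductive bounds applies.
  have hle : ∀ J : Rect d N, J.sites ⊂ K.sites → J < K ∧ J ≤ s := by
    intro J hJ
    have hlt : J < K := Rect.lt_of_size_lt (Rect.size_lt_of_ssubset hJ)
    refine ⟨hlt, ?_⟩
    rcases Rect.lt_trichotomy' J s with h | h | h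
    · exact Or.inr h
    · exact Or.inl h
    · exact absurd hlt (hs.2 h)
  refine ⟨isLocal_effectiveAux t hV _, fun J hJ hJs => ?_, fun J hJ hJs => ?_⟩
  · refine isBlockDiag_effectiveAux t V _ J hJs ?_
    rcases (hle J hJ).2 with h | h
    · rw [h]
    · exact (Rect.index_lt h).le
  · have hr : (1 : ℝ) ≤ J.size := by exact_mod_cast hJs
    refine (Form.boundedBy_of_normH0_le (by positivity)
      ((hind J (Or.inr (hle J hJ).1) hJs).final (hle J hJ).2)).mono ?_
    rw [mul_div_assoc']
    gcongr
    -- The power of t in the inductive bound is estimated by 1; the smallness comes from the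
    -- explicit factor t in G_K.
    refine mul_le_of_le_one_right (by norm_num) (Real.rpow_le_one ht ht1 ?_)
    have : 0 ≤ (J.size : ℝ) - 1 := by linarith
    positivity

/-- For K itself only finiteness matters, whichever regime s falls in: it makes the right-hand side
of the equation for T a bounded form. -/
lemma exists_boundedBy_of_inductiveBounds (ht : 0 ≤ t) {s a b : Rect d N} (hs : s < K)
    {v : Form S K.sites} (h : InductiveBounds t s K a b v) : ∃ C, 0 ≤ C ∧ v.BoundedBy C := by
  have hb : ∀ c : ℝ, 0 ≤ c → v.normH0 ≤ ENNReal.ofReal c → ∃ C, 0 ≤ C ∧ v.BoundedBy C :=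
    fun c hc h => ⟨c, hc, Form.boundedBy_of_normH0_le hc h⟩
  by_cases ha : s < a
  · exact hb _ (by positivity) (h.small ha)
  have ha' : a ≤ s := by
    rcases Rect.lt_trichotomy' a s with h | h | h
    · exact Or.inr h
    · exact Or.inl h
    · exact absurd h ha
  by_cases hsb : s < b
  · exact hb _ (by positivity) (h.middle ha' hsb)
  have hb' : b ≤ s := by
    rcases Rect.lt_trichotomy' b s with h | h | h
    · exact Or.inr h
    · exact Or.inl h
    · exact absurd h hsb
  exact hb _ (by positivity) (h.large hb' hs)

end Main

end

end LieSchwinger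

open LieSchwinger in
/-- For a coupling `t` that is small depending on `d` only, the inductive bounds in the step `s`
preceding `K` imply
`‖[H⁰_K]₁^{1/2} [π_K]₁^{-1/2} (G_K - E_K)⁻¹ P⁺_K V_K P⁻_K‖ ≤
C_d ‖[π_K]₁^{-1/2} [H⁰_K]₁^{-1/2} P⁺_K V_K P⁻_K‖`, where `V` are the potentials in step `s`. -/
theorem lemma4p3 (d : ℕ) (hd : 2 ≤ d) :
    ∃ t_d : ℝ, 0 < t_d ∧ ∃ C_d : ℝ, 0 < C_d ∧
      ∀ (𝓗 : Type*) [NormedAddCommGroup 𝓗] [InnerProductSpace ℂ 𝓗] [CompleteSpace 𝓗]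
        (S : SiteData 𝓗) (N : ℕ) (V : Potentials S d N) (_ : IsInteraction V)
        (t : ℝ) (_ : 0 ≤ t) (_ : t < t_d)
        (a b : Rect d N → Rect d N)
        (_ : ∀ J, 1 ≤ J.size → (a J).size = ⌊(J.size : ℝ) ^ (1 / 4 : ℝ)⌋₊)
        (_ : ∀ J, 1 ≤ J.size → (b J).size = J.size - ⌊(J.size : ℝ) ^ (1 / 4 : ℝ)⌋₊)
        (s K : Rect d N) (_ : s ⋖ K) (_ : 1 ≤ K.size)
        (_ : ∀ J, J ≤ K → 1 ≤ J.size →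
          InductiveBounds t s J (a J) (b J) (effective t V s J)),
        let W := effective t V s
        (∃! T, IsResolventTerm (formG t W K) (energy t W K) (W K) T) ∧
        weightedNorm S K.sites (resolventTerm (formG t W K) (energy t W K) (W K)) ≤
          ENNReal.ofReal C_d * (W K).doublyWeightedNorm := by
  -- The threshold makes t · 576 · 2^{7d} ≤ 1/2. The constant 4 is 2 from G_K - E_K ≥ H⁰_K / 2 times
  -- 2 from H⁰_K + 1 ≤ 2 H⁰_K on ran P⁺_K.
  refine ⟨1 / (1152 * 2 ^ (7 * d)), by positivity, 4, by norm_num, ?_⟩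
  intro 𝓗 _ _ _ S N V hV t ht htd a b _ _ s K hs hK hind W
  have ht1 : t ≤ 1 := by
    refine htd.le.trans ?_
    rw [div_le_one (by positivity)]
    have : (1 : ℝ) ≤ 2 ^ (7 * d) := one_le_pow₀ (by norm_num)
    linarith
  have hW : IsTreated W K := isTreated_effective hV ht ht1 hs hind
  obtain ⟨C, hC, hWK⟩ := exists_boundedBy_of_inductiveBounds ht hs.1 (hind K (Or.inl rfl) hK)
  have hex := hW.existsUnique_resolventTerm ht htd.le hC hWK
  refine ⟨hex, ?_⟩
  rw [resolventTerm, dif_pos hex]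
  exact hW.weightedNorm_le ht htd.le hex.choose_spec.1
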